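/- Let $0\le\gamma<1$ and let $B(|\zeta_*-\zeta|,\theta)=|\zeta_*-\zeta|^{\gamma}\beta(\theta)$ be a nontrivial cutoff cross section, that is, $\beta$ is measurable, $0\le\beta(\theta)\le C\cos\theta\sin\theta$ on $[0,\pi/2]$ for some constant $C$, and $\beta_0:=\int_0^{\pi/2}\beta(\theta)\,d\theta>0$. Let $L=-\nu+K$ be the corresponding collision operator linearized around the Maxwellian $\pi^{-3/2}e^{-|\zeta|^2}$ (normalized so that $\nu$ is as follows), with collision frequency $\nu(|\zeta|)=\beta_0\int_{\mathbb R^3}e^{-|\eta|^2}|\eta-\zeta|^{\gamma}\,d\eta$ and integral part $K(f)(x,\zeta)=\int_{\mathbb R^3}k(\zeta,\zeta_*)f(x,\zeta_*)\,d\zeta_*$. Explicitly, $k$ is Grad's kernel: for $v=\zeta_*-\zeta\neq0$ and $\theta_w=\arctan(|w|/|v|)$, $$k(\zeta,\zeta_*)=\frac{1}{2\pi|v|^{2}}\int_{w\perp v}\frac{\beta(\theta_w)+\beta(\tfrac{\pi}{2}-\theta_w)}{\sin\theta_w}\,(|v|^2+|w|^2)^{\gamma/2}\,e^{-\frac12|\zeta_*+w|^2-\frac12|\zeta+w|^2}\,dw-\beta_0|v|^{\gamma}e^{-\frac12(|\zeta|^2+|\zeta_*|^2)}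 .$$ Let $\Omega\subset\mathbb R^3$ be a bounded convex domain with $C^1$ boundary. For $x\in\Omega$, let $\tau_-(x,\zeta)$ be the time at which the backward trajectory $t\mapsto x-t\zeta$ reaches $\partial\Omega$, and $p(x,\zeta)=x-\tau_-(x,\zeta)\zeta$. A function $f$ is called a solution of $\zeta\cdot\nabla f=L(f)$ in $\Omega$ if, for almost every $(x,\zeta)\in\Omega\times\mathbb R^3$, $$f(x,\zeta)=f(p(x,\zeta),\zeta)e^{-\nu(|\zeta|)\tau_-(x,\zeta)}+\int_0^{\tau_-(x,\zeta)}e^{-\nu(|\zeta|)s}K(f)(x-s\zeta,\zeta)\,ds .$$ For $x\in\Omega$ and $\zeta\in\mathbb R^3$ put $$G(x,\zeta)=\int_{\mathbb R^3}\int_0^{\tau_-(x,\zeta')}k(\zeta,\zeta')\,e^{-\nu(|\zeta'|)t}\,K(f)(x-t\zeta',\zeta')\,dt\,d\zeta' .$$ Then there is a constant $C_3$ depending only on $\Omega$, $\gamma$ and $\beta$ such that, for every solution $f\in L^\infty(\Omega\times\mathbb R^3)$: 1. for all $x_0\in\Omega$ and $\zeta\in\mathbb R^3$, $$G(x_0,\zeta)=\int_0^\infty\int_{\Omega}k\Big(\zeta,\tfrac{(x_0-y)\rho}{|x_0-y|}\Big)e^{-\nu(\rho)\frac{|x_0-y|}{\rho}}K(f)\Big(y,\tfrac{(x_0-y)\rho}{|x_0-y|}\Big)\frac{\rho}{|x_0-y|^2}\,dy\,d\rho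 ,$$ where the integral converges absolutely; 2. for all $x_0,x_1\in\Omega$ and $\zeta\in\mathbb R^3$, $$|G(x_0,\zeta)-G(x_1,\zeta)|\le C_3\,\|f\|_{L^\infty_{x,\zeta}}\,|x_0-x_1|^{1/2}.$$ -/

import Mathlib

open MeasureTheory Set
open scoped ENNReal

noncomputable section

namespace LinBoltzmann

/-- Three dimensional Euclidean space, used both for positions and for velocities. -/
abbrev R3 : Type := EuclideanSpace ℝ (Fin 3)

/-- The cross section `B(|ζ_* - ζ|, θ) = |ζ_* - ζ| ^ γ * β θ` of a cutoff hard potential gas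
(`0 < γ < 1`) or of a cutoff Maxwellian gas (`γ = 0`). It is nontrivial and satisfies Grad's
angular cutoff `0 ≤ β θ ≤ C cos θ sin θ` on `[0, π/2]`. -/
structure IsCutoffCrossSection (γ : ℝ) (β : ℝ → ℝ) : Prop where
  gamma_nonneg : 0 ≤ γ
  gamma_lt_one : γ < 1
  measurable_beta : Measurable β
  cutoff : ∃ C : ℝ, ∀ θ ∈ Icc (0 : ℝ) (Real.pi / 2),
    0 ≤ β θ ∧ β θ ≤ C * (Real.cos θ * Real.sin θ)
  nontrivial : 0 < ∫ θ in (0 : ℝ)..(Real.pi / 2), β θ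

/-- `β₀ = ∫_0^{π/2} β(θ) dθ`. -/
def beta0 (β : ℝ → ℝ) : ℝ := ∫ θ in (0 : ℝ)..(Real.pi / 2), β θ

/-- The collision frequency `ν(|ζ|) = β₀ ∫ exp(-|η|²) |η - ζ|^γ dη`. It depends on `ζ` only
through `|ζ|`. -/
def nu (γ : ℝ) (β : ℝ → ℝ) (ζ : R3) : ℝ :=
  beta0 β * ∫ η : R3, Real.exp (-‖η‖ ^ 2) * ‖η - ζ‖ ^ γ

/-- Square root of the (unnormalized) Maxwellian, `exp(-|ζ|²/2)`. -/
def sqrtMaxwellian (ζ : R3) : ℝ := Real.exp (-‖ζ‖ ^ 2 / 2)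

/-- Kernel of the part of `L` that comes from the loss term `-F F_*`. -/
def lossKernel (γ : ℝ) (β : ℝ → ℝ) (ζ η : R3) : ℝ :=
  beta0 β * ‖ζ - η‖ ^ γ * sqrtMaxwellian ζ * sqrtMaxwellian η

/-- Kernel of the part of `L` that comes from the gain term `F' F'_*`.

With `E = sqrtMaxwellian` and the post-collisional velocities
`ζ' = ζ + ((ζ_* - ζ) · α) α`, `ζ'_* = ζ_* - ((ζ_* - ζ) · α) α`, where the unit vector `α` makes
the angle `θ ∈ (0, π/2)` with `ζ_* - ζ` and has azimuth `ε`, the gain part of `L g` at `ζ` is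
`(2π)⁻¹ ∫ ∫_0^{2π} ∫_0^{π/2} E(ζ_*) (E(ζ'_*) g(ζ') + E(ζ') g(ζ'_*)) |ζ_* - ζ|^γ β(θ) dθ dε dζ_*`.
Replacing `α` by the orthogonal unit vector in the plane of `α` and `ζ_* - ζ` exchanges `ζ'` with
`ζ'_*` and `θ` with `π/2 - θ`, so both terms are of the first kind, with angular factor
`β(θ) + β(π/2 - θ)`. Put `v = ζ' - ζ` and `w = ζ_* - ζ'`. Then `w ⟂ v`,
`|ζ_* - ζ|² = |v|² + |w|²`, `tan θ = |w| / |v|`, and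
`dθ dε dζ_* = (|v|² sin θ)⁻¹ dw dv` with `dw` the area on the plane orthogonal to `v`.
The gain part of `L g` is therefore `∫ gainKernel γ β ζ η * g η dη`, with `η = ζ' = ζ + v`,
`ζ_* = η + w` and `ζ'_* = ζ + w`. -/
def gainKernel (γ : ℝ) (β : ℝ → ℝ) (ζ η : R3) : ℝ :=
  (2 * Real.pi)⁻¹ * (‖η - ζ‖ ^ 2)⁻¹ *
    ∫ w : ((Submodule.span ℝ {η - ζ})ᗮ : Submodule ℝ R3),
      (β (Real.arctan (‖w‖ / ‖η - ζ‖)) + β (Real.pi / 2 - Real.arctan (‖w‖ / ‖η - ζ‖))) /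
          Real.sin (Real.arctan (‖w‖ / ‖η - ζ‖)) *
        (‖η - ζ‖ ^ 2 + ‖w‖ ^ 2) ^ (γ / 2) *
        (sqrtMaxwellian (η + (w : R3)) * sqrtMaxwellian (ζ + (w : R3)))

/-- The collision kernel `k(ζ, ζ_*)` in `L g = -ν g + K g`. -/
def collisionKernel (γ : ℝ) (β : ℝ → ℝ) (ζ η : R3) : ℝ :=
  gainKernel γ β ζ η - lossKernel γ β ζ η

/-- `K(f)(x, ζ) = ∫ k(ζ, ζ_*) f(x, ζ_*) dζ_*`. -/
def collK (γ : ℝ) (β : ℝ → ℝ) (f : R3 → R3 → ℝ) (x ζ : R3) : ℝ :=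
  ∫ η : R3, collisionKernel γ β ζ η * f x η

/-- The domain `Ω` has a boundary of class `C¹`: near each boundary point it is the sublevel set
of a `C¹` function with nonvanishing gradient. -/
def HasC1Boundary (Ω : Set R3) : Prop :=
  ∀ X ∈ frontier Ω, ∃ U : Set R3, IsOpen U ∧ X ∈ U ∧ ∃ Φ : R3 → ℝ,
    ContDiffOn ℝ 1 Φ U ∧ fderiv ℝ Φ X ≠ 0 ∧ Ω ∩ U = {z ∈ U | Φ z < 0}

/-- Travelling time `τ_-(x, ζ)` of the backward trajectory from `x ∈ Ω` with velocity `ζ` to the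
boundary. (Its value at `ζ = 0`, where the trajectory never leaves `Ω`, is irrelevant.) -/
def tauMinus (Ω : Set R3) (x ζ : R3) : ℝ := sInf {t : ℝ | 0 ≤ t ∧ x - t • ζ ∉ Ω}

/-- The boundary point `p(x, ζ)` that the backward trajectory from `x` with velocity `ζ` hits. -/
def exitPoint (Ω : Set R3) (x ζ : R3) : R3 := x - tauMinus Ω x ζ • ζ

/-- `f` is a solution of the stationary linearized Boltzmann equation `ζ · ∇f = L f` in `Ω`:
the integrated equation along characteristics holds for almost every `(x, ζ) ∈ Ω × ℝ³`. The
values of `f` on the boundary of `Ω` are the boundary data. -/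
def IsStationarySolution (γ : ℝ) (β : ℝ → ℝ) (Ω : Set R3) (f : R3 → R3 → ℝ) : Prop :=
  ∀ᵐ q : R3 × R3 ∂(volume.restrict (Ω ×ˢ (univ : Set R3))),
    f q.1 q.2 =
      f (exitPoint Ω q.1 q.2) q.2 * Real.exp (-nu γ β q.2 * tauMinus Ω q.1 q.2) +
        ∫ s in (0 : ℝ)..(tauMinus Ω q.1 q.2),
          Real.exp (-nu γ β q.2 * s) * collK γ β f (q.1 - s • q.2) q.2

/-- `f ∈ L^∞_{x,ζ}`. -/
def MemLinf (Ω : Set R3) (f : R3 → R3 → ℝ) : Prop :=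
  MemLp (fun q : R3 × R3 => f q.1 q.2) ∞ (volume.restrict (Ω ×ˢ (univ : Set R3)))

/-- The norm of `L^∞_{x,ζ}`, the essential supremum of `|f|` over `Ω × ℝ³`. -/
def normLinf (Ω : Set R3) (f : R3 → R3 → ℝ) : ℝ :=
  (eLpNorm (fun q : R3 × R3 => f q.1 q.2) ∞ (volume.restrict (Ω ×ˢ (univ : Set R3)))).toReal

/-- The inner integral
`G(x, ζ) = ∫ ∫_0^{τ_-(x,ζ')} k(ζ, ζ') exp(-ν(|ζ'|) t) K(f)(x - ζ' t, ζ') dt dζ'`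
of the term `III = ∫_0^{τ_-(x,ζ)} exp(-ν(|ζ|) s) G(x - ζ s, ζ) ds` of the twice iterated integral
equation. -/
def G (γ : ℝ) (β : ℝ → ℝ) (Ω : Set R3) (f : R3 → R3 → ℝ) (x ζ : R3) : ℝ :=
  ∫ ζ' : R3, ∫ t in (0 : ℝ)..(tauMinus Ω x ζ'),
    collisionKernel γ β ζ ζ' * Real.exp (-nu γ β ζ' * t) * collK γ β f (x - t • ζ') ζ'

/-- The velocity of speed `ρ` in the direction from `y` to `x`, `(x - y) ρ / |x - y|`. -/
def dirVel (x y : R3) (ρ : ℝ) : R3 := (ρ / ‖x - y‖) • (x - y)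

/-- The integrand of `G` in the variables `ρ > 0` (speed) and `y ∈ Ω` (space):
`k(ζ, ζ') exp(-ν(|ζ'|) |x - y| / ρ) K(f)(y, ζ') ρ / |x - y|²` with `ζ' = (x - y) ρ / |x - y|`. -/
def spaceIntegrand (γ : ℝ) (β : ℝ → ℝ) (f : R3 → R3 → ℝ) (x ζ : R3) (ρ : ℝ) (y : R3) : ℝ :=
  collisionKernel γ β ζ (dirVel x y ρ) *
    Real.exp (-nu γ β (dirVel x y ρ) * (‖x - y‖ / ρ)) *
    collK γ β f y (dirVel x y ρ) * (ρ / ‖x - y‖ ^ 2)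

end LinBoltzmann

end

/-!
In `G` the velocity `ζ'` and the time `t` are replaced by the speed `ρ = |ζ'|` and the position
`y = x - t ζ'`. In polar coordinates for `ζ'` this has the Jacobian `ρ / |x - y|²`
(`measurePreserving_speedPosition`), and since `Ω` is convex the backward trajectory is in `Ω`
exactly for `0 < t < τ_-` (`mem_Ioo_tauMinus_iff`). This is the first claim, once the integrand is
shown to be integrable. In the new variables the base point `x` enters only through `r = |x - y|`
and the direction of `x - y`, so a bound of the integrand for fixed `(ρ, y)` gives the second
claim without any regularity of `f` in position.

The velocity factors need care because `β` is only measurable. For `v = η - ζ`, the plane `v^⊥` in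
Grad's kernel is parametrized isometrically with the first axis along the projection of `ζ`, and
scaled by `|v|`. Then `β` no longer depends on `ζ` and `η`, and these enter only through `|v|`,
`|ζ|`, `|η|` and the area `p` of the parallelogram they span (`gainKernel_eq`). After completing
the square the exponent is the squared norm of an explicit point of `ℝ⁴`
(`gainKernel_eq_integral_expPoint`). This gives measurability, symmetry and
* `|k(ζ, η)| ≤ C |v|⁻¹ exp (-|v|² / 16)` (`exists_abs_collisionKernel_le`),
* for `|η₀| = |η₁|`, a bound of `k(ζ, η₀) - k(ζ, η₁)` by `((1 + |ζ|) |η₀ - η₁|) ^ (1 / 2)` times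
  singularities of order `3 / 2` with Gaussian decay (`exists_abs_collisionKernel_sub_le`), and
  thus the same half-Hölder continuity of `K f` in the velocity, along spheres around the origin
  (`exists_integral_collisionKernel_sub_le`).

For two base points `x₀`, `x₁` the velocities `ρ (x_i - y) / r_i` have the same speed and differ
by at most `2 ρ |x₀ - x₁| / r_i`. Interpolating each of the four factors of the integrand to the
power `1 / 2` bounds the difference of the integrands by `|x₀ - x₁| ^ (1 / 2)` times
`∑ ρ² Ψ(ζ, ζ_i) r_i ^ (-5 / 2)`, where `Ψ` has singularities of order at most `5 / 2`
at `ζ_i = 0` and at `ζ_i = ζ`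
(`exists_abs_spaceIntegrand_sub_le`). Undoing the change of variables separates this
into a velocity integral of `Ψ` and `∫_0^R r ^ (-1 / 2) dr`, both finite uniformly in `ζ` and
`x_i` (`exists_integral_dominator_le`).
-/

namespace LinBoltzmann

/-! ### Half-Hölder estimates for Gaussians -/

/-- Half-Hölder continuity of `r ↦ exp (-r²)`, with a constant that keeps Gaussian decay. -/
theorem abs_exp_neg_sq_sub_le_of_le {a b : ℝ} (ha : 0 ≤ a) (hab : a ≤ b) :
    |Real.exp (-a ^ 2) - Real.exp (-b ^ 2)| ≤ 2 * √|a - b| * Real.exp (-a ^ 2 / 2) := by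
  have hd : 0 ≤ b - a := sub_nonneg.2 hab
  set d := b - a with hdd
  have hb : b = a + d := by simp [hdd]
  rw [abs_sub_comm a b, ← hdd, abs_of_nonneg hd]
  have hle : Real.exp (-b ^ 2) ≤ Real.exp (-a ^ 2) := by
    apply Real.exp_le_exp.2; nlinarith
  rw [abs_of_nonneg (sub_nonneg.2 hle)]
  have hfac : Real.exp (-b ^ 2) = Real.exp (-a ^ 2) * Real.exp (-(2 * a * d + d ^ 2)) := by
    rw [← Real.exp_add, hb]; congr 1; ring
  have hhalf : Real.exp (-a ^ 2) = Real.exp (-a ^ 2 / 2) * Real.exp (-a ^ 2 / 2) := by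
    rw [← Real.exp_add]; congr 1; ring
  have h1 : 1 - (2 * a * d + d ^ 2) ≤ Real.exp (-(2 * a * d + d ^ 2)) := by
    have := Real.add_one_le_exp (-(2 * a * d + d ^ 2)); linarith
  have h0 := Real.exp_pos (-(2 * a * d + d ^ 2))
  have hs : 0 ≤ √d := Real.sqrt_nonneg d
  have hsq : √d ^ 2 = d := Real.sq_sqrt hd
  -- the exponent increases by `2 a d + d²`, and `1 - exp (-x) ≤ min 1 x`
  have hkey : 1 - Real.exp (-(2 * a * d + d ^ 2)) ≤ √d * (1 + a) := by
    by_cases hd1 : √d * (1 + a) ≤ 1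
    · have hx : (1 - Real.exp (-(2 * a * d + d ^ 2))) ≤ 2 * a * d + d ^ 2 := by linarith
      have hs1 : √d ≤ 1 := by nlinarith
      have hsa : √d * a ≤ 1 := by nlinarith
      by_cases hs2 : √d * (2 * a + d) ≤ 1 + a
      · calc _ ≤ 2 * a * d + d ^ 2 := hx
          _ = √d * (√d * (2 * a + d)) := by linear_combination (-2 * a - d) * hsq
          _ ≤ _ := by gcongr
      · exfalso
        apply hs2
        have : √d * d ≤ 1 := by nlinarith
        nlinarith
    · linarith
  -- the factor `1 + a` is absorbed by half of the Gaussian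
  have hexp : (1 + a) * Real.exp (-a ^ 2 / 2) ≤ 2 := by
    have h2 : 1 + a ≤ 2 * Real.exp (a ^ 2 / 2) := by
      have := Real.add_one_le_exp (a ^ 2 / 2); nlinarith [sq_nonneg (a - 1)]
    have h3 : Real.exp (a ^ 2 / 2) * Real.exp (-a ^ 2 / 2) = 1 := by
      rw [← Real.exp_add]; simp [neg_div]
    nlinarith [Real.exp_pos (-a ^ 2 / 2)]
  calc Real.exp (-a ^ 2) - Real.exp (-b ^ 2)
      = Real.exp (-a ^ 2) * (1 - Real.exp (-(2 * a * d + d ^ 2))) := by rw [hfac]; ring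
    _ ≤ Real.exp (-a ^ 2) * (√d * (1 + a)) := by gcongr
    _ = √d * ((1 + a) * Real.exp (-a ^ 2 / 2)) * Real.exp (-a ^ 2 / 2) := by rw [hhalf]; ring
    _ ≤ √d * 2 * Real.exp (-a ^ 2 / 2) := by gcongr
    _ = _ := by ring

theorem abs_exp_neg_sq_sub_le {a b : ℝ} (ha : 0 ≤ a) (hb : 0 ≤ b) :
    |Real.exp (-a ^ 2) - Real.exp (-b ^ 2)| ≤
      2 * √|a - b| * Real.exp (-a ^ 2 / 2) + 2 * √|a - b| * Real.exp (-b ^ 2 / 2) := by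
  rcases le_total a b with h | h
  · have := abs_exp_neg_sq_sub_le_of_le ha h
    have h2 : 0 ≤ 2 * √|a - b| * Real.exp (-b ^ 2 / 2) := by positivity
    linarith
  · have := abs_exp_neg_sq_sub_le_of_le hb h
    rw [abs_sub_comm, abs_sub_comm b a] at this
    have h2 : 0 ≤ 2 * √|a - b| * Real.exp (-a ^ 2 / 2) := by positivity
    linarith

theorem one_add_mul_exp_neg_sq_half_le {r : ℝ} :
    (1 + r) * Real.exp (-r ^ 2 / 2) ≤ 2 * Real.exp (-r ^ 2 / 4) := by
  have h2 : 1 + r ≤ 2 * Real.exp (r ^ 2 / 4) := by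
    have := Real.add_one_le_exp (r ^ 2 / 4); nlinarith [sq_nonneg (r - 1)]
  calc (1 + r) * Real.exp (-r ^ 2 / 2)
    _ ≤ 2 * Real.exp (r ^ 2 / 4) * Real.exp (-r ^ 2 / 2) := by gcongr
    _ = 2 * Real.exp (-r ^ 2 / 4) := by
      rw [mul_assoc, ← Real.exp_add]; congr 2; ring

/-- The point `(s x + p / s, s y, s / 2, n / (2 s))` of `ℝ⁴`. With `s = |η - ζ|`, `p` the area of
the parallelogram spanned by `ζ` and `η`, `n = |η|² - |ζ|²` and `(x, y)` the variable of integration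
in Grad's kernel scaled by `s`, its squared norm is the exponent in that kernel
(`gainKernel_eq_integral_expPoint`). -/
noncomputable def expPoint (s p n x y : ℝ) : EuclideanSpace ℝ (Fin 4) :=
  !₂[s * x + p / s, s * y, s / 2, n / (2 * s)]

theorem norm_expPoint_sq (s p n x y : ℝ) : ‖expPoint s p n x y‖ ^ 2 =
    (s * x + p / s) ^ 2 + (s * y) ^ 2 + (s / 2) ^ 2 + (n / (2 * s)) ^ 2 := by
  rw [EuclideanSpace.norm_sq_eq]
  simp [expPoint, Fin.sum_univ_four]

/-- The exponent point moves by `O(Δ / s (R + z))`, where `R` is its norm and `z` bounds `p / s`. No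
power of `z` beyond the first occurs because the square has been completed: `s |x|` is at most
`R + z`. -/
theorem norm_expPoint_sub_le {s₀ s₁ p₀ p₁ n x y z Δ : ℝ} (h₀ : 0 < s₀) (h₁ : 0 < s₁)
    (h₀₁ : s₀ ≤ 2 * s₁) (hz : 0 ≤ z) (hs : |s₀ - s₁| ≤ Δ) (hp : |p₀ - p₁| ≤ z * Δ)
    (hp₀ : |p₀| ≤ z * s₀) (hp₁ : |p₁| ≤ z * s₁) :
    ‖expPoint s₀ p₀ n x y - expPoint s₁ p₁ n x y‖ ≤
      6 * (Δ / s₀ * (‖expPoint s₀ p₀ n x y‖ + z)) := by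
  have hRsq := norm_expPoint_sq s₀ p₀ n x y
  have hR0 : 0 ≤ ‖expPoint s₀ p₀ n x y‖ := norm_nonneg _
  generalize ‖expPoint s₀ p₀ n x y‖ = R at hRsq hR0 ⊢
  have q1 := sq_nonneg (s₀ * x + p₀ / s₀)
  have q2 := sq_nonneg (s₀ * y)
  have q3 := sq_nonneg (s₀ / 2)
  have q4 := sq_nonneg (n / (2 * s₀))
  have e1 : |s₀ * x + p₀ / s₀| ≤ R := abs_le_of_sq_le_sq (by linarith) hR0
  have e2 : |s₀ * y| ≤ R := abs_le_of_sq_le_sq (by linarith) hR0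
  have e3 : |s₀ / 2| ≤ R := abs_le_of_sq_le_sq (by linarith) hR0
  have e4 : |n / (2 * s₀)| ≤ R := abs_le_of_sq_le_sq (by linarith) hR0
  clear hRsq q1 q2 q3 q4
  have hΔ : 0 ≤ Δ := (abs_nonneg _).trans hs
  obtain ⟨T, hT⟩ : ∃ T, T = Δ / s₀ := ⟨_, rfl⟩
  rw [← hT]
  have hT0 : 0 ≤ T := hT ▸ div_nonneg hΔ h₀.le
  have hΔT : Δ = T * s₀ := by rw [hT]; field_simp
  have ep0 : |p₀ / s₀| ≤ z := by rw [abs_div, abs_of_pos h₀, div_le_iff₀ h₀]; exact hp₀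
  have ep1 : |p₁ / s₁| ≤ z := by rw [abs_div, abs_of_pos h₁, div_le_iff₀ h₁]; exact hp₁
  have ex : |s₀ * x| ≤ R + z := by
    calc |s₀ * x| = |(s₀ * x + p₀ / s₀) - p₀ / s₀| := by ring_nf
      _ ≤ _ := (abs_sub _ _).trans (add_le_add e1 ep0)
  have hquot : |(s₀ - s₁) / s₀| ≤ T := by
    rw [abs_div, abs_of_pos h₀, div_le_iff₀ h₀]; exact hΔT ▸ hs
  -- the last coordinate has the denominator `s₁`, which is comparable to `s₀`
  have hquot1 : |(s₀ - s₁) / s₁| ≤ 2 * T := by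
    rw [abs_div, abs_of_pos h₁, div_le_iff₀ h₁]
    have := mul_le_mul_of_nonneg_left h₀₁ hT0
    linarith
  have hquotp : |(p₀ - p₁) / s₀| ≤ z * T := by
    rw [abs_div, abs_of_pos h₀, div_le_iff₀ h₀]; rw [hΔT] at hp; linarith
  have d1 : |(s₀ * x + p₀ / s₀) - (s₁ * x + p₁ / s₁)| ≤ T * (R + z) + (z * T + z * T) := by
    have : (s₀ * x + p₀ / s₀) - (s₁ * x + p₁ / s₁) =
        (s₀ - s₁) / s₀ * (s₀ * x) + ((p₀ - p₁) / s₀ - (p₁ / s₁) * ((s₀ - s₁) / s₀)) := by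
      field_simp; ring
    rw [this]
    refine (abs_add_le _ _).trans (add_le_add ?_ ((abs_sub _ _).trans (add_le_add hquotp ?_)))
    · rw [abs_mul]; exact mul_le_mul hquot ex (abs_nonneg _) hT0
    · rw [abs_mul]; exact mul_le_mul ep1 hquot (abs_nonneg _) hz
  have d2 : |s₀ * y - s₁ * y| ≤ T * R := by
    have : s₀ * y - s₁ * y = (s₀ - s₁) / s₀ * (s₀ * y) := by field_simp
    rw [this, abs_mul]; exact mul_le_mul hquot e2 (abs_nonneg _) hT0
  have d3 : |s₀ / 2 - s₁ / 2| ≤ T * R := by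
    have : s₀ / 2 - s₁ / 2 = (s₀ - s₁) / s₀ * (s₀ / 2) := by field_simp
    rw [this, abs_mul]; exact mul_le_mul hquot e3 (abs_nonneg _) hT0
  have d4 : |n / (2 * s₀) - n / (2 * s₁)| ≤ 2 * T * R := by
    have : n / (2 * s₀) - n / (2 * s₁) = -((s₀ - s₁) / s₁ * (n / (2 * s₀))) := by
      field_simp; ring
    rw [this, abs_neg, abs_mul]; exact mul_le_mul hquot1 e4 (abs_nonneg _) (by positivity)
  have hTz : 0 ≤ T * z := mul_nonneg hT0 hz
  have hTR : 0 ≤ T * R := mul_nonneg hT0 hR0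
  have hb : ∀ w : ℝ, |w| ≤ 3 * (T * (R + z)) → w ^ 2 ≤ (3 * (T * (R + z))) ^ 2 := fun w hw =>
    sq_le_sq' (by linarith [neg_abs_le w]) ((le_abs_self w).trans hw)
  have b1 := hb _ (d1.trans (by linarith))
  have b2 := hb _ (d2.trans (by linarith))
  have b3 := hb _ (d3.trans (by linarith))
  have b4 := hb _ (d4.trans (by linarith))
  have hn : ‖expPoint s₀ p₀ n x y - expPoint s₁ p₁ n x y‖ ^ 2 =
      ((s₀ * x + p₀ / s₀) - (s₁ * x + p₁ / s₁)) ^ 2 + (s₀ * y - s₁ * y) ^ 2 +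
      (s₀ / 2 - s₁ / 2) ^ 2 + (n / (2 * s₀) - n / (2 * s₁)) ^ 2 := by
    rw [EuclideanSpace.norm_sq_eq, Fin.sum_univ_four]
    simp [expPoint]
  exact (abs_le_of_sq_le_sq' (by linarith) (by linarith)).2

/-- Half-Hölder estimate for the Gaussian factor in Grad's kernel. -/
theorem abs_exp_neg_expPoint_sub_le {s₀ s₁ p₀ p₁ n x y z Δ : ℝ} (h₀ : 0 < s₀) (h₁ : 0 < s₁)
    (h₀₁ : s₀ ≤ 2 * s₁) (h₁₀ : s₁ ≤ 2 * s₀) (hz : 0 ≤ z) (hs : |s₀ - s₁| ≤ Δ)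
    (hp : |p₀ - p₁| ≤ z * Δ) (hp₀ : |p₀| ≤ z * s₀) (hp₁ : |p₁| ≤ z * s₁) :
    |Real.exp (-‖expPoint s₀ p₀ n x y‖ ^ 2) - Real.exp (-‖expPoint s₁ p₁ n x y‖ ^ 2)| ≤
      12 * √(Δ * (1 + z)) * ((√s₀)⁻¹ * Real.exp (-‖expPoint s₀ p₀ n x y‖ ^ 2 / 4) +
        (√s₁)⁻¹ * Real.exp (-‖expPoint s₁ p₁ n x y‖ ^ 2 / 4)) := by
  have hΔ : 0 ≤ Δ := (abs_nonneg _).trans hs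
  have aux : ∀ s R D : ℝ, 0 < s → 0 ≤ R → D ≤ 6 * (Δ / s * (R + z)) →
      2 * √D * Real.exp (-R ^ 2 / 2) ≤ 12 * √(Δ * (1 + z)) * ((√s)⁻¹ * Real.exp (-R ^ 2 / 4)) := by
    intro s R D hs' hR hD
    have : √D ≤ 3 * (√(Δ * (1 + z)) * (√s)⁻¹ * (1 + R)) := by
      apply Real.sqrt_le_iff.2 ⟨by positivity, ?_⟩
      rw [mul_pow, mul_pow, mul_pow, inv_pow, Real.sq_sqrt hs'.le, Real.sq_sqrt (by positivity)]
      refine hD.trans ?_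
      have h1 : R + z ≤ (1 + z) * (1 + R) ^ 2 := by nlinarith [mul_nonneg hz hR]
      have h2 : 0 ≤ Δ / s := by positivity
      calc 6 * (Δ / s * (R + z)) ≤ 6 * (Δ / s * ((1 + z) * (1 + R) ^ 2)) := by gcongr
        _ ≤ 9 * (Δ / s * ((1 + z) * (1 + R) ^ 2)) := by gcongr; norm_num
        _ = _ := by ring
    calc _ ≤ 2 * (3 * (√(Δ * (1 + z)) * (√s)⁻¹ * (1 + R))) * Real.exp (-R ^ 2 / 2) := by gcongr
      _ = 6 * √(Δ * (1 + z)) * (√s)⁻¹ * ((1 + R) * Real.exp (-R ^ 2 / 2)) := by ring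
      _ ≤ 6 * √(Δ * (1 + z)) * (√s)⁻¹ * (2 * Real.exp (-R ^ 2 / 4)) := by
        exact mul_le_mul_of_nonneg_left one_add_mul_exp_neg_sq_half_le (by positivity)
      _ = _ := by ring
  refine (abs_exp_neg_sq_sub_le (norm_nonneg _) (norm_nonneg _)).trans ?_
  rw [mul_add]
  refine add_le_add (aux _ _ _ h₀ (norm_nonneg _) ?_) (aux _ _ _ h₁ (norm_nonneg _) ?_)
  · exact (abs_norm_sub_norm_le _ _).trans (norm_expPoint_sub_le h₀ h₁ h₀₁ hz hs hp hp₀ hp₁)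
  · rw [abs_sub_comm]
    exact (abs_norm_sub_norm_le _ _).trans (norm_expPoint_sub_le h₁ h₀ h₁₀ hz
      (by rwa [abs_sub_comm]) (by rwa [abs_sub_comm]) hp₁ hp₀)

/-! ### Grad's kernel in rotation invariant form -/

/-- The Euclidean plane. -/
abbrev R2 : Type := EuclideanSpace ℝ (Fin 2)

/-- The area `√(|ζ|² |η|² - ⟨ζ, η⟩²)` of the parallelogram spanned by `ζ` and `η`. -/
noncomputable def gram (ζ η : R3) : ℝ := √(‖ζ‖ ^ 2 * ‖η‖ ^ 2 - inner ℝ ζ η ^ 2)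

theorem gram_nonneg (ζ η : R3) : 0 ≤ gram ζ η := Real.sqrt_nonneg _

theorem gram_comm (ζ η : R3) : gram ζ η = gram η ζ := by
  simp only [gram, real_inner_comm ζ η, mul_comm (‖ζ‖ ^ 2)]

theorem gram_le (ζ η : R3) : gram ζ η ≤ ‖ζ‖ * ‖η‖ := by
  refine Real.sqrt_le_iff.2 ⟨by positivity, ?_⟩
  nlinarith [sq_nonneg (inner ℝ ζ η)]

/-- Shearing does not change the area. -/
theorem gram_sub_left (ζ η : R3) : gram ζ (η - ζ) = gram ζ η := by
  unfold gram
  congr 1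
  rw [norm_sub_sq_real, inner_sub_right, real_inner_self_eq_norm_sq, real_inner_comm]
  ring

theorem gram_sq (ζ η : R3) : gram ζ η ^ 2 = ‖ζ‖ ^ 2 * ‖η‖ ^ 2 - inner ℝ ζ η ^ 2 := by
  apply Real.sq_sqrt
  have := real_inner_mul_inner_self_le ζ η
  rw [real_inner_self_eq_norm_sq, real_inner_self_eq_norm_sq] at this
  nlinarith

theorem gram_eq_norm {ζ : R3} (hζ : ζ ≠ 0) (η : R3) :
    gram ζ η = ‖‖ζ‖ • η - (inner ℝ ζ η / ‖ζ‖) • ζ‖ := by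
  have hn : ‖ζ‖ ≠ 0 := norm_ne_zero_iff.2 hζ
  refine (pow_left_inj₀ (gram_nonneg _ _) (norm_nonneg _) two_ne_zero).1 ?_
  rw [gram_sq, norm_sub_sq_real, norm_smul, norm_smul, real_inner_smul_left, real_inner_smul_right,
    real_inner_comm, Real.norm_eq_abs, Real.norm_eq_abs, mul_pow, mul_pow, sq_abs, sq_abs]
  field_simp
  ring

/-- The area is Lipschitz in one side because it is the norm of a linear function of that side. -/
theorem abs_gram_sub_le (ζ η₀ η₁ : R3) : |gram ζ η₀ - gram ζ η₁| ≤ ‖ζ‖ * ‖η₀ - η₁‖ := by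
  rcases eq_or_ne ζ 0 with rfl | hζ
  · simp [gram]
  rw [gram_eq_norm hζ, gram_eq_norm hζ]
  refine (abs_norm_sub_norm_le _ _).trans (le_trans (le_of_eq ?_) (gram_le ζ (η₀ - η₁)))
  rw [gram_eq_norm hζ]
  congr 1
  rw [inner_sub_right, sub_div, sub_smul, smul_sub]
  abel

/-- A linear isometry of the plane onto `v^⊥` that sends the first axis to the direction of the
projection of `ζ` to `v^⊥`. -/
theorem exists_isometry_orthogonal {v : R3} (hv : v ≠ 0) (ζ : R3) :
    ∃ ι : R2 ≃ₗᵢ[ℝ] ((Submodule.span ℝ {v})ᗮ : Submodule ℝ R3),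
      ∀ u, inner ℝ (ι u : R3) ζ = gram ζ v / ‖v‖ * u 0 := by
  have : Fact (Module.finrank ℝ R3 = 2 + 1) := ⟨by simp⟩
  have hn : ‖v‖ ≠ 0 := norm_ne_zero_iff.2 hv
  let e : R2 ≃ₗᵢ[ℝ] ((Submodule.span ℝ {v})ᗮ : Submodule ℝ R3) :=
    (OrthonormalBasis.fromOrthogonalSpanSingleton 2 hv).repr.symm
  have hmem : ζ - (inner ℝ v ζ / ‖v‖ ^ 2) • v ∈ (Submodule.span ℝ {v})ᗮ := by
    rw [Submodule.mem_orthogonal_singleton_iff_inner_right, inner_sub_right, real_inner_smul_right,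
      real_inner_self_eq_norm_sq]
    field_simp; ring
  let w : ((Submodule.span ℝ {v})ᗮ : Submodule ℝ R3) := ⟨_, hmem⟩
  have hw : ‖w‖ = gram ζ v / ‖v‖ := by
    refine (pow_left_inj₀ (norm_nonneg _) (div_nonneg (gram_nonneg _ _) (norm_nonneg _))
      two_ne_zero).1 ?_
    rw [div_pow, gram_sq]
    change ‖ζ - (inner ℝ v ζ / ‖v‖ ^ 2) • v‖ ^ 2 = _
    rw [norm_sub_sq_real, norm_smul, real_inner_smul_right, Real.norm_eq_abs, mul_pow, sq_abs,
      real_inner_comm v ζ]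
    field_simp; ring
  -- reflect any isometry so that the projection `w` of `ζ` lies on the first axis
  have hab : ‖e.symm w‖ = ‖(EuclideanSpace.single 0 (gram ζ v / ‖v‖) : R2)‖ := by
    rw [LinearIsometryEquiv.norm_map, hw, PiLp.norm_single, Real.norm_of_nonneg]
    exact div_nonneg (gram_nonneg _ _) (norm_nonneg _)
  let r : R2 ≃ₗᵢ[ℝ] R2 := (Submodule.span ℝ
    {e.symm w - EuclideanSpace.single 0 (gram ζ v / ‖v‖)})ᗮ.reflection
  have hr : r (e.symm w) = EuclideanSpace.single 0 (gram ζ v / ‖v‖) :=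
    Submodule.reflection_sub hab
  refine ⟨r.symm.trans e, fun u => ?_⟩
  set x := (r.symm.trans e) u with hx
  have h1 : inner ℝ (x : R3) ζ = inner ℝ x w := by
    change _ = inner ℝ (x : R3) (ζ - (inner ℝ v ζ / ‖v‖ ^ 2) • v)
    have := (Submodule.mem_orthogonal_singleton_iff_inner_left).1 x.2
    rw [inner_sub_right, real_inner_smul_right, this]; simp
  have h2 : inner ℝ x w = inner ℝ u (r (e.symm w)) := by
    have : w = (r.symm.trans e) (r (e.symm w)) := by simp
    rw [this, hx, LinearIsometryEquiv.inner_map_map]; simp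
  rw [h1, h2, hr]
  simp [EuclideanSpace.inner_single_right]

/-- The angular part of Grad's kernel, together with the factor `(1 + t²) ^ (γ / 2)` left over from
`(|v|² + |w|²) ^ (γ / 2)` after scaling, as a function of `t = tan θ = |w| / |v|`. -/
noncomputable def angular (γ : ℝ) (β : ℝ → ℝ) (t : ℝ) : ℝ :=
  (β (Real.arctan t) + β (Real.pi / 2 - Real.arctan t)) / Real.sin (Real.arctan t) *
    (1 + t ^ 2) ^ (γ / 2)

/-- The integral over the plane in Grad's kernel, in variables scaled by `s = |ζ_* - ζ|` and with
the first axis along the projection of `ζ`, whose length is `p / s`. -/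
noncomputable def planeInt (γ : ℝ) (β : ℝ → ℝ) (s p : ℝ) : ℝ :=
  ∫ u : R2, angular γ β ‖u‖ * Real.exp (-(s ^ 2 * ‖u‖ ^ 2 + 2 * p * u 0))

/-- The gain kernel depends on `ζ`, `η` only through `|ζ|`, `|η|` and `|η - ζ|`, and the domain of
integration can be taken independent of `ζ`, `η`. -/
theorem gainKernel_eq (γ : ℝ) (β : ℝ → ℝ) {ζ η : R3} (h : η ≠ ζ) :
    gainKernel γ β ζ η = (2 * Real.pi)⁻¹ * ‖η - ζ‖ ^ γ *
      (Real.exp (-(‖ζ‖ ^ 2 + ‖η‖ ^ 2) / 2) * planeInt γ β ‖η - ζ‖ (gram ζ η)) := by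
  have hv : η - ζ ≠ 0 := sub_ne_zero.2 h
  obtain ⟨ι, hι⟩ := exists_isometry_orthogonal hv ζ
  rw [gram_sub_left] at hι
  unfold gainKernel
  rw [← ι.measurePreserving.integral_comp' (f := ι.toMeasurableEquiv)]
  have hs : 0 < ‖η - ζ‖ := norm_pos_iff.2 hv
  have horth : ∀ u, inner ℝ (ι u : R3) η = inner ℝ (ι u : R3) ζ := fun u => by
    have := (Submodule.mem_orthogonal_singleton_iff_inner_left).1 (ι u).2
    rw [inner_sub_right] at this; linarith
  set s := ‖η - ζ‖ with hsdef
  set p := gram ζ η with hp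
  have hscale := Measure.integral_comp_smul (volume : Measure R2) (fun u : R2 =>
      (β (Real.arctan (‖ι u‖ / s)) + β (Real.pi / 2 - Real.arctan (‖ι u‖ / s))) /
          Real.sin (Real.arctan (‖ι u‖ / s)) *
        (s ^ 2 + ‖ι u‖ ^ 2) ^ (γ / 2) *
        (sqrtMaxwellian (η + (ι u : R3)) * sqrtMaxwellian (ζ + (ι u : R3)))) s
  have hfr : Module.finrank ℝ R2 = 2 := by simp
  rw [hfr, smul_eq_mul, abs_of_pos (by positivity)] at hscale
  have hint : ∀ u : R2,
      (β (Real.arctan (‖ι (s • u)‖ / s)) + β (Real.pi / 2 - Real.arctan (‖ι (s • u)‖ / s))) /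
          Real.sin (Real.arctan (‖ι (s • u)‖ / s)) *
        (s ^ 2 + ‖ι (s • u)‖ ^ 2) ^ (γ / 2) *
        (sqrtMaxwellian (η + (ι (s • u) : R3)) * sqrtMaxwellian (ζ + (ι (s • u) : R3))) =
      s ^ γ * Real.exp (-(‖ζ‖ ^ 2 + ‖η‖ ^ 2) / 2) *
        (angular γ β ‖u‖ * Real.exp (-(s ^ 2 * ‖u‖ ^ 2 + 2 * p * u 0))) := by
    intro u
    have h1 : ‖ι (s • u)‖ = s * ‖u‖ := by
      rw [LinearIsometryEquiv.norm_map, norm_smul, Real.norm_of_nonneg hs.le]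
    have h2 : s * ‖u‖ / s = ‖u‖ := by field_simp
    have h3 : (s ^ 2 + (s * ‖u‖) ^ 2) ^ (γ / 2) = s ^ γ * (1 + ‖u‖ ^ 2) ^ (γ / 2) := by
      rw [show s ^ 2 + (s * ‖u‖) ^ 2 = s ^ 2 * (1 + ‖u‖ ^ 2) by ring,
        Real.mul_rpow (by positivity) (by positivity), ← Real.rpow_natCast_mul hs.le]
      congr 2; push_cast; ring
    have h4 : sqrtMaxwellian (η + (ι (s • u) : R3)) * sqrtMaxwellian (ζ + (ι (s • u) : R3)) =
        Real.exp (-(‖ζ‖ ^ 2 + ‖η‖ ^ 2) / 2) *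
          Real.exp (-(s ^ 2 * ‖u‖ ^ 2 + 2 * p * u 0)) := by
      unfold sqrtMaxwellian
      rw [← Real.exp_add, ← Real.exp_add, norm_add_sq_real, norm_add_sq_real,
        real_inner_comm, real_inner_comm _ ζ, horth, hι, Submodule.norm_coe, h1]
      congr 1
      simp
      field_simp; ring
    rw [h1, h2, h3, h4, angular]
    ring
  simp_rw [hint] at hscale
  rw [integral_const_mul] at hscale
  have hcoe : ∀ u, ι.toMeasurableEquiv u = ι u := fun _ => rfl
  simp only [hcoe]
  unfold planeInt
  have hs2 : (s ^ 2) ≠ 0 := by positivity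
  rw [mul_assoc (2 * Real.pi)⁻¹, ← hscale]
  ring

theorem measurable_angular (γ : ℝ) {β : ℝ → ℝ} (hβ : Measurable β) :
    Measurable (angular γ β) := by
  unfold angular
  have h1 : Measurable Real.arctan := Real.continuous_arctan.measurable
  have h2 := hβ.comp h1
  have h3 := hβ.comp (measurable_const.sub h1 : Measurable fun t => Real.pi / 2 - Real.arctan t)
  exact ((h2.add h3).div (Real.measurable_sin.comp h1)).mul
    ((measurable_const.add (measurable_id.pow_const 2)).pow_const _)

/-- Under the cutoff assumption the angular part is `O(t ^ (γ - 1))`. -/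
theorem exists_angular_le {γ : ℝ} {β : ℝ → ℝ} (hB : IsCutoffCrossSection γ β) :
    ∃ A : ℝ, 0 ≤ A ∧ ∀ t, 0 ≤ t → 0 ≤ angular γ β t ∧ angular γ β t ≤ A * t ^ (γ - 1) := by
  obtain ⟨C, hC⟩ := hB.cutoff
  have hγ := hB.gamma_lt_one
  refine ⟨2 * |C|, by positivity, fun t ht => ?_⟩
  rcases ht.eq_or_lt with rfl | ht
  -- at `t = 0` both sides are `0`, by `x / 0 = 0` and `0 ^ (γ - 1) = 0`
  · have : angular γ β 0 = 0 := by simp [angular]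
    rw [this]; exact ⟨le_rfl, by positivity⟩
  have hθ0 : 0 < Real.arctan t := Real.arctan_pos.2 ht
  have hθ1 : Real.arctan t < Real.pi / 2 := Real.arctan_lt_pi_div_two t
  have hsin : 0 < Real.sin (Real.arctan t) := Real.sin_pos_of_pos_of_lt_pi hθ0 (by linarith)
  have hcos : 0 < Real.cos (Real.arctan t) := Real.cos_arctan_pos t
  obtain ⟨l1, u1⟩ := hC (Real.arctan t) ⟨hθ0.le, hθ1.le⟩
  obtain ⟨l2, u2⟩ := hC (Real.pi / 2 - Real.arctan t) ⟨by linarith, by linarith⟩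
  rw [Real.cos_pi_div_two_sub, Real.sin_pi_div_two_sub] at u2
  have hq : (β (Real.arctan t) + β (Real.pi / 2 - Real.arctan t)) / Real.sin (Real.arctan t) ≤
      2 * |C| * Real.cos (Real.arctan t) := by
    rw [div_le_iff₀ hsin]
    have := mul_le_mul_of_nonneg_right (le_abs_self C) (mul_pos hcos hsin).le
    nlinarith
  have hpos : 0 < 1 + t ^ 2 := by positivity
  refine ⟨mul_nonneg (div_nonneg (add_nonneg l1 l2) hsin.le) (by positivity), ?_⟩
  have hc : Real.cos (Real.arctan t) = (1 + t ^ 2) ^ (-(1 / 2) : ℝ) := by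
    rw [Real.cos_arctan, Real.sqrt_eq_rpow, Real.rpow_neg hpos.le, one_div]
  calc angular γ β t ≤ 2 * |C| * Real.cos (Real.arctan t) * (1 + t ^ 2) ^ (γ / 2) := by
        unfold angular; gcongr
    _ = 2 * |C| * (1 + t ^ 2) ^ ((γ - 1) / 2) := by
        rw [hc, mul_assoc, ← Real.rpow_add hpos]; congr 2; ring
    _ ≤ 2 * |C| * (t ^ 2) ^ ((γ - 1) / 2) := by
        gcongr 2 * |C| * ?_
        exact Real.rpow_le_rpow_of_nonpos (by positivity) (by linarith) (by linarith)
    _ = 2 * |C| * t ^ (γ - 1) := by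
        rw [← Real.rpow_natCast_mul ht.le]; congr 2; push_cast; ring

theorem measurable_planeInt (γ : ℝ) {β : ℝ → ℝ} (hβ : Measurable β) :
    Measurable fun q : ℝ × ℝ => planeInt γ β q.1 q.2 := by
  have hm := (measurable_angular γ hβ).comp
    (measurable_norm.comp (measurable_snd : Measurable fun q : (ℝ × ℝ) × R2 => q.2))
  have : StronglyMeasurable (Function.uncurry fun (q : ℝ × ℝ) (u : R2) =>
      angular γ β ‖u‖ * Real.exp (-(q.1 ^ 2 * ‖u‖ ^ 2 + 2 * q.2 * u 0))) := by
    apply Measurable.stronglyMeasurable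
    apply hm.mul
    apply Continuous.measurable
    fun_prop
  exact (this.integral_prod_right (ν := (volume : Measure R2))).measurable

theorem measurable_collisionKernel (γ : ℝ) {β : ℝ → ℝ} (hβ : Measurable β) :
    Measurable fun q : R3 × R3 => collisionKernel γ β q.1 q.2 := by
  classical
  have hgram : Measurable fun q : R3 × R3 => gram q.1 q.2 := by
    unfold gram
    apply Continuous.measurable; fun_prop
  have hpl : Measurable fun q : R3 × R3 => planeInt γ β ‖q.2 - q.1‖ (gram q.1 q.2) :=
    (measurable_planeInt γ hβ).comp
      ((by fun_prop : Measurable fun q : R3 × R3 => ‖q.2 - q.1‖).prodMk hgram)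
  have hgain : Measurable fun q : R3 × R3 => gainKernel γ β q.1 q.2 := by
    -- on the diagonal the factor `(‖η - ζ‖ ^ 2)⁻¹` is `0⁻¹ = 0`
    have heq : (fun q : R3 × R3 => gainKernel γ β q.1 q.2) = fun q =>
        if q.2 - q.1 = 0 then 0 else (2 * Real.pi)⁻¹ * ‖q.2 - q.1‖ ^ γ *
          (Real.exp (-(‖q.1‖ ^ 2 + ‖q.2‖ ^ 2) / 2) * planeInt γ β ‖q.2 - q.1‖ (gram q.1 q.2)) := by
      funext q
      split_ifs with h
      · simp [gainKernel, h]
      · exact gainKernel_eq γ β (sub_ne_zero.1 h)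
    rw [heq]
    refine Measurable.ite ?_ measurable_const ?_
    · exact (measurable_snd.sub measurable_fst) (measurableSet_singleton 0)
    · exact (measurable_const.mul ((by fun_prop : Measurable fun q : R3 × R3 =>
        ‖q.2 - q.1‖).pow_const _)).mul ((by fun_prop : Measurable fun q : R3 × R3 =>
          Real.exp (-(‖q.1‖ ^ 2 + ‖q.2‖ ^ 2) / 2)).mul hpl)
  refine hgain.sub ?_
  unfold lossKernel sqrtMaxwellian
  exact ((measurable_const.mul ((by fun_prop : Measurable fun q : R3 × R3 =>
    ‖q.1 - q.2‖).pow_const _)).mul (by fun_prop)).mul (by fun_prop)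

theorem collisionKernel_comm (γ : ℝ) (β : ℝ → ℝ) (ζ η : R3) :
    collisionKernel γ β ζ η = collisionKernel γ β η ζ := by
  rcases eq_or_ne η ζ with rfl | h
  · rfl
  unfold collisionKernel lossKernel
  rw [gainKernel_eq γ β h, gainKernel_eq γ β h.symm, norm_sub_rev η ζ, gram_comm η ζ,
    add_comm (‖η‖ ^ 2)]
  ring

/-! ### Gaussian integrals with a singularity -/

theorem integrable_rpow_norm_mul_gaussian {n : ℕ} [NeZero n] {c q : ℝ} (hc : 0 < c)
    (hqn : -(n : ℝ) < q) :
    Integrable fun w : EuclideanSpace ℝ (Fin n) => ‖w‖ ^ q * Real.exp (-c * ‖w‖ ^ 2) := by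
  have : Nontrivial (EuclideanSpace ℝ (Fin n)) := by
    apply Module.nontrivial_of_finrank_pos (R := ℝ)
    simpa using NeZero.pos n
  refine (integrable_fun_norm_addHaar volume (f := fun y => y ^ q * Real.exp (-c * y ^ 2))).2 ?_
  refine (integrableOn_rpow_mul_exp_neg_mul_sq hc (s := q + n - 1) (by linarith)).congr_fun
    (fun y hy => ?_) measurableSet_Ioi
  have hy : 0 < y := hy
  simp only [finrank_euclideanSpace, Fintype.card_fin, smul_eq_mul]
  rw [← mul_assoc, ← Real.rpow_natCast y (n - 1), ← Real.rpow_add hy,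
    Nat.cast_sub (NeZero.one_le : 1 ≤ n)]
  congr 2; push_cast; ring

/-- A singularity at the origin that is locally integrable, times a Gaussian centred anywhere, has
an integral that is bounded independently of the centre. -/
theorem exists_integral_rpow_norm_mul_gaussian_le (n : ℕ) [NeZero n] {c q : ℝ} (hc : 0 < c)
    (hq : q ≤ 0) (hqn : -(n : ℝ) < q) :
    ∃ C : ℝ, 0 ≤ C ∧ ∀ b : EuclideanSpace ℝ (Fin n),
      Integrable (fun w => ‖w‖ ^ q * Real.exp (-c * ‖w + b‖ ^ 2)) ∧
        ∫ w, ‖w‖ ^ q * Real.exp (-c * ‖w + b‖ ^ 2) ≤ C := by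
  have i1 := integrable_rpow_norm_mul_gaussian (n := n) hc hqn
  have i2 : Integrable fun w : EuclideanSpace ℝ (Fin n) => Real.exp (-c * ‖w‖ ^ 2) := by
    have := integrable_rpow_norm_mul_gaussian (n := n) (q := 0) hc
      (by simpa using NeZero.pos n)
    simpa using this
  have hpt : ∀ b w : EuclideanSpace ℝ (Fin n), ‖w‖ ^ q * Real.exp (-c * ‖w + b‖ ^ 2) ≤
      Real.exp c * (‖w‖ ^ q * Real.exp (-c * ‖w‖ ^ 2)) + Real.exp (-c * ‖w + b‖ ^ 2) := by
    intro b w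
    have hp : 0 ≤ ‖w‖ ^ q := by positivity
    rcases le_total ‖w‖ 1 with h | h
    · have h1 : Real.exp (-c * ‖w + b‖ ^ 2) ≤ Real.exp c * Real.exp (-c * ‖w‖ ^ 2) := by
        rw [← Real.exp_add]
        apply Real.exp_le_exp.2
        nlinarith [mul_nonneg hc.le (sq_nonneg ‖w + b‖), pow_le_one₀ (norm_nonneg w) h (n := 2)]
      have := mul_le_mul_of_nonneg_left h1 hp
      have := Real.exp_pos (-c * ‖w + b‖ ^ 2)
      linarith
    · have h1 : ‖w‖ ^ q ≤ 1 := Real.rpow_le_one_of_one_le_of_nonpos h hq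
      have := mul_le_mul_of_nonneg_right h1 (Real.exp_pos (-c * ‖w + b‖ ^ 2)).le
      have : 0 ≤ Real.exp c * (‖w‖ ^ q * Real.exp (-c * ‖w‖ ^ 2)) := by positivity
      linarith
  refine ⟨Real.exp c * (∫ w : EuclideanSpace ℝ (Fin n), ‖w‖ ^ q * Real.exp (-c * ‖w‖ ^ 2)) +
    ∫ w : EuclideanSpace ℝ (Fin n), Real.exp (-c * ‖w‖ ^ 2), ?_, fun b => ?_⟩
  · have h1 : 0 ≤ ∫ w : EuclideanSpace ℝ (Fin n), ‖w‖ ^ q * Real.exp (-c * ‖w‖ ^ 2) :=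
      integral_nonneg fun w => by positivity
    have h2 : 0 ≤ ∫ w : EuclideanSpace ℝ (Fin n), Real.exp (-c * ‖w‖ ^ 2) :=
      integral_nonneg fun w => by positivity
    positivity
  have i3 : Integrable fun w : EuclideanSpace ℝ (Fin n) => Real.exp (-c * ‖w + b‖ ^ 2) :=
    i2.comp_add_right b
  have i4 := (i1.const_mul (Real.exp c)).add i3
  have i5 : Integrable (fun w : EuclideanSpace ℝ (Fin n) =>
      ‖w‖ ^ q * Real.exp (-c * ‖w + b‖ ^ 2)) := by
    refine i4.mono' (Measurable.aestronglyMeasurable ?_) (Filter.Eventually.of_forall fun w => ?_)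
    · exact (measurable_norm.pow_const _).mul (by fun_prop)
    · rw [Real.norm_of_nonneg (by positivity)]; exact hpt b w
  refine ⟨i5, (integral_mono i5 i4 (hpt b)).trans (le_of_eq ?_)⟩
  simp only [Pi.add_apply]
  rw [integral_add (i1.const_mul _) i3, integral_const_mul,
    integral_add_right_eq_self (fun w : EuclideanSpace ℝ (Fin n) => Real.exp (-c * ‖w‖ ^ 2)) b]

/-- The scaled form of the previous bound in the plane, for the singularity of the angular part. -/
theorem exists_integral_scaled_gaussian_le {γ c : ℝ} (hc : 0 < c) (h0 : 0 ≤ γ) (h1 : γ < 1) :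
    ∃ C : ℝ, 0 ≤ C ∧ ∀ s : ℝ, 0 < s → ∀ b : R2,
      Integrable (fun u : R2 => ‖u‖ ^ (γ - 1) * Real.exp (-c * ‖s • u + b‖ ^ 2)) ∧
        ∫ u : R2, ‖u‖ ^ (γ - 1) * Real.exp (-c * ‖s • u + b‖ ^ 2) ≤ C * s ^ (-γ - 1) := by
  obtain ⟨C, hC0, hC⟩ := exists_integral_rpow_norm_mul_gaussian_le 2 (q := γ - 1) hc (by linarith)
    (by push_cast; linarith)
  refine ⟨C, hC0, fun s hs b => ?_⟩
  obtain ⟨hi, hb⟩ := hC b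
  have heq : (fun u : R2 => ‖u‖ ^ (γ - 1) * Real.exp (-c * ‖s • u + b‖ ^ 2)) =
      fun u => s ^ (1 - γ) * (‖s • u‖ ^ (γ - 1) * Real.exp (-c * ‖s • u + b‖ ^ 2)) := by
    funext u
    rw [norm_smul, Real.norm_of_nonneg hs.le, Real.mul_rpow hs.le (norm_nonneg _), ← mul_assoc,
      ← mul_assoc, ← Real.rpow_add hs]
    simp
  rw [heq]
  refine ⟨((integrable_comp_smul_iff volume _ hs.ne').2 hi).const_mul _, ?_⟩
  rw [integral_const_mul, Measure.integral_comp_smul (volume : Measure R2)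
    (fun w : R2 => ‖w‖ ^ (γ - 1) * Real.exp (-c * ‖w + b‖ ^ 2)) s]
  have hfr : Module.finrank ℝ R2 = 2 := by simp
  rw [hfr, smul_eq_mul, abs_of_pos (by positivity)]
  calc s ^ (1 - γ) * ((s ^ 2)⁻¹ * _) ≤ s ^ (1 - γ) * ((s ^ 2)⁻¹ * C) := by gcongr
    _ = C * s ^ (-γ - 1) := by
      rw [← Real.rpow_natCast s 2, ← Real.rpow_neg hs.le, ← mul_assoc, ← Real.rpow_add hs, mul_comm]
      congr 2; push_cast; ring

theorem measurable_exp_expPoint (s p n c : ℝ) :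
    Measurable fun u : R2 => Real.exp (-‖expPoint s p n (u 0) (u 1)‖ ^ 2 / c) := by
  simp only [norm_expPoint_sq]
  fun_prop

/-- The exponent contains `s² / 4` and a Gaussian in the plane. -/
theorem exp_neg_expPoint_le (s p n : ℝ) (u : R2) :
    Real.exp (-‖expPoint s p n (u 0) (u 1)‖ ^ 2 / 4) ≤
      Real.exp (-s ^ 2 / 16) *
        Real.exp (-(1 / 4) * ‖s • u + EuclideanSpace.single 0 (p / s)‖ ^ 2) := by
  rw [← Real.exp_add]
  apply Real.exp_le_exp.2
  rw [norm_expPoint_sq, EuclideanSpace.norm_sq_eq]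
  simp [Fin.sum_univ_two]
  nlinarith [sq_nonneg (n / (2 * s))]

theorem exists_integral_angular_le {γ : ℝ} {β : ℝ → ℝ} (hB : IsCutoffCrossSection γ β) :
    ∃ C : ℝ, 0 ≤ C ∧ ∀ s p n : ℝ, 0 < s →
      Integrable (fun u : R2 => angular γ β ‖u‖ *
        Real.exp (-‖expPoint s p n (u 0) (u 1)‖ ^ 2 / 4)) ∧
      ∫ u : R2, angular γ β ‖u‖ * Real.exp (-‖expPoint s p n (u 0) (u 1)‖ ^ 2 / 4) ≤
        C * (s ^ (-γ - 1) * Real.exp (-s ^ 2 / 16)) := by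
  obtain ⟨A, hA0, hA⟩ := exists_angular_le hB
  obtain ⟨C, hC0, hC⟩ := exists_integral_scaled_gaussian_le (c := 1 / 4) (by norm_num)
    hB.gamma_nonneg hB.gamma_lt_one
  refine ⟨A * C, by positivity, fun s p n hs => ?_⟩
  obtain ⟨hi, hb⟩ := hC s hs (EuclideanSpace.single 0 (p / s))
  have hpt : ∀ u : R2, angular γ β ‖u‖ * Real.exp (-‖expPoint s p n (u 0) (u 1)‖ ^ 2 / 4) ≤
      (A * Real.exp (-s ^ 2 / 16)) * (‖u‖ ^ (γ - 1) *
        Real.exp (-(1 / 4) * ‖s • u + EuclideanSpace.single 0 (p / s)‖ ^ 2)) := by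
    intro u
    calc _ ≤ (A * ‖u‖ ^ (γ - 1)) * (Real.exp (-s ^ 2 / 16) *
        Real.exp (-(1 / 4) * ‖s • u + EuclideanSpace.single 0 (p / s)‖ ^ 2)) :=
          mul_le_mul (hA _ (norm_nonneg _)).2 (exp_neg_expPoint_le s p n u) (Real.exp_pos _).le
            (by positivity)
      _ = _ := by ring
  have hi' := hi.const_mul (A * Real.exp (-s ^ 2 / 16))
  have hint : Integrable (fun u : R2 => angular γ β ‖u‖ *
        Real.exp (-‖expPoint s p n (u 0) (u 1)‖ ^ 2 / 4)) := by
    refine hi'.mono' (Measurable.aestronglyMeasurable ?_) (Filter.Eventually.of_forall fun u => ?_)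
    · exact ((measurable_angular γ hB.measurable_beta).comp measurable_norm).mul
        (measurable_exp_expPoint s p n 4)
    · rw [Real.norm_of_nonneg (mul_nonneg (hA _ (norm_nonneg _)).1 (Real.exp_pos _).le)]
      exact hpt u
  refine ⟨hint, (integral_mono hint hi' hpt).trans ?_⟩
  rw [integral_const_mul]
  calc _ ≤ (A * Real.exp (-s ^ 2 / 16)) * (C * s ^ (-γ - 1)) := by gcongr
    _ = _ := by ring

/-! ### Size of the collision kernel -/

/-- Grad's kernel after completing the square in the exponent. -/
theorem gainKernel_eq_integral_expPoint (γ : ℝ) (β : ℝ → ℝ) {ζ η : R3} (h : η ≠ ζ) :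
    gainKernel γ β ζ η = (2 * Real.pi)⁻¹ * ‖η - ζ‖ ^ γ *
      ∫ u : R2, angular γ β ‖u‖ * Real.exp
        (-‖expPoint ‖η - ζ‖ (gram ζ η) (‖η‖ ^ 2 - ‖ζ‖ ^ 2) (u 0) (u 1)‖ ^ 2) := by
  rw [gainKernel_eq γ β h, planeInt, ← integral_const_mul]
  congr 2 with u
  rw [mul_left_comm, ← Real.exp_add]
  congr 2
  have hs : ‖η - ζ‖ ≠ 0 := norm_ne_zero_iff.2 (sub_ne_zero.2 h)
  have hp := gram_sq ζ η
  have hs2 := norm_sub_sq_real η ζ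
  rw [real_inner_comm] at hs2
  rw [norm_expPoint_sq, EuclideanSpace.norm_sq_eq u, Fin.sum_univ_two]
  simp only [Real.norm_eq_abs, sq_abs]
  generalize ‖η - ζ‖ = s at *
  generalize gram ζ η = p at *
  generalize inner ℝ ζ η = c at *
  have hc : c = (‖ζ‖ ^ 2 + ‖η‖ ^ 2 - s ^ 2) / 2 := by linarith
  have hp' : p ^ 2 = s ^ 2 * (‖ζ‖ ^ 2 + ‖η‖ ^ 2) / 2 - s ^ 4 / 4 - (‖η‖ ^ 2 - ‖ζ‖ ^ 2) ^ 2 / 4 := by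
    rw [hp, hc]; ring
  field_simp
  linear_combination 4 * hp'

theorem rpow_add_one_mul_exp_le {γ s : ℝ} (h0 : 0 ≤ γ) (h1 : γ < 1) (hs : 0 < s) :
    s ^ (γ + 1) * Real.exp (-s ^ 2 / 4) ≤ 6 * Real.exp (-s ^ 2 / 16) := by
  have h2 : s ^ (γ + 1) ≤ 1 + s ^ 2 := by
    rcases le_total s 1 with h | h
    · have := Real.rpow_le_one hs.le h (by linarith : 0 ≤ γ + 1); nlinarith
    · have := Real.rpow_le_rpow_of_exponent_le h (by linarith : γ + 1 ≤ 2)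
      rw [Real.rpow_two] at this; linarith
  have h3 : 1 + s ^ 2 ≤ 6 * Real.exp (3 * s ^ 2 / 16) := by
    have := Real.add_one_le_exp (3 * s ^ 2 / 16); nlinarith
  calc _ ≤ (6 * Real.exp (3 * s ^ 2 / 16)) * Real.exp (-s ^ 2 / 4) := by
        gcongr; exact h2.trans h3
    _ = _ := by rw [mul_assoc, ← Real.exp_add]; congr 2; ring

/-- For `0 ≤ γ < 1` and `x > 0` the power `x ^ γ` lies between `1` and `x`. -/
theorem abs_rpow_sub_rpow_le {γ a b : ℝ} (h0 : 0 ≤ γ) (h1 : γ < 1) (ha : 0 < a) (hb : 0 < b) :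
    |a ^ γ - b ^ γ| ≤ a ^ (γ - 1) * |a - b| := by
  have hx : 0 < b / a := by positivity
  have hb' : b = a * (b / a) := by field_simp
  generalize b / a = x at hx hb'
  subst hb'
  rw [Real.mul_rpow ha.le hx.le, Real.rpow_sub_one ha.ne',
    show a ^ γ - a ^ γ * x ^ γ = a ^ γ * (1 - x ^ γ) by ring, show a - a * x = a * (1 - x) by ring,
    abs_mul, abs_mul, abs_of_pos ha, abs_of_pos (Real.rpow_pos_of_pos ha γ)]
  have : |1 - x ^ γ| ≤ |1 - x| := by
    rcases le_total x 1 with h | h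
    · have l1 := Real.rpow_le_one hx.le h h0
      have l2 := Real.rpow_le_rpow_of_exponent_ge hx h h1.le
      rw [Real.rpow_one] at l2
      rw [abs_of_nonneg (by linarith), abs_of_nonneg (by linarith)]; linarith
    · have l1 := Real.one_le_rpow h h0
      have l2 := Real.rpow_le_rpow_of_exponent_le h h1.le
      rw [Real.rpow_one] at l2
      rw [abs_of_nonpos (by linarith), abs_of_nonpos (by linarith)]; linarith
  calc _ ≤ a ^ γ * |1 - x| := by gcongr
    _ = _ := by field_simp

theorem sqrtMaxwellian_mul_le (ζ η : R3) :
    sqrtMaxwellian ζ * sqrtMaxwellian η ≤ Real.exp (-‖η - ζ‖ ^ 2 / 4) := by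
  unfold sqrtMaxwellian
  rw [← Real.exp_add]
  apply Real.exp_le_exp.2
  have h1 := norm_sub_sq_real η ζ
  have h2 := norm_add_sq_real η ζ
  nlinarith [sq_nonneg ‖η + ζ‖]

/-- Pointwise size of the collision kernel. -/
theorem exists_abs_collisionKernel_le {γ : ℝ} {β : ℝ → ℝ} (hB : IsCutoffCrossSection γ β) :
    ∃ C : ℝ, 0 ≤ C ∧ ∀ ζ η : R3, η ≠ ζ →
      |collisionKernel γ β ζ η| ≤ C * (‖η - ζ‖⁻¹ * Real.exp (-‖η - ζ‖ ^ 2 / 16)) := by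
  obtain ⟨A, hA0, hA⟩ := exists_angular_le hB
  obtain ⟨C, hC0, hC⟩ := exists_integral_angular_le hB
  have hb0 : 0 < beta0 β := hB.nontrivial
  refine ⟨(2 * Real.pi)⁻¹ * C + beta0 β * 6, by positivity, fun ζ η h => ?_⟩
  have hs : 0 < ‖η - ζ‖ := norm_pos_iff.2 (sub_ne_zero.2 h)
  have hgain : |gainKernel γ β ζ η| ≤
      (2 * Real.pi)⁻¹ * C * (‖η - ζ‖⁻¹ * Real.exp (-‖η - ζ‖ ^ 2 / 16)) := by
    rw [gainKernel_eq_integral_expPoint γ β h]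
    obtain ⟨hi, hb⟩ := hC ‖η - ζ‖ (gram ζ η) (‖η‖ ^ 2 - ‖ζ‖ ^ 2) hs
    generalize ‖η - ζ‖ = s at *
    have hn : 0 ≤ ∫ u : R2, angular γ β ‖u‖ * Real.exp
        (-‖expPoint s (gram ζ η) (‖η‖ ^ 2 - ‖ζ‖ ^ 2) (u 0) (u 1)‖ ^ 2) :=
      integral_nonneg fun u => mul_nonneg (hA _ (norm_nonneg _)).1 (Real.exp_pos _).le
    rw [abs_of_nonneg (by positivity)]
    have hle : ∫ u : R2, angular γ β ‖u‖ * Real.exp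
        (-‖expPoint s (gram ζ η) (‖η‖ ^ 2 - ‖ζ‖ ^ 2) (u 0) (u 1)‖ ^ 2) ≤
        C * (s ^ (-γ - 1) * Real.exp (-s ^ 2 / 16)) := by
      refine (integral_mono_of_nonneg (Filter.Eventually.of_forall fun u =>
        mul_nonneg (hA _ (norm_nonneg _)).1 (Real.exp_pos _).le) hi
        (Filter.Eventually.of_forall fun u => ?_)).trans hb
      refine mul_le_mul_of_nonneg_left (Real.exp_le_exp.2 ?_) (hA _ (norm_nonneg _)).1
      nlinarith [sq_nonneg ‖expPoint s (gram ζ η) (‖η‖ ^ 2 - ‖ζ‖ ^ 2) (u 0) (u 1)‖]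
    calc _ ≤ (2 * Real.pi)⁻¹ * s ^ γ * (C * (s ^ (-γ - 1) * Real.exp (-s ^ 2 / 16))) := by gcongr
      _ = (2 * Real.pi)⁻¹ * C * ((s ^ γ * s ^ (-γ - 1)) * Real.exp (-s ^ 2 / 16)) := by ring
      _ = _ := by
        rw [← Real.rpow_add hs, show γ + (-γ - 1) = -1 by ring, Real.rpow_neg_one]
  have hloss : |lossKernel γ β ζ η| ≤
      beta0 β * 6 * (‖η - ζ‖⁻¹ * Real.exp (-‖η - ζ‖ ^ 2 / 16)) := by
    unfold lossKernel
    have hM := sqrtMaxwellian_mul_le ζ η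
    have hM0 : 0 ≤ sqrtMaxwellian ζ * sqrtMaxwellian η :=
      mul_nonneg (Real.exp_pos _).le (Real.exp_pos _).le
    rw [mul_assoc, norm_sub_rev, abs_of_nonneg (by positivity)]
    have := rpow_add_one_mul_exp_le hB.gamma_nonneg hB.gamma_lt_one hs
    generalize ‖η - ζ‖ = s at *
    calc _ ≤ beta0 β * s ^ γ * Real.exp (-s ^ 2 / 4) := by gcongr
      _ = beta0 β * s⁻¹ * (s ^ (γ + 1) * Real.exp (-s ^ 2 / 4)) := by
        rw [Real.rpow_add_one hs.ne']; field_simp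
      _ ≤ beta0 β * s⁻¹ * (6 * Real.exp (-s ^ 2 / 16)) := by gcongr
      _ = _ := by ring
  calc _ ≤ |gainKernel γ β ζ η| + |lossKernel γ β ζ η| := abs_sub _ _
    _ ≤ _ := by rw [add_mul]; exact add_le_add hgain hloss

/-! ### Hölder continuity of the collision kernel -/

theorem sqrt_mul_rpow_neg {s : ℝ} (hs : 0 < s) : √s * s ^ (-(3 / 2) : ℝ) = s⁻¹ := by
  rw [Real.sqrt_eq_rpow, ← Real.rpow_add hs, ← Real.rpow_neg_one]; norm_num

theorem inv_sqrt_mul_inv {s : ℝ} (hs : 0 < s) : (√s)⁻¹ * s⁻¹ = s ^ (-(3 / 2) : ℝ) := by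
  rw [← sqrt_mul_rpow_neg hs]
  have : √s ≠ 0 := (Real.sqrt_pos.2 hs).ne'
  field_simp

theorem mul_inv_mul_inv_le_sqrt {Δ s : ℝ} (hΔ : 0 ≤ Δ) (hs : 0 < s) (h : Δ ≤ s) :
    Δ * (s⁻¹ * s⁻¹) ≤ √Δ * s ^ (-(3 / 2) : ℝ) := by
  have h1 : √Δ ≤ √s := Real.sqrt_le_sqrt h
  have h2 : √s * s⁻¹ = (√s)⁻¹ := by
    have := (Real.sqrt_pos.2 hs).ne'
    have h3 := Real.sq_sqrt hs.le
    field_simp; exact h3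
  calc Δ * (s⁻¹ * s⁻¹) = √Δ * (√Δ * s⁻¹ * s⁻¹) := by
        nth_rw 1 [← Real.mul_self_sqrt hΔ]; ring
    _ ≤ √Δ * (√s * s⁻¹ * s⁻¹) := by gcongr
    _ = _ := by rw [h2, inv_sqrt_mul_inv hs]

/-- The gain kernel is `1/2`-Hölder in its second argument as long as this moves on a sphere around
the origin by less than the distance to the diagonal. -/
theorem exists_abs_gainKernel_sub_le {γ : ℝ} {β : ℝ → ℝ} (hB : IsCutoffCrossSection γ β) :
    ∃ C : ℝ, 0 ≤ C ∧ ∀ ζ η₀ η₁ : R3, η₀ ≠ ζ → η₁ ≠ ζ → ‖η₀‖ = ‖η₁‖ →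
      ‖η₀ - η₁‖ ≤ ‖η₀ - ζ‖ / 2 → ‖η₀ - η₁‖ ≤ ‖η₁ - ζ‖ / 2 →
      |gainKernel γ β ζ η₀ - gainKernel γ β ζ η₁| ≤ C * (√(‖η₀ - η₁‖ * (1 + ‖ζ‖)) *
        (‖η₀ - ζ‖ ^ (-(3 / 2) : ℝ) * Real.exp (-‖η₀ - ζ‖ ^ 2 / 16) +
          ‖η₁ - ζ‖ ^ (-(3 / 2) : ℝ) * Real.exp (-‖η₁ - ζ‖ ^ 2 / 16))) := by
  obtain ⟨A, hA0, hA⟩ := exists_angular_le hB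
  obtain ⟨C, hC0, hC⟩ := exists_integral_angular_le hB
  refine ⟨(2 * Real.pi)⁻¹ * (25 * C), by positivity, fun ζ η₀ η₁ h₀ h₁ hn hd₀ hd₁ => ?_⟩
  have hs₀ : 0 < ‖η₀ - ζ‖ := norm_pos_iff.2 (sub_ne_zero.2 h₀)
  have hs₁ : 0 < ‖η₁ - ζ‖ := norm_pos_iff.2 (sub_ne_zero.2 h₁)
  have hss : |‖η₀ - ζ‖ - ‖η₁ - ζ‖| ≤ ‖η₀ - η₁‖ := by
    refine (abs_norm_sub_norm_le _ _).trans (le_of_eq ?_); congr 1; abel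
  have hpp := abs_gram_sub_le ζ η₀ η₁
  have hp₀ : |gram ζ η₀| ≤ ‖ζ‖ * ‖η₀ - ζ‖ := by
    rw [abs_of_nonneg (gram_nonneg _ _), ← gram_sub_left]; exact gram_le _ _
  have hp₁ : |gram ζ η₁| ≤ ‖ζ‖ * ‖η₁ - ζ‖ := by
    rw [abs_of_nonneg (gram_nonneg _ _), ← gram_sub_left]; exact gram_le _ _
  have hz := norm_nonneg ζ
  have hΔ := norm_nonneg (η₀ - η₁)
  rw [gainKernel_eq_integral_expPoint γ β h₀, gainKernel_eq_integral_expPoint γ β h₁, ← hn]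
  generalize ‖η₀ - ζ‖ = s₀ at *
  generalize ‖η₁ - ζ‖ = s₁ at *
  generalize gram ζ η₀ = p₀ at *
  generalize gram ζ η₁ = p₁ at *
  generalize ‖η₀ - η₁‖ = Δ at *
  generalize ‖η₀‖ ^ 2 - ‖ζ‖ ^ 2 = n at *
  generalize ‖ζ‖ = z at *
  clear h₀ h₁ hn
  have h₀₁ : s₀ ≤ 2 * s₁ := by have := abs_le.1 hss; linarith
  have h₁₀ : s₁ ≤ 2 * s₀ := by have := abs_le.1 hss; linarith
  obtain ⟨i0, b0⟩ := hC s₀ p₀ n hs₀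
  obtain ⟨i1, b1⟩ := hC s₁ p₁ n hs₁
  have hexp : ∀ r : ℝ, Real.exp (-r ^ 2) ≤ Real.exp (-r ^ 2 / 4) := fun r =>
    Real.exp_le_exp.2 (by nlinarith [sq_nonneg r])
  have hint : ∀ s p : ℝ, 0 < s → Integrable (fun u : R2 => angular γ β ‖u‖ *
        Real.exp (-‖expPoint s p n (u 0) (u 1)‖ ^ 2)) := by
    intro s p hs
    refine (hC s p n hs).1.mono' (Measurable.aestronglyMeasurable ?_)
      (Filter.Eventually.of_forall fun u => ?_)
    · have := measurable_exp_expPoint s p n 1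
      simp only [div_one] at this
      exact ((measurable_angular γ hB.measurable_beta).comp measurable_norm).mul this
    · rw [Real.norm_of_nonneg (mul_nonneg (hA _ (norm_nonneg _)).1 (Real.exp_pos _).le)]
      exact mul_le_mul_of_nonneg_left (hexp _) (hA _ (norm_nonneg _)).1
  have j0 := hint s₀ p₀ hs₀
  have j1 := hint s₁ p₁ hs₁
  have hI0 : |∫ u : R2, angular γ β ‖u‖ * Real.exp (-‖expPoint s₀ p₀ n (u 0) (u 1)‖ ^ 2)| ≤
      C * (s₀ ^ (-γ - 1) * Real.exp (-s₀ ^ 2 / 16)) := by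
    rw [abs_of_nonneg (integral_nonneg fun u =>
      mul_nonneg (hA _ (norm_nonneg _)).1 (Real.exp_pos _).le)]
    exact (integral_mono j0 i0 fun u =>
      mul_le_mul_of_nonneg_left (hexp _) (hA _ (norm_nonneg _)).1).trans b0
  have hdiff : |(∫ u : R2, angular γ β ‖u‖ * Real.exp (-‖expPoint s₀ p₀ n (u 0) (u 1)‖ ^ 2)) -
      ∫ u : R2, angular γ β ‖u‖ * Real.exp (-‖expPoint s₁ p₁ n (u 0) (u 1)‖ ^ 2)| ≤
      12 * √(Δ * (1 + z)) * ((√s₀)⁻¹ * (C * (s₀ ^ (-γ - 1) * Real.exp (-s₀ ^ 2 / 16))) +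
        (√s₁)⁻¹ * (C * (s₁ ^ (-γ - 1) * Real.exp (-s₁ ^ 2 / 16)))) := by
    rw [← integral_sub j0 j1]
    have k0 := (i0.const_mul (√s₀)⁻¹).add (i1.const_mul (√s₁)⁻¹)
    rw [← Real.norm_eq_abs]
    refine (norm_integral_le_of_norm_le (k0.const_mul (12 * √(Δ * (1 + z))))
      (Filter.Eventually.of_forall fun u => ?_)).trans ?_
    · have ha := (hA _ (norm_nonneg u)).1
      rw [← mul_sub, Real.norm_eq_abs, abs_mul, abs_of_nonneg ha]
      calc _ ≤ angular γ β ‖u‖ * _ := mul_le_mul_of_nonneg_left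
            (abs_exp_neg_expPoint_sub_le hs₀ hs₁ h₀₁ h₁₀ hz hss hpp hp₀ hp₁) ha
        _ = _ := by simp only [Pi.add_apply]; ring
    · simp only [Pi.add_apply]
      rw [integral_const_mul, integral_add (i0.const_mul _) (i1.const_mul _),
        integral_const_mul, integral_const_mul]
      gcongr
  have hpow : |s₀ ^ γ - s₁ ^ γ| ≤ s₀ ^ (γ - 1) * Δ :=
    (abs_rpow_sub_rpow_le hB.gamma_nonneg hB.gamma_lt_one hs₀ hs₁).trans (by gcongr)
  have hg1 : s₁ ^ γ ≤ 2 * s₀ ^ γ := by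
    calc s₁ ^ γ ≤ (2 * s₀) ^ γ := Real.rpow_le_rpow hs₁.le h₁₀ hB.gamma_nonneg
      _ = 2 ^ γ * s₀ ^ γ := Real.mul_rpow (by norm_num) hs₀.le
      _ ≤ 2 ^ (1 : ℝ) * s₀ ^ γ := by
          gcongr
          · norm_num
          · exact hB.gamma_lt_one.le
      _ = _ := by simp
  generalize (∫ u : R2, angular γ β ‖u‖ * Real.exp (-‖expPoint s₀ p₀ n (u 0) (u 1)‖ ^ 2)) = I₀ at *
  generalize (∫ u : R2, angular γ β ‖u‖ * Real.exp (-‖expPoint s₁ p₁ n (u 0) (u 1)‖ ^ 2)) = I₁ at *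
  have hcomb : ∀ s : ℝ, 0 < s → s ^ γ * s ^ (-γ - 1) = s⁻¹ := fun s hs => by
    rw [← Real.rpow_add hs, ← Real.rpow_neg_one]; congr 1; ring
  have hS : √Δ ≤ √(Δ * (1 + z)) := Real.sqrt_le_sqrt (by nlinarith)
  obtain ⟨E₀, hE₀⟩ : ∃ E, E = Real.exp (-s₀ ^ 2 / 16) := ⟨_, rfl⟩
  obtain ⟨E₁, hE₁⟩ : ∃ E, E = Real.exp (-s₁ ^ 2 / 16) := ⟨_, rfl⟩
  have hE₀p : 0 ≤ E₀ := hE₀ ▸ (Real.exp_pos _).le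
  have hE₁p : 0 ≤ E₁ := hE₁ ▸ (Real.exp_pos _).le
  rw [← hE₀] at hI0
  rw [← hE₀, ← hE₁] at hdiff ⊢
  -- `t1` is the difference of the prefactors `s ^ γ`, `t2` that of the integrals
  have t1 : |(s₀ ^ γ - s₁ ^ γ) * I₀| ≤ C * (√(Δ * (1 + z)) * (s₀ ^ (-(3 / 2) : ℝ) * E₀)) := by
    rw [abs_mul]
    calc _ ≤ (s₀ ^ (γ - 1) * Δ) * (C * (s₀ ^ (-γ - 1) * E₀)) :=
          mul_le_mul hpow hI0 (abs_nonneg _) (by positivity)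
      _ = C * ((Δ * (s₀⁻¹ * s₀⁻¹)) * E₀) := by
          rw [Real.rpow_sub_one hs₀.ne', ← hcomb s₀ hs₀]
          have := hs₀.ne'
          rw [show Δ * ((s₀ ^ γ * s₀ ^ (-γ - 1)) * (s₀ ^ γ * s₀ ^ (-γ - 1))) =
            Δ * s₀ ^ γ * s₀ ^ (-γ - 1) * (s₀ ^ γ * s₀ ^ (-γ - 1)) by ring, hcomb s₀ hs₀]
          ring
      _ ≤ C * ((√Δ * s₀ ^ (-(3 / 2) : ℝ)) * E₀) := by
          gcongr C * (?_ * E₀); exact mul_inv_mul_inv_le_sqrt hΔ hs₀ (by linarith)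
      _ ≤ C * ((√(Δ * (1 + z)) * s₀ ^ (-(3 / 2) : ℝ)) * E₀) := by gcongr
      _ = _ := by ring
  have t2 : |s₁ ^ γ * (I₀ - I₁)| ≤ C * (√(Δ * (1 + z)) * (24 * (s₀ ^ (-(3 / 2) : ℝ) * E₀) +
      12 * (s₁ ^ (-(3 / 2) : ℝ) * E₁))) := by
    rw [abs_mul, abs_of_nonneg (by positivity)]
    calc _ ≤ s₁ ^ γ * (12 * √(Δ * (1 + z)) * ((√s₀)⁻¹ * (C * (s₀ ^ (-γ - 1) * E₀)) +
        (√s₁)⁻¹ * (C * (s₁ ^ (-γ - 1) * E₁)))) := by gcongr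
      _ = 12 * C * √(Δ * (1 + z)) * (s₁ ^ γ * ((√s₀)⁻¹ * (s₀ ^ (-γ - 1) * E₀)) +
          (√s₁)⁻¹ * (s₁ ^ γ * s₁ ^ (-γ - 1)) * E₁) := by ring
      _ ≤ 12 * C * √(Δ * (1 + z)) * ((2 * s₀ ^ γ) * ((√s₀)⁻¹ * (s₀ ^ (-γ - 1) * E₀)) +
          (√s₁)⁻¹ * (s₁ ^ γ * s₁ ^ (-γ - 1)) * E₁) := by gcongr
      _ = 12 * C * √(Δ * (1 + z)) * (2 * ((√s₀)⁻¹ * (s₀ ^ γ * s₀ ^ (-γ - 1)) * E₀) +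
          (√s₁)⁻¹ * (s₁ ^ γ * s₁ ^ (-γ - 1)) * E₁) := by ring
      _ = _ := by
        rw [hcomb s₀ hs₀, hcomb s₁ hs₁, inv_sqrt_mul_inv hs₀, inv_sqrt_mul_inv hs₁]; ring
  have hsum : |s₀ ^ γ * I₀ - s₁ ^ γ * I₁| ≤
      25 * C * (√(Δ * (1 + z)) * (s₀ ^ (-(3 / 2) : ℝ) * E₀ + s₁ ^ (-(3 / 2) : ℝ) * E₁)) := by
    rw [show s₀ ^ γ * I₀ - s₁ ^ γ * I₁ = (s₀ ^ γ - s₁ ^ γ) * I₀ + s₁ ^ γ * (I₀ - I₁) by ring]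
    refine (abs_add_le _ _).trans ((add_le_add t1 t2).trans ?_)
    have : 0 ≤ C * (√(Δ * (1 + z)) * (s₁ ^ (-(3 / 2) : ℝ) * E₁)) := by positivity
    nlinarith
  rw [show (2 * Real.pi)⁻¹ * s₀ ^ γ * I₀ - (2 * Real.pi)⁻¹ * s₁ ^ γ * I₁ =
    (2 * Real.pi)⁻¹ * (s₀ ^ γ * I₀ - s₁ ^ γ * I₁) by ring, abs_mul,
    abs_of_pos (by positivity : 0 < (2 * Real.pi)⁻¹), mul_assoc (2 * Real.pi)⁻¹]
  gcongr

theorem exists_abs_lossKernel_sub_le {γ : ℝ} {β : ℝ → ℝ} (hB : IsCutoffCrossSection γ β) :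
    ∃ C : ℝ, 0 ≤ C ∧ ∀ ζ η₀ η₁ : R3, η₀ ≠ ζ → η₁ ≠ ζ → ‖η₀‖ = ‖η₁‖ →
      ‖η₀ - η₁‖ ≤ ‖η₀ - ζ‖ / 2 →
      |lossKernel γ β ζ η₀ - lossKernel γ β ζ η₁| ≤ C * (√‖η₀ - η₁‖ *
        (‖η₀ - ζ‖ ^ (-(3 / 2) : ℝ) * Real.exp (-‖η₀ - ζ‖ ^ 2 / 16))) := by
  have hb0 : 0 < beta0 β := hB.nontrivial
  refine ⟨beta0 β * 6, by positivity, fun ζ η₀ η₁ h₀ h₁ hn hd => ?_⟩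
  have hs₀ : 0 < ‖η₀ - ζ‖ := norm_pos_iff.2 (sub_ne_zero.2 h₀)
  have hs₁ : 0 < ‖η₁ - ζ‖ := norm_pos_iff.2 (sub_ne_zero.2 h₁)
  have hss : |‖η₀ - ζ‖ - ‖η₁ - ζ‖| ≤ ‖η₀ - η₁‖ := by
    refine (abs_norm_sub_norm_le _ _).trans (le_of_eq ?_); congr 1; abel
  have hM := sqrtMaxwellian_mul_le ζ η₀
  have hM0 : 0 ≤ sqrtMaxwellian ζ * sqrtMaxwellian η₀ :=
    mul_nonneg (Real.exp_pos _).le (Real.exp_pos _).le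
  have heq : sqrtMaxwellian η₁ = sqrtMaxwellian η₀ := by unfold sqrtMaxwellian; rw [hn]
  have hΔ := norm_nonneg (η₀ - η₁)
  unfold lossKernel
  rw [heq, norm_sub_rev ζ, norm_sub_rev ζ, mul_assoc, mul_assoc (beta0 β * _), ← sub_mul, ← mul_sub,
    abs_mul, abs_mul, abs_of_nonneg hM0, abs_of_pos hb0]
  have hr := rpow_add_one_mul_exp_le hB.gamma_nonneg hB.gamma_lt_one hs₀
  have hpow := abs_rpow_sub_rpow_le hB.gamma_nonneg hB.gamma_lt_one hs₀ hs₁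
  generalize ‖η₀ - ζ‖ = s₀ at *
  generalize ‖η₁ - ζ‖ = s₁ at *
  generalize ‖η₀ - η₁‖ = Δ at *
  calc _ ≤ beta0 β * (s₀ ^ (γ - 1) * Δ) * Real.exp (-s₀ ^ 2 / 4) := by
        gcongr; exact hpow.trans (by gcongr)
    _ = beta0 β * (Δ * (s₀⁻¹ * s₀⁻¹)) * (s₀ ^ (γ + 1) * Real.exp (-s₀ ^ 2 / 4)) := by
        rw [Real.rpow_sub_one hs₀.ne', Real.rpow_add_one hs₀.ne']; field_simp
    _ ≤ beta0 β * (√Δ * s₀ ^ (-(3 / 2) : ℝ)) * (6 * Real.exp (-s₀ ^ 2 / 16)) := by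
        gcongr beta0 β * ?_ * ?_
        exact mul_inv_mul_inv_le_sqrt hΔ hs₀ (by linarith)
    _ = _ := by ring

/-- Half-Hölder continuity of the collision kernel in its second argument along spheres around the
origin. -/
theorem exists_abs_collisionKernel_sub_le {γ : ℝ} {β : ℝ → ℝ} (hB : IsCutoffCrossSection γ β) :
    ∃ C : ℝ, 0 ≤ C ∧ ∀ ζ η₀ η₁ : R3, η₀ ≠ ζ → η₁ ≠ ζ → ‖η₀‖ = ‖η₁‖ →
      |collisionKernel γ β ζ η₀ - collisionKernel γ β ζ η₁| ≤ C * (√(‖η₀ - η₁‖ * (1 + ‖ζ‖)) *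
        (‖η₀ - ζ‖ ^ (-(3 / 2) : ℝ) * Real.exp (-‖η₀ - ζ‖ ^ 2 / 16) +
          ‖η₁ - ζ‖ ^ (-(3 / 2) : ℝ) * Real.exp (-‖η₁ - ζ‖ ^ 2 / 16))) := by
  obtain ⟨Cg, hCg0, hCg⟩ := exists_abs_gainKernel_sub_le hB
  obtain ⟨Cl, hCl0, hCl⟩ := exists_abs_lossKernel_sub_le hB
  obtain ⟨Ck, hCk0, hCk⟩ := exists_abs_collisionKernel_le hB
  refine ⟨Cg + Cl + 2 * Ck, by positivity, fun ζ η₀ η₁ h₀ h₁ hn => ?_⟩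
  have hs₀ : 0 < ‖η₀ - ζ‖ := norm_pos_iff.2 (sub_ne_zero.2 h₀)
  have hs₁ : 0 < ‖η₁ - ζ‖ := norm_pos_iff.2 (sub_ne_zero.2 h₁)
  have hss : |‖η₀ - ζ‖ - ‖η₁ - ζ‖| ≤ ‖η₀ - η₁‖ := by
    refine (abs_norm_sub_norm_le _ _).trans (le_of_eq ?_); congr 1; abel
  have hΔ := norm_nonneg (η₀ - η₁)
  have hz := norm_nonneg ζ
  have hS : √‖η₀ - η₁‖ ≤ √(‖η₀ - η₁‖ * (1 + ‖ζ‖)) := Real.sqrt_le_sqrt (by nlinarith)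
  have hE₀ := Real.exp_pos (-‖η₀ - ζ‖ ^ 2 / 16)
  have hE₁ := Real.exp_pos (-‖η₁ - ζ‖ ^ 2 / 16)
  have hH₀ : 0 ≤ ‖η₀ - ζ‖ ^ (-(3 / 2) : ℝ) * Real.exp (-‖η₀ - ζ‖ ^ 2 / 16) := by positivity
  have hH₁ : 0 ≤ ‖η₁ - ζ‖ ^ (-(3 / 2) : ℝ) * Real.exp (-‖η₁ - ζ‖ ^ 2 / 16) := by positivity
  by_cases hnear : ‖η₀ - η₁‖ ≤ ‖η₀ - ζ‖ / 2 ∧ ‖η₀ - η₁‖ ≤ ‖η₁ - ζ‖ / 2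
  · have hg := hCg ζ η₀ η₁ h₀ h₁ hn hnear.1 hnear.2
    have hl := hCl ζ η₀ η₁ h₀ h₁ hn hnear.1
    have hl' : |lossKernel γ β ζ η₀ - lossKernel γ β ζ η₁| ≤ Cl * (√(‖η₀ - η₁‖ * (1 + ‖ζ‖)) *
        (‖η₀ - ζ‖ ^ (-(3 / 2) : ℝ) * Real.exp (-‖η₀ - ζ‖ ^ 2 / 16) +
          ‖η₁ - ζ‖ ^ (-(3 / 2) : ℝ) * Real.exp (-‖η₁ - ζ‖ ^ 2 / 16))) := by
      refine hl.trans ?_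
      gcongr
      linarith
    have h3 : 0 ≤ 2 * Ck * (√(‖η₀ - η₁‖ * (1 + ‖ζ‖)) *
        (‖η₀ - ζ‖ ^ (-(3 / 2) : ℝ) * Real.exp (-‖η₀ - ζ‖ ^ 2 / 16) +
          ‖η₁ - ζ‖ ^ (-(3 / 2) : ℝ) * Real.exp (-‖η₁ - ζ‖ ^ 2 / 16))) := by positivity
    unfold collisionKernel
    rw [show ∀ a b c d : ℝ, a - b - (c - d) = (a - c) - (b - d) by intros; ring]
    refine (abs_sub _ _).trans ?_
    rw [add_mul, add_mul]
    linarith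
  · -- if the step is not small compared with the distance to the diagonal, both values are
    -- estimated separately
    have hfar : ‖η₀ - ζ‖ ≤ 3 * ‖η₀ - η₁‖ ∧ ‖η₁ - ζ‖ ≤ 3 * ‖η₀ - η₁‖ := by
      have := abs_le.1 hss
      by_contra hcon
      apply hnear
      constructor <;> by_contra h4 <;> apply hcon <;> constructor <;> linarith
    have aux : ∀ s E : ℝ, 0 < s → 0 ≤ E → s ≤ 3 * ‖η₀ - η₁‖ →
        Ck * (s⁻¹ * E) ≤ 2 * Ck * (√(‖η₀ - η₁‖ * (1 + ‖ζ‖)) * (s ^ (-(3 / 2) : ℝ) * E)) := by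
      intro s E hs hE h3
      have h4 : √s ≤ 2 * √‖η₀ - η₁‖ := by
        apply Real.sqrt_le_iff.2 ⟨by positivity, ?_⟩
        rw [mul_pow, Real.sq_sqrt hΔ]; linarith
      rw [← sqrt_mul_rpow_neg hs]
      calc _ ≤ Ck * ((2 * √(‖η₀ - η₁‖ * (1 + ‖ζ‖))) * s ^ (-(3 / 2) : ℝ) * E) := by
            gcongr; linarith
        _ = _ := by ring
    have k0 := (hCk ζ η₀ h₀).trans (aux _ _ hs₀ hE₀.le hfar.1)
    have k1 := (hCk ζ η₁ h₁).trans (aux _ _ hs₁ hE₁.le hfar.2)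
    have h3 : 0 ≤ (Cg + Cl) * (√(‖η₀ - η₁‖ * (1 + ‖ζ‖)) *
        (‖η₀ - ζ‖ ^ (-(3 / 2) : ℝ) * Real.exp (-‖η₀ - ζ‖ ^ 2 / 16) +
          ‖η₁ - ζ‖ ^ (-(3 / 2) : ℝ) * Real.exp (-‖η₁ - ζ‖ ^ 2 / 16))) := by positivity
    refine (abs_sub _ _).trans ((add_le_add k0 k1).trans ?_)
    rw [add_mul]
    linarith

/-! ### Velocity integrals bounded uniformly in the centre -/

/-- Two singularities of total order at most `5 / 2` are dominated by one of order `5 / 2`. -/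
theorem rpow_neg_mul_rpow_neg_le {a b ρ s : ℝ} (ha : 0 ≤ a) (hb : 0 ≤ b) (hab : a + b ≤ 5 / 2)
    (hρ : 0 < ρ) (hs : 0 < s) :
    ρ ^ (-a) * s ^ (-b) ≤ 1 + ρ ^ (-(5 / 2) : ℝ) + s ^ (-(5 / 2) : ℝ) := by
  obtain ⟨m, hm⟩ : ∃ m, m = min 1 (min ρ s) := ⟨_, rfl⟩
  have hm0 : 0 < m := by rw [hm]; exact lt_min one_pos (lt_min hρ hs)
  have h1 : m ≤ 1 := hm ▸ min_le_left _ _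
  have h2 : m ≤ ρ := hm ▸ (min_le_right _ _).trans (min_le_left _ _)
  have h3 : m ≤ s := hm ▸ (min_le_right _ _).trans (min_le_right _ _)
  have p1 : 0 < ρ ^ (-(5 / 2) : ℝ) := Real.rpow_pos_of_pos hρ _
  have p2 : 0 < s ^ (-(5 / 2) : ℝ) := Real.rpow_pos_of_pos hs _
  calc ρ ^ (-a) * s ^ (-b) ≤ m ^ (-a) * m ^ (-b) := by
        have := Real.rpow_le_rpow_of_nonpos hm0 h2 (by linarith : -a ≤ 0)
        have := Real.rpow_le_rpow_of_nonpos hm0 h3 (by linarith : -b ≤ 0)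
        gcongr
    _ = m ^ (-(a + b)) := by rw [← Real.rpow_add hm0]; congr 1; ring
    _ ≤ m ^ (-(5 / 2) : ℝ) := Real.rpow_le_rpow_of_exponent_ge hm0 h1 (by linarith)
    _ ≤ _ := by
      rcases min_choice 1 (min ρ s) with h | h
      · rw [← hm] at h; rw [h, Real.one_rpow]; linarith
      · rcases min_choice ρ s with h' | h' <;> rw [← hm, h'] at h <;> rw [h] <;> linarith

/-- A weight with singularities of order `5 / 2 < 3` at `ζ' = 0` and at `ζ' = ζ`. It dominates every
velocity factor that occurs, and its integral in `ζ'` is bounded uniformly in `ζ`. -/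
noncomputable def psi (ζ ζ' : R3) : ℝ :=
  (1 + ‖ζ'‖ ^ (-(5 / 2) : ℝ) + ‖ζ' - ζ‖ ^ (-(5 / 2) : ℝ)) * Real.exp (-‖ζ' - ζ‖ ^ 2 / 16)

theorem psi_nonneg (ζ ζ' : R3) : 0 ≤ psi ζ ζ' := by unfold psi; positivity

theorem measurable_psi (ζ : R3) : Measurable (psi ζ) := by
  unfold psi
  refine ((measurable_const.add (measurable_norm.pow_const _)).add
    ((measurable_norm.comp (measurable_id.sub_const ζ)).pow_const _)).mul ?_
  fun_prop

theorem rpow_mul_rpow_mul_exp_le_psi {a b : ℝ} (ha : 0 ≤ a) (hb : 0 ≤ b) (hab : a + b ≤ 5 / 2)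
    {ζ ζ' : R3} (h0 : ζ' ≠ 0) (h : ζ' ≠ ζ) :
    ‖ζ'‖ ^ (-a) * ‖ζ' - ζ‖ ^ (-b) * Real.exp (-‖ζ' - ζ‖ ^ 2 / 16) ≤ psi ζ ζ' := by
  unfold psi
  gcongr
  exact rpow_neg_mul_rpow_neg_le ha hb hab (norm_pos_iff.2 h0) (norm_pos_iff.2 (sub_ne_zero.2 h))

theorem rpow_mul_exp_le_psi {b : ℝ} (hb : 0 ≤ b) (hab : b ≤ 5 / 2)
    {ζ ζ' : R3} (h : ζ' ≠ ζ) :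
    ‖ζ' - ζ‖ ^ (-b) * Real.exp (-‖ζ' - ζ‖ ^ 2 / 16) ≤ psi ζ ζ' := by
  unfold psi
  gcongr
  have := rpow_neg_mul_rpow_neg_le le_rfl hb (by linarith) one_pos
    (norm_pos_iff.2 (sub_ne_zero.2 h))
  rw [Real.one_rpow, one_mul] at this
  have hs := norm_pos_iff.2 (sub_ne_zero.2 h)
  rcases le_total ‖ζ' - ζ‖ 1 with h1 | h1
  · have := Real.rpow_le_rpow_of_exponent_ge hs h1 (by linarith : -(5 / 2) ≤ -b)
    have : 0 ≤ ‖ζ'‖ ^ (-(5 / 2) : ℝ) := by positivity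
    linarith
  · have := Real.rpow_le_one_of_one_le_of_nonpos h1 (by linarith : -b ≤ 0)
    have : 0 ≤ ‖ζ'‖ ^ (-(5 / 2) : ℝ) := by positivity
    have : 0 ≤ ‖ζ' - ζ‖ ^ (-(5 / 2) : ℝ) := by positivity
    linarith

theorem exists_integral_psi_le : ∃ C : ℝ, 0 ≤ C ∧ ∀ ζ : R3,
    Integrable (psi ζ) ∧ ∫ ζ', psi ζ ζ' ≤ C := by
  obtain ⟨C₁, h1, H1⟩ := exists_integral_rpow_norm_mul_gaussian_le 3 (c := 1 / 16) (q := 0)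
    (by norm_num) le_rfl (by norm_num)
  obtain ⟨C₂, h2, H2⟩ := exists_integral_rpow_norm_mul_gaussian_le 3 (c := 1 / 16)
    (q := -(5 / 2)) (by norm_num) (by norm_num) (by norm_num)
  refine ⟨C₁ + C₂ + C₂, by positivity, fun ζ => ?_⟩
  obtain ⟨i1, b1⟩ := H1 (-ζ)
  obtain ⟨i2, b2⟩ := H2 (-ζ)
  obtain ⟨i3, b3⟩ := H2 0
  have i3' := i3.comp_sub_right ζ
  rw [← integral_sub_right_eq_self _ ζ] at b3
  have heq : psi ζ = fun w => (‖w‖ ^ (0 : ℝ) * Real.exp (-(1 / 16) * ‖w + -ζ‖ ^ 2) +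
      ‖w‖ ^ (-(5 / 2) : ℝ) * Real.exp (-(1 / 16) * ‖w + -ζ‖ ^ 2)) +
      ‖w - ζ‖ ^ (-(5 / 2) : ℝ) * Real.exp (-(1 / 16) * ‖w - ζ + 0‖ ^ 2) := by
    funext w
    rw [psi, Real.rpow_zero, add_zero, ← sub_eq_add_neg,
      show -(1 / 16) * ‖w - ζ‖ ^ 2 = -‖w - ζ‖ ^ 2 / 16 by ring]
    ring
  rw [heq]
  refine ⟨(i1.add i2).add i3', ?_⟩
  have := integral_add (i1.add i2) i3'
  simp only [Pi.add_apply] at this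
  rw [this, integral_add i1 i2]
  linarith

theorem ae_ne (ζ : R3) : ∀ᵐ η : R3, η ≠ ζ := by
  simp [ae_iff]

theorem exists_integral_collisionKernel_le {γ : ℝ} {β : ℝ → ℝ} (hB : IsCutoffCrossSection γ β) :
    ∃ C : ℝ, 0 ≤ C ∧ ∀ ζ : R3, Integrable (collisionKernel γ β ζ) ∧
      ∫ η, |collisionKernel γ β ζ η| ≤ C := by
  obtain ⟨C, hC0, hC⟩ := exists_abs_collisionKernel_le hB
  obtain ⟨P, hP0, hP⟩ := exists_integral_psi_le
  refine ⟨C * P, by positivity, fun ζ => ?_⟩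
  obtain ⟨hi, hb⟩ := hP ζ
  have hle : ∀ᵐ η, |collisionKernel γ β ζ η| ≤ C * psi ζ η := by
    filter_upwards [ae_ne ζ] with η hη
    refine (hC ζ η hη).trans ?_
    gcongr
    rw [← Real.rpow_neg_one]
    exact rpow_mul_exp_le_psi (by norm_num) (by norm_num) hη
  have hint : Integrable (collisionKernel γ β ζ) :=
    (hi.const_mul C).mono' ((measurable_collisionKernel γ hB.measurable_beta).comp
      measurable_prodMk_left).aestronglyMeasurable hle
  refine ⟨hint, (integral_mono_ae hint.abs (hi.const_mul C) hle).trans ?_⟩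
  rw [integral_const_mul]; gcongr

/-- The kernels `k(ζ₀, ·)` and `k(ζ₁, ·)` are close in `L¹` for velocities of the same speed. -/
theorem exists_integral_collisionKernel_sub_le {γ : ℝ} {β : ℝ → ℝ}
    (hB : IsCutoffCrossSection γ β) :
    ∃ C : ℝ, 0 ≤ C ∧ ∀ ζ₀ ζ₁ : R3, ‖ζ₀‖ = ‖ζ₁‖ →
      ∫ η, |collisionKernel γ β ζ₀ η - collisionKernel γ β ζ₁ η| ≤
        C * √(‖ζ₀ - ζ₁‖ * (1 + ‖ζ₀‖)) := by
  obtain ⟨C, hC0, hC⟩ := exists_abs_collisionKernel_sub_le hB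
  obtain ⟨P, hP0, hP⟩ := exists_integral_psi_le
  refine ⟨C * (4 * P), by positivity, fun ζ₀ ζ₁ hn => ?_⟩
  obtain ⟨i0, b0⟩ := hP ζ₀
  obtain ⟨i1, b1⟩ := hP ζ₁
  have aux : ∀ ζ η : R3, ‖ζ‖ = ‖ζ₀‖ → η ≠ ζ → √(‖ζ₀ - ζ₁‖ * (1 + ‖η‖)) *
      (‖ζ - η‖ ^ (-(3 / 2) : ℝ) * Real.exp (-‖ζ - η‖ ^ 2 / 16)) ≤
        √(‖ζ₀ - ζ₁‖ * (1 + ‖ζ₀‖)) * (2 * psi ζ η) := by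
    intro ζ η h hne
    have hs : 0 < ‖η - ζ‖ := norm_pos_iff.2 (sub_ne_zero.2 hne)
    have h1 : √(‖ζ₀ - ζ₁‖ * (1 + ‖η‖)) ≤ √(‖ζ₀ - ζ₁‖ * (1 + ‖ζ₀‖)) * (1 + √‖η - ζ‖) := by
      apply Real.sqrt_le_iff.2 ⟨by positivity, ?_⟩
      rw [mul_pow, Real.sq_sqrt (by positivity), mul_assoc]
      have h2 : ‖η‖ ≤ ‖ζ₀‖ + ‖η - ζ‖ := by
        rw [← h]; simpa using norm_add_le ζ (η - ζ)
      have h3 : 1 + ‖η - ζ‖ ≤ (1 + √‖η - ζ‖) ^ 2 := by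
        nlinarith [Real.sq_sqrt hs.le, Real.sqrt_nonneg ‖η - ζ‖]
      have h4 : 1 + ‖η‖ ≤ (1 + ‖ζ₀‖) * (1 + ‖η - ζ‖) := by
        nlinarith [mul_nonneg (norm_nonneg ζ₀) hs.le]
      gcongr
      exact h4.trans (by gcongr)
    rw [norm_sub_rev ζ η]
    calc _ ≤ √(‖ζ₀ - ζ₁‖ * (1 + ‖ζ₀‖)) * (1 + √‖η - ζ‖) *
          (‖η - ζ‖ ^ (-(3 / 2) : ℝ) * Real.exp (-‖η - ζ‖ ^ 2 / 16)) := by gcongr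
      _ = √(‖ζ₀ - ζ₁‖ * (1 + ‖ζ₀‖)) *
          (‖η - ζ‖ ^ (-(3 / 2) : ℝ) * Real.exp (-‖η - ζ‖ ^ 2 / 16) +
            ‖η - ζ‖ ^ (-1 : ℝ) * Real.exp (-‖η - ζ‖ ^ 2 / 16)) := by
          rw [Real.rpow_neg_one, ← sqrt_mul_rpow_neg hs]; ring
      _ ≤ √(‖ζ₀ - ζ₁‖ * (1 + ‖ζ₀‖)) * (psi ζ η + psi ζ η) := by
          gcongr
          · exact rpow_mul_exp_le_psi (by norm_num) (by norm_num) hne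
          · exact rpow_mul_exp_le_psi (by norm_num) (by norm_num) hne
      _ = _ := by ring
  have hle : ∀ᵐ η, |collisionKernel γ β ζ₀ η - collisionKernel γ β ζ₁ η| ≤
      C * √(‖ζ₀ - ζ₁‖ * (1 + ‖ζ₀‖)) * (2 * psi ζ₀ η + 2 * psi ζ₁ η) := by
    filter_upwards [ae_ne ζ₀, ae_ne ζ₁] with η h0 h1
    -- by symmetry the moving velocity becomes the second argument of the kernel
    rw [collisionKernel_comm γ β ζ₀, collisionKernel_comm γ β ζ₁]
    refine (hC η ζ₀ ζ₁ h0.symm h1.symm hn).trans ?_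
    rw [mul_assoc]
    refine mul_le_mul_of_nonneg_left ?_ hC0
    linarith [aux ζ₀ η rfl h0, aux ζ₁ η hn.symm h1]
  have hint := (((i0.const_mul 2).add (i1.const_mul 2)).const_mul
    (C * √(‖ζ₀ - ζ₁‖ * (1 + ‖ζ₀‖))))
  refine (integral_mono_of_nonneg (Filter.Eventually.of_forall fun _ => abs_nonneg _) hint
    hle).trans ?_
  simp only [Pi.add_apply]
  rw [integral_const_mul, integral_add (i0.const_mul 2) (i1.const_mul 2), integral_const_mul,
    integral_const_mul]
  calc _ ≤ C * √(‖ζ₀ - ζ₁‖ * (1 + ‖ζ₀‖)) * (2 * P + 2 * P) := by gcongr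
    _ = _ := by ring

/-! ### The collision frequency -/

/-- The collision frequency depends only on the speed. -/
theorem nu_eq_of_norm_eq (γ : ℝ) (β : ℝ → ℝ) {ζ₀ ζ₁ : R3} (h : ‖ζ₀‖ = ‖ζ₁‖) :
    nu γ β ζ₀ = nu γ β ζ₁ := by
  let r : R3 ≃ₗᵢ[ℝ] R3 := (Submodule.span ℝ {ζ₀ - ζ₁})ᗮ.reflection
  have hr : r ζ₀ = ζ₁ := Submodule.reflection_sub h
  unfold nu
  congr 1
  rw [← r.measurePreserving.integral_comp' (f := r.toMeasurableEquiv)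
    (fun η => Real.exp (-‖η‖ ^ 2) * ‖η - ζ₁‖ ^ γ)]
  congr 1 with η
  change _ = Real.exp (-‖r η‖ ^ 2) * ‖r η - ζ₁‖ ^ γ
  rw [← hr, ← map_sub, LinearIsometryEquiv.norm_map, LinearIsometryEquiv.norm_map]

theorem nu_nonneg {γ : ℝ} {β : ℝ → ℝ} (hB : IsCutoffCrossSection γ β) (ζ : R3) :
    0 ≤ nu γ β ζ :=
  mul_nonneg hB.nontrivial.le (integral_nonneg fun _ => by positivity)

theorem exists_nu_le {γ : ℝ} {β : ℝ → ℝ} (hB : IsCutoffCrossSection γ β) :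
    ∃ C : ℝ, 0 ≤ C ∧ ∀ ζ : R3, nu γ β ζ ≤ C * (1 + ‖ζ‖) := by
  have i0 := integrable_rpow_norm_mul_gaussian (n := 3) (c := 1) (q := 0) one_pos (by norm_num)
  have i1 := integrable_rpow_norm_mul_gaussian (n := 3) (c := 1) (q := 1) one_pos (by norm_num)
  have i2 := i0.add i1
  have hb0 : 0 < beta0 β := hB.nontrivial
  refine ⟨beta0 β * ∫ η : R3, (‖η‖ ^ (0 : ℝ) * Real.exp (-1 * ‖η‖ ^ 2) +
    ‖η‖ ^ (1 : ℝ) * Real.exp (-1 * ‖η‖ ^ 2)),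
    mul_nonneg hb0.le (integral_nonneg fun _ => by positivity), fun ζ => ?_⟩
  unfold nu
  rw [mul_assoc]
  gcongr
  rw [← integral_mul_const]
  refine integral_mono_of_nonneg (Filter.Eventually.of_forall fun _ => by positivity)
    (i2.mul_const _) (Filter.Eventually.of_forall fun η => ?_)
  simp only [Real.rpow_zero, Real.rpow_one, neg_mul, one_mul]
  have h1 : ‖η - ζ‖ ^ γ ≤ (1 + ‖η‖) * (1 + ‖ζ‖) := by
    have h2 : ‖η - ζ‖ ^ γ ≤ (1 + ‖η - ζ‖) ^ γ :=
      Real.rpow_le_rpow (norm_nonneg _) (by linarith) hB.gamma_nonneg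
    have h3 := Real.rpow_le_rpow_of_exponent_le (by linarith [norm_nonneg (η - ζ)] :
      1 ≤ 1 + ‖η - ζ‖) hB.gamma_lt_one.le
    rw [Real.rpow_one] at h3
    have h4 := norm_sub_le η ζ
    nlinarith [mul_nonneg (norm_nonneg η) (norm_nonneg ζ)]
  calc _ ≤ Real.exp (-‖η‖ ^ 2) * ((1 + ‖η‖) * (1 + ‖ζ‖)) := by gcongr
    _ = _ := by ring

theorem measurable_nu (γ : ℝ) (β : ℝ → ℝ) : Measurable (nu γ β) := by
  unfold nu
  refine measurable_const.mul ?_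
  have : StronglyMeasurable (Function.uncurry fun (ζ η : R3) =>
      Real.exp (-‖η‖ ^ 2) * ‖η - ζ‖ ^ γ) := by
    apply Measurable.stronglyMeasurable
    exact (by fun_prop : Measurable fun q : R3 × R3 => Real.exp (-‖q.2‖ ^ 2)).mul
      ((by fun_prop : Measurable fun q : R3 × R3 => ‖q.2 - q.1‖).pow_const _)
  exact (this.integral_prod_right (ν := (volume : Measure R3))).measurable

/-! ### From velocity and time to speed and position -/

theorem ofReal_mul_setLIntegral_comp_mul {ρ : ℝ} (hρ : 0 < ρ) {g : ℝ → ℝ≥0∞}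
    (hg : Measurable g) :
    ENNReal.ofReal ρ * ∫⁻ t in Ioi (0 : ℝ), g (t * ρ) = ∫⁻ r in Ioi (0 : ℝ), g r := by
  rw [← lintegral_indicator measurableSet_Ioi, ← lintegral_indicator measurableSet_Ioi]
  nth_rw 2 [← Real.smul_map_volume_mul_left hρ.ne']
  rw [lintegral_smul_measure, lintegral_map (hg.indicator measurableSet_Ioi)
    (measurable_const_mul ρ), abs_of_pos hρ, smul_eq_mul]
  congr 2 with t
  simp [indicator, hρ, mul_comm]

/-- Integration in polar coordinates in `ℝ³`. -/
theorem lintegral_eq_lintegral_sphere {f : R3 → ℝ≥0∞} (hf : Measurable f) :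
    ∫⁻ x, f x = ∫⁻ ω, (∫⁻ r in Ioi (0 : ℝ), ENNReal.ofReal (r ^ 2) * f (r • (ω : R3)))
      ∂((volume : Measure R3).toSphere) := by
  have h1 : ∫⁻ x, f x = ∫⁻ x in ({0}ᶜ : Set R3), f x := by
    rw [restrict_compl_singleton]
  have hfr : Module.finrank ℝ R3 - 1 = 2 := by simp
  have hmp := (volume : Measure R3).measurePreserving_homeomorphUnitSphereProd
  rw [hfr] at hmp
  rw [h1, ← lintegral_subtype_comap (measurableSet_singleton (0 : R3)).compl f]
  have h2 := hmp.lintegral_comp_emb (Homeomorph.measurableEmbedding _)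
    (fun p => f ((p.2 : ℝ) • (p.1 : R3)))
  have h3 : ∀ x : ({0}ᶜ : Set R3), ((homeomorphUnitSphereProd R3 x).2 : ℝ) •
      ((homeomorphUnitSphereProd R3 x).1 : R3) = x := by
    intro x
    rw [← homeomorphUnitSphereProd_symm_apply_coe]; simp
  simp only [h3] at h2
  have hm : Measurable fun p : Metric.sphere (0 : R3) 1 × Ioi (0 : ℝ) =>
      f ((p.2 : ℝ) • (p.1 : R3)) := by fun_prop
  rw [h2, lintegral_prod _ hm.aemeasurable]
  refine lintegral_congr fun ω => ?_
  rw [Measure.volumeIoiPow, lintegral_withDensity_eq_lintegral_mul _ (by fun_prop) (by fun_prop)]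
  exact lintegral_subtype_comap measurableSet_Ioi
    (fun r : ℝ => ENNReal.ofReal (r ^ 2) * f (r • (ω : R3)))

/-- The map from velocity and backward time to speed and position. -/
noncomputable def speedPosition (x : R3) (q : R3 × ℝ) : ℝ × R3 := (‖q.1‖, x - q.2 • q.1)

theorem measurable_speedPosition (x : R3) : Measurable (speedPosition x) := by
  unfold speedPosition; fun_prop

/-- The Jacobian `ρ / |x - y|²` of the change from velocity and time to speed and position. -/
noncomputable def jac (x : R3) (p : ℝ × R3) : ℝ := p.1 / ‖x - p.2‖ ^ 2

theorem measurable_jac (x : R3) : Measurable (jac x) := by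
  unfold jac; fun_prop

theorem lintegral_speedPosition (x : R3) {F : ℝ × R3 → ℝ≥0∞} (hF : Measurable F) :
    ∫⁻ q, F (speedPosition x q) ∂((volume : Measure R3).prod (volume.restrict (Ioi (0 : ℝ)))) =
      ∫⁻ p, ENNReal.ofReal (jac x p) * F p
        ∂((volume.restrict (Ioi (0 : ℝ))).prod (volume : Measure R3)) := by
  have hT := measurable_speedPosition x
  have hJ := measurable_jac x
  have hFT : Measurable fun q => F (speedPosition x q) := hF.comp hT
  rw [lintegral_prod _ hFT.aemeasurable, lintegral_prod _ (by fun_prop)]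
  have hL : ∫⁻ ζ : R3, ∫⁻ t in Ioi (0 : ℝ), F (speedPosition x (ζ, t)) =
      ∫⁻ ω, (∫⁻ ρ in Ioi (0 : ℝ), ENNReal.ofReal ρ *
        ∫⁻ r in Ioi (0 : ℝ), F (ρ, x - r • (ω : R3))) ∂((volume : Measure R3).toSphere) := by
    rw [lintegral_eq_lintegral_sphere
      (f := fun ζ => ∫⁻ t in Ioi (0 : ℝ), F (speedPosition x (ζ, t)))
      hFT.lintegral_prod_right']
    refine lintegral_congr fun ω => setLIntegral_congr_fun measurableSet_Ioi fun ρ hρ => ?_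
    have hρ : 0 < ρ := hρ
    have hω : ‖(ω : R3)‖ = 1 := by simp
    simp only [speedPosition, norm_smul, hω, Real.norm_of_nonneg hρ.le, mul_one, smul_smul]
    rw [← ofReal_mul_setLIntegral_comp_mul hρ (g := fun r => F (ρ, x - r • (ω : R3)))
      (by fun_prop), ← mul_assoc, ← ENNReal.ofReal_mul hρ.le, sq]
  have hR : ∀ ρ ∈ Ioi (0 : ℝ), ∫⁻ y : R3, ENNReal.ofReal (jac x (ρ, y)) * F (ρ, y) =
      ∫⁻ ω, (ENNReal.ofReal ρ *
        ∫⁻ r in Ioi (0 : ℝ), F (ρ, x - r • (ω : R3))) ∂((volume : Measure R3).toSphere) := by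
    intro ρ hρ
    have hρ : 0 < ρ := hρ
    rw [← lintegral_sub_left_eq_self _ x, lintegral_eq_lintegral_sphere (by fun_prop)]
    refine lintegral_congr fun ω => ?_
    rw [← lintegral_const_mul _ (by fun_prop)]
    refine setLIntegral_congr_fun measurableSet_Ioi fun r hr => ?_
    have hr : 0 < r := hr
    have hω : ‖(ω : R3)‖ = 1 := by simp
    simp only [jac, sub_sub_cancel, norm_smul, hω, Real.norm_of_nonneg hr.le, mul_one]
    rw [← mul_assoc, ← ENNReal.ofReal_mul (by positivity)]
    congr 2
    field_simp
  rw [hL, setLIntegral_congr_fun measurableSet_Ioi hR, lintegral_lintegral_swap]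
  have hm : Measurable fun q : (Metric.sphere (0 : R3) 1 × ℝ) × ℝ =>
      F (q.1.2, x - q.2 • (q.1.1 : R3)) := by fun_prop
  exact ((measurable_snd.ennreal_ofReal).mul
    (hm.lintegral_prod_right' (ν := volume.restrict (Ioi (0 : ℝ))))).aemeasurable

theorem measurePreserving_speedPosition (x : R3) :
    MeasurePreserving (speedPosition x)
      ((volume : Measure R3).prod (volume.restrict (Ioi (0 : ℝ))))
      (((volume.restrict (Ioi (0 : ℝ))).prod (volume : Measure R3)).withDensity
        fun p => ENNReal.ofReal (jac x p)) := by
  refine ⟨measurable_speedPosition x, Measure.ext_of_lintegral _ fun F hF => ?_⟩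
  rw [lintegral_map hF (measurable_speedPosition x), lintegral_speedPosition x hF,
    lintegral_withDensity_eq_lintegral_mul _ (measurable_jac x).ennreal_ofReal hF]
  rfl

/-- Velocities and times for which the backward trajectory is in `Ω`. -/
noncomputable def trajMeasure (Ω : Set R3) (x : R3) : Measure (R3 × ℝ) :=
  ((volume : Measure R3).prod (volume.restrict (Ioi (0 : ℝ)))).restrict
    (speedPosition x ⁻¹' (univ ×ˢ Ω))

theorem measurePreserving_trajMeasure {Ω : Set R3} (hΩ : MeasurableSet Ω) (x : R3) :
    MeasurePreserving (speedPosition x) (trajMeasure Ω x)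
      ((volume.restrict (Ioi (0 : ℝ) ×ˢ Ω)).withDensity fun p => ENNReal.ofReal (jac x p)) := by
  have h := (measurePreserving_speedPosition x).restrict_preimage
    ((MeasurableSet.univ (α := ℝ)).prod hΩ)
  rw [restrict_withDensity (MeasurableSet.univ.prod hΩ)] at h
  nth_rw 2 [← Measure.restrict_univ (μ := (volume : Measure R3))] at h
  rw [Measure.prod_restrict, Measure.restrict_restrict (MeasurableSet.univ.prod hΩ),
    prod_inter_prod, univ_inter, inter_univ, ← Measure.volume_eq_prod] at h
  exact h

theorem integrable_comp_speedPosition_iff {Ω : Set R3} (hΩ : MeasurableSet Ω) (x : R3)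
    {H : ℝ × R3 → ℝ} (hH : AEStronglyMeasurable H (volume.restrict (Ioi (0 : ℝ) ×ˢ Ω))) :
    Integrable (fun q => H (speedPosition x q)) (trajMeasure Ω x) ↔
      IntegrableOn (fun p => jac x p * H p) (Ioi (0 : ℝ) ×ˢ Ω) := by
  have hmp := measurePreserving_trajMeasure hΩ x
  have hH' := hH.mono_ac (withDensity_absolutelyContinuous _ fun p => ENNReal.ofReal (jac x p))
  refine (hmp.integrable_comp hH').trans ?_
  rw [integrable_withDensity_iff_integrable_smul' (measurable_jac x).ennreal_ofReal
    (Filter.Eventually.of_forall fun _ => ENNReal.ofReal_lt_top), IntegrableOn]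
  refine integrable_congr ?_
  filter_upwards [ae_restrict_mem (measurableSet_Ioi.prod hΩ)] with p hp
  have : 0 < p.1 := hp.1
  rw [ENNReal.toReal_ofReal (by unfold jac; positivity), smul_eq_mul]

theorem integral_comp_speedPosition {Ω : Set R3} (hΩ : MeasurableSet Ω) (x : R3)
    {H : ℝ × R3 → ℝ} (hH : AEStronglyMeasurable H (volume.restrict (Ioi (0 : ℝ) ×ˢ Ω))) :
    ∫ q, H (speedPosition x q) ∂(trajMeasure Ω x) =
      ∫ p in Ioi (0 : ℝ) ×ˢ Ω, jac x p * H p := by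
  have hmp := measurePreserving_trajMeasure hΩ x
  have hH' := hH.mono_ac (withDensity_absolutelyContinuous _ fun p => ENNReal.ofReal (jac x p))
  rw [← integral_map hmp.measurable.aemeasurable (by rwa [hmp.map_eq]), hmp.map_eq,
    integral_withDensity_eq_integral_toReal_smul (measurable_jac x).ennreal_ofReal
    (Filter.Eventually.of_forall fun _ => ENNReal.ofReal_lt_top)]
  refine integral_congr_ae ?_
  filter_upwards [ae_restrict_mem (measurableSet_Ioi.prod hΩ)] with p hp
  have : 0 < p.1 := hp.1
  rw [ENNReal.toReal_ofReal (by unfold jac; positivity), smul_eq_mul]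

theorem dirVel_speedPosition (x : R3) {ζ : R3} (hζ : ζ ≠ 0) {t : ℝ} (ht : 0 < t) :
    dirVel x (speedPosition x (ζ, t)).2 (speedPosition x (ζ, t)).1 = ζ := by
  have : ‖ζ‖ ≠ 0 := norm_ne_zero_iff.2 hζ
  simp only [dirVel, speedPosition, sub_sub_cancel, norm_smul, Real.norm_of_nonneg ht.le, smul_smul]
  rw [show ‖ζ‖ / (t * ‖ζ‖) * t = 1 by field_simp, one_smul]

theorem norm_dirVel {x y : R3} (h : x ≠ y) {ρ : ℝ} (hρ : 0 < ρ) : ‖dirVel x y ρ‖ = ρ := by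
  have : 0 < ‖x - y‖ := norm_pos_iff.2 (sub_ne_zero.2 h)
  rw [dirVel, norm_smul, Real.norm_of_nonneg (by positivity)]
  field_simp

theorem measurable_dirVel (x : R3) : Measurable fun p : ℝ × R3 => dirVel x p.2 p.1 := by
  unfold dirVel; fun_prop

theorem setLIntegral_rpow_lt_top (R : ℝ) :
    ∫⁻ r in Ioi (0 : ℝ),
      (Iio R).indicator (fun r => ENNReal.ofReal (r ^ (-(1 / 2) : ℝ))) r < ∞ := by
  rw [setLIntegral_indicator measurableSet_Iio, Iio_inter_Ioi]
  rcases le_or_gt R 0 with hR | hR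
  · simp [Ioo_eq_empty_of_le hR]
  have h : IntegrableOn (fun r : ℝ => r ^ (-(1 / 2) : ℝ)) (Ioo 0 R) :=
    (intervalIntegral.integrableOn_Ioo_rpow_iff hR).2 (by norm_num)
  exact h.lintegral_lt_top

/-- The dominating function for the integrand of `G` in the variables speed and position. -/
noncomputable def dominator (x ζ : R3) (p : ℝ × R3) : ℝ :=
  p.1 ^ 2 * psi ζ (dirVel x p.2 p.1) * ‖x - p.2‖ ^ (-(5 / 2) : ℝ)

theorem measurable_dominator (x ζ : R3) : Measurable (dominator x ζ) := by
  unfold dominator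
  exact ((measurable_fst.pow_const 2).mul ((measurable_psi ζ).comp (measurable_dirVel x))).mul
    ((by fun_prop : Measurable fun p : ℝ × R3 => ‖x - p.2‖).pow_const _)

theorem dominator_nonneg (x ζ : R3) (p : ℝ × R3) : 0 ≤ dominator x ζ p :=
  mul_nonneg (mul_nonneg (sq_nonneg _) (psi_nonneg _ _)) (by positivity)

/-- In velocity and time the dominating function separates: the time integral gives
`∫_0^R r^{-1/2} dr`, uniformly in the velocity, and the velocity integral is that of `psi`. -/
theorem exists_integral_dominator_le {Ω : Set R3} (hΩ : MeasurableSet Ω)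
    (hb : Bornology.IsBounded Ω) : ∃ C : ℝ, 0 ≤ C ∧ ∀ x ∈ Ω, ∀ ζ : R3,
      IntegrableOn (dominator x ζ) (Ioi (0 : ℝ) ×ˢ Ω) ∧
        ∫ p in Ioi (0 : ℝ) ×ˢ Ω, dominator x ζ p ≤ C := by
  obtain ⟨P, hP0, hP⟩ := exists_integral_psi_le
  obtain ⟨R, hR⟩ := Metric.isBounded_iff.1 hb
  set c := ∫⁻ r in Ioi (0 : ℝ),
    (Iio (R + 1)).indicator (fun r => ENNReal.ofReal (r ^ (-(1 / 2) : ℝ))) r with hc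
  have hclt : c < ∞ := setLIntegral_rpow_lt_top (R + 1)
  refine ⟨P * c.toReal, by positivity, fun x hx ζ => ?_⟩
  let F : ℝ × R3 → ℝ≥0∞ := fun p => (univ ×ˢ Ω).indicator (fun p => ENNReal.ofReal
    (p.1 * psi ζ (dirVel x p.2 p.1) * ‖x - p.2‖ ^ (-(1 / 2) : ℝ))) p
  have hF : Measurable F := by
    refine Measurable.indicator (Measurable.ennreal_ofReal ?_) (MeasurableSet.univ.prod hΩ)
    exact (measurable_fst.mul ((measurable_psi ζ).comp (measurable_dirVel x))).mul
      ((by fun_prop : Measurable fun p : ℝ × R3 => ‖x - p.2‖).pow_const _)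
  have h1 : ∫⁻ p in Ioi (0 : ℝ) ×ˢ Ω, ENNReal.ofReal (dominator x ζ p) =
      ∫⁻ p, ENNReal.ofReal (jac x p) * F p
        ∂((volume.restrict (Ioi (0 : ℝ))).prod (volume : Measure R3)) := by
    have e1 : (volume.restrict (Ioi (0 : ℝ))).prod (volume : Measure R3) =
        volume.restrict (Ioi (0 : ℝ) ×ˢ univ) := by
      rw [Measure.volume_eq_prod, ← Measure.prod_restrict, Measure.restrict_univ]
    have e2 : ∀ p : ℝ × R3, ENNReal.ofReal (jac x p) * F p = (univ ×ˢ Ω).indicator (fun p =>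
        ENNReal.ofReal (jac x p) * ENNReal.ofReal
          (p.1 * psi ζ (dirVel x p.2 p.1) * ‖x - p.2‖ ^ (-(1 / 2) : ℝ))) p := by
      intro p
      by_cases hp : p ∈ univ ×ˢ Ω <;>
        simp only [F, indicator, hp, if_true, if_false, mul_zero]
    simp_rw [e2]
    rw [e1, setLIntegral_indicator (MeasurableSet.univ.prod hΩ), prod_inter_prod, univ_inter,
      inter_univ]
    refine setLIntegral_congr_fun (measurableSet_Ioi.prod hΩ) fun p hp => ?_
    have hp1 : 0 < p.1 := hp.1
    rw [← ENNReal.ofReal_mul (by unfold jac; positivity)]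
    congr 1
    unfold dominator jac
    rcases eq_or_ne x p.2 with h | h
    · rw [h, sub_self, norm_zero, Real.zero_rpow (by norm_num), Real.zero_rpow (by norm_num)]
      simp
    have hr : 0 < ‖x - p.2‖ := norm_pos_iff.2 (sub_ne_zero.2 h)
    rw [show (-(5 / 2) : ℝ) = -(1 / 2) + (-2 : ℝ) by norm_num, Real.rpow_add hr,
      Real.rpow_neg hr.le 2, Real.rpow_two]
    field_simp
  have h2 : ∫⁻ p in Ioi (0 : ℝ) ×ˢ Ω, ENNReal.ofReal (dominator x ζ p) ≤
      ENNReal.ofReal P * c := by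
    have hFT : Measurable fun q => F (speedPosition x q) := hF.comp (measurable_speedPosition x)
    rw [h1, ← lintegral_speedPosition x hF, lintegral_prod _ hFT.aemeasurable]
    have h3 : ∀ᵐ ζ' : R3, ∫⁻ t in Ioi (0 : ℝ), F (speedPosition x (ζ', t)) ≤
        ENNReal.ofReal (psi ζ ζ') * c := by
      filter_upwards [ae_ne 0] with ζ' hζ'
      have hn : 0 < ‖ζ'‖ := norm_pos_iff.2 hζ'
      have hgm : Measurable ((Iio (R + 1)).indicator
          fun r : ℝ => ENNReal.ofReal (r ^ (-(1 / 2) : ℝ))) :=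
        Measurable.indicator (Measurable.ennreal_ofReal (measurable_id.pow_const _))
          measurableSet_Iio
      have hgm' : Measurable fun t => (Iio (R + 1)).indicator
          (fun r : ℝ => ENNReal.ofReal (r ^ (-(1 / 2) : ℝ))) (t * ‖ζ'‖) :=
        hgm.comp (measurable_mul_const _)
      rw [hc, ← ofReal_mul_setLIntegral_comp_mul hn hgm, ← mul_assoc,
        ← lintegral_const_mul _ hgm']
      refine setLIntegral_mono' measurableSet_Ioi fun t ht => ?_
      have ht : 0 < t := ht
      have hpsi := psi_nonneg ζ ζ'
      by_cases hmem : speedPosition x (ζ', t) ∈ univ ×ˢ Ω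
      · have hxy : x - (speedPosition x (ζ', t)).2 = t • ζ' := by simp [speedPosition]
        have hlt : t * ‖ζ'‖ < R + 1 := by
          have := hR hx hmem.2
          rw [dist_eq_norm, hxy, norm_smul, Real.norm_of_nonneg ht.le] at this
          linarith
        simp only [F, indicator_of_mem hmem,
          indicator_of_mem (show t * ‖ζ'‖ ∈ Iio (R + 1) from hlt)]
        rw [dirVel_speedPosition x hζ' ht, hxy, norm_smul, Real.norm_of_nonneg ht.le,
          ← ENNReal.ofReal_mul hpsi, ← ENNReal.ofReal_mul (by positivity)]
        simp only [speedPosition]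
        rw [mul_comm ‖ζ'‖ (psi ζ ζ')]
      · simp only [F, indicator_of_notMem hmem]; exact zero_le
    refine (lintegral_mono_ae h3).trans ?_
    rw [lintegral_mul_const _ (measurable_psi ζ).ennreal_ofReal]
    gcongr
    rw [← ofReal_integral_eq_lintegral_ofReal (hP ζ).1
      (Filter.Eventually.of_forall (psi_nonneg ζ))]
    exact ENNReal.ofReal_le_ofReal (hP ζ).2
  have hnn := Filter.Eventually.of_forall (f := ae (volume.restrict (Ioi (0 : ℝ) ×ˢ Ω)))
    (dominator_nonneg x ζ)
  refine ⟨⟨(measurable_dominator x ζ).aestronglyMeasurable, ?_⟩, ?_⟩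
  · rw [hasFiniteIntegral_iff_ofReal hnn]
    exact h2.trans_lt (ENNReal.mul_lt_top ENNReal.ofReal_lt_top hclt)
  · rw [integral_eq_lintegral_of_nonneg_ae hnn (measurable_dominator x ζ).aestronglyMeasurable]
    refine (ENNReal.toReal_mono (ENNReal.mul_lt_top ENNReal.ofReal_lt_top hclt).ne h2).trans ?_
    rw [ENNReal.toReal_mul, ENNReal.toReal_ofReal hP0]

/-! ### Weights -/

theorem inv_sqrt_eq_rpow {ρ : ℝ} (hρ : 0 ≤ ρ) : (√ρ)⁻¹ = ρ ^ (-(1 / 2) : ℝ) := by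
  rw [Real.sqrt_eq_rpow, Real.rpow_neg hρ]

theorem sqrt_add_le {a b : ℝ} (ha : 0 ≤ a) (hb : 0 ≤ b) : √(a + b) ≤ √a + √b := by
  apply Real.sqrt_le_iff.2 ⟨by positivity, ?_⟩
  nlinarith [Real.sq_sqrt ha, Real.sq_sqrt hb, mul_nonneg (Real.sqrt_nonneg a) (Real.sqrt_nonneg b)]

/-- The weights in this and the three other bounds by `psi` that follow are the
velocity factors in the parts of the difference of two integrands that come, respectively,
from `|x - y|⁻²`, from the exponential, from `K f` and from the kernel `k`. -/
theorem norm_mul_inv_le_psi {ζ ζ' : R3} (h0 : ζ' ≠ 0) (h : ζ' ≠ ζ) :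
    ‖ζ'‖ * (‖ζ' - ζ‖⁻¹ * Real.exp (-‖ζ' - ζ‖ ^ 2 / 16)) ≤ ‖ζ'‖ ^ 2 * psi ζ ζ' := by
  have hρ := norm_pos_iff.2 h0
  have p1 := rpow_mul_rpow_mul_exp_le_psi (a := 1) (b := 1) (by norm_num) (by norm_num)
    (by norm_num) h0 h
  rw [Real.rpow_neg_one, Real.rpow_neg_one] at p1
  calc _ = ‖ζ'‖ ^ 2 * (‖ζ'‖⁻¹ * ‖ζ' - ζ‖⁻¹ * Real.exp (-‖ζ' - ζ‖ ^ 2 / 16)) := by field_simp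
    _ ≤ _ := by gcongr

theorem norm_mul_sqrt_div_mul_inv_le_psi {ζ ζ' : R3} (h0 : ζ' ≠ 0) (h : ζ' ≠ ζ) :
    ‖ζ'‖ * (√((1 + ‖ζ'‖) / ‖ζ'‖) * (‖ζ' - ζ‖⁻¹ * Real.exp (-‖ζ' - ζ‖ ^ 2 / 16))) ≤
      2 * (‖ζ'‖ ^ 2 * psi ζ ζ') := by
  have hρ := norm_pos_iff.2 h0
  have p1 := norm_mul_inv_le_psi h0 h
  have p2 := rpow_mul_rpow_mul_exp_le_psi (a := 3 / 2) (b := 1) (by norm_num) (by norm_num)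
    (by norm_num) h0 h
  rw [Real.rpow_neg_one, ← inv_sqrt_mul_inv hρ] at p2
  have h1 : √((1 + ‖ζ'‖) / ‖ζ'‖) ≤ (√‖ζ'‖)⁻¹ + 1 := by
    rw [add_div, div_self hρ.ne']
    refine (sqrt_add_le (by positivity) zero_le_one).trans ?_
    simp
  calc _ ≤ ‖ζ'‖ * (((√‖ζ'‖)⁻¹ + 1) * (‖ζ' - ζ‖⁻¹ * Real.exp (-‖ζ' - ζ‖ ^ 2 / 16))) := by gcongr
    _ = ‖ζ'‖ ^ 2 * ((√‖ζ'‖)⁻¹ * ‖ζ'‖⁻¹ * ‖ζ' - ζ‖⁻¹ * Real.exp (-‖ζ' - ζ‖ ^ 2 / 16)) +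
        ‖ζ'‖ * (‖ζ' - ζ‖⁻¹ * Real.exp (-‖ζ' - ζ‖ ^ 2 / 16)) := by field_simp
    _ ≤ ‖ζ'‖ ^ 2 * psi ζ ζ' + ‖ζ'‖ ^ 2 * psi ζ ζ' := by gcongr
    _ = _ := by ring

theorem mul_sqrt_eq {ρ : ℝ} (hρ : 0 < ρ) : ρ * √ρ = ρ ^ 2 * (√ρ)⁻¹ := by
  have := (Real.sqrt_pos.2 hρ).ne'
  have h3 := Real.sq_sqrt hρ.le
  field_simp
  exact h3

theorem norm_mul_sqrt_mul_inv_le_psi {ζ ζ' : R3} (h0 : ζ' ≠ 0) (h : ζ' ≠ ζ) :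
    ‖ζ'‖ * (√(‖ζ'‖ * (1 + ‖ζ'‖)) * (‖ζ' - ζ‖⁻¹ * Real.exp (-‖ζ' - ζ‖ ^ 2 / 16))) ≤
      2 * (‖ζ'‖ ^ 2 * psi ζ ζ') := by
  have hρ := norm_pos_iff.2 h0
  have p1 := rpow_mul_rpow_mul_exp_le_psi (a := 1 / 2) (b := 1) (by norm_num) (by norm_num)
    (by norm_num) h0 h
  have p2 := rpow_mul_exp_le_psi (b := 1) (by norm_num) (by norm_num) h
  rw [Real.rpow_neg_one, ← inv_sqrt_eq_rpow hρ.le] at p1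
  rw [Real.rpow_neg_one] at p2
  have h1 : √(‖ζ'‖ * (1 + ‖ζ'‖)) ≤ √‖ζ'‖ + ‖ζ'‖ := by
    rw [mul_add, mul_one]
    refine (sqrt_add_le hρ.le (by positivity)).trans ?_
    rw [Real.sqrt_mul_self hρ.le]
  calc _ ≤ ‖ζ'‖ * ((√‖ζ'‖ + ‖ζ'‖) * (‖ζ' - ζ‖⁻¹ * Real.exp (-‖ζ' - ζ‖ ^ 2 / 16))) := by gcongr
    _ = (‖ζ'‖ * √‖ζ'‖) * (‖ζ' - ζ‖⁻¹ * Real.exp (-‖ζ' - ζ‖ ^ 2 / 16)) +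
        ‖ζ'‖ ^ 2 * (‖ζ' - ζ‖⁻¹ * Real.exp (-‖ζ' - ζ‖ ^ 2 / 16)) := by ring
    _ = ‖ζ'‖ ^ 2 * ((√‖ζ'‖)⁻¹ * ‖ζ' - ζ‖⁻¹ * Real.exp (-‖ζ' - ζ‖ ^ 2 / 16)) +
        ‖ζ'‖ ^ 2 * (‖ζ' - ζ‖⁻¹ * Real.exp (-‖ζ' - ζ‖ ^ 2 / 16)) := by
      rw [mul_sqrt_eq hρ]; ring
    _ ≤ ‖ζ'‖ ^ 2 * psi ζ ζ' + ‖ζ'‖ ^ 2 * psi ζ ζ' := by gcongr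
    _ = _ := by ring

theorem norm_mul_sqrt_mul_rpow_le_psi {ζ ζ' : R3} (h0 : ζ' ≠ 0) (h : ζ' ≠ ζ) :
    ‖ζ'‖ * (√(‖ζ'‖ * (1 + ‖ζ‖)) * (‖ζ' - ζ‖ ^ (-(3 / 2) : ℝ) * Real.exp (-‖ζ' - ζ‖ ^ 2 / 16))) ≤
      3 * (‖ζ'‖ ^ 2 * psi ζ ζ') := by
  have hρ := norm_pos_iff.2 h0
  have hs := norm_pos_iff.2 (sub_ne_zero.2 h)
  have p1 := rpow_mul_rpow_mul_exp_le_psi (a := 1 / 2) (b := 3 / 2) (by norm_num) (by norm_num)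
    (by norm_num) h0 h
  have p2 := rpow_mul_exp_le_psi (b := 3 / 2) (by norm_num) (by norm_num) h
  have p3 := rpow_mul_rpow_mul_exp_le_psi (a := 1 / 2) (b := 1) (by norm_num) (by norm_num)
    (by norm_num) h0 h
  rw [← inv_sqrt_eq_rpow hρ.le] at p1 p3
  rw [Real.rpow_neg_one, ← sqrt_mul_rpow_neg hs] at p3
  have h1 : √(‖ζ'‖ * (1 + ‖ζ‖)) ≤ √‖ζ'‖ * (1 + √‖ζ'‖ + √‖ζ' - ζ‖) := by
    rw [Real.sqrt_mul hρ.le]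
    gcongr
    have h2 : 1 + ‖ζ‖ ≤ 1 + ‖ζ'‖ + ‖ζ' - ζ‖ := by
      have := norm_sub_le ζ' (ζ' - ζ)
      rw [sub_sub_cancel] at this; linarith
    refine (Real.sqrt_le_sqrt h2).trans ((sqrt_add_le (by positivity) hs.le).trans ?_)
    gcongr
    refine (sqrt_add_le zero_le_one hρ.le).trans ?_
    simp
  have hS0 : 0 ≤ ‖ζ' - ζ‖ ^ (-(3 / 2) : ℝ) := by positivity
  generalize ‖ζ' - ζ‖ ^ (-(3 / 2) : ℝ) = S at *
  have hS : 0 ≤ S * Real.exp (-‖ζ' - ζ‖ ^ 2 / 16) := by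
    positivity
  calc _ ≤ ‖ζ'‖ * ((√‖ζ'‖ * (1 + √‖ζ'‖ + √‖ζ' - ζ‖)) *
        (S * Real.exp (-‖ζ' - ζ‖ ^ 2 / 16))) := by gcongr
    _ = (‖ζ'‖ * √‖ζ'‖) * (S * Real.exp (-‖ζ' - ζ‖ ^ 2 / 16)) +
        ‖ζ'‖ * (√‖ζ'‖ * √‖ζ'‖) * (S * Real.exp (-‖ζ' - ζ‖ ^ 2 / 16)) +
        (‖ζ'‖ * √‖ζ'‖) * (√‖ζ' - ζ‖ * S * Real.exp (-‖ζ' - ζ‖ ^ 2 / 16)) := by ring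
    _ = ‖ζ'‖ ^ 2 * ((√‖ζ'‖)⁻¹ * S * Real.exp (-‖ζ' - ζ‖ ^ 2 / 16)) +
        ‖ζ'‖ ^ 2 * (S * Real.exp (-‖ζ' - ζ‖ ^ 2 / 16)) +
        ‖ζ'‖ ^ 2 * ((√‖ζ'‖)⁻¹ * (√‖ζ' - ζ‖ * S) * Real.exp (-‖ζ' - ζ‖ ^ 2 / 16)) := by
      rw [mul_sqrt_eq hρ, Real.mul_self_sqrt hρ.le]; ring
    _ ≤ ‖ζ'‖ ^ 2 * psi ζ ζ' + ‖ζ'‖ ^ 2 * psi ζ ζ' + ‖ζ'‖ ^ 2 * psi ζ ζ' := by gcongr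
    _ = _ := by ring

/-! ### The integrand in speed and position -/

theorem abs_collK_le {γ : ℝ} {β : ℝ → ℝ} {f : R3 → R3 → ℝ} {M c : ℝ} (hM : 0 ≤ M)
    {ζ : R3} (hi : Integrable (collisionKernel γ β ζ)) (hc : ∫ η, |collisionKernel γ β ζ η| ≤ c)
    {y : R3} (hf : ∀ η, |f y η| ≤ M) : |collK γ β f y ζ| ≤ c * M := by
  unfold collK
  rw [← Real.norm_eq_abs]
  refine (norm_integral_le_of_norm_le (hi.abs.mul_const M)
    (Filter.Eventually.of_forall fun η => ?_)).trans ?_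
  · rw [Real.norm_eq_abs, abs_mul]; gcongr; exact hf η
  · rw [integral_mul_const]; gcongr

theorem integrable_collisionKernel_mul {γ : ℝ} {β : ℝ → ℝ} {f : R3 → R3 → ℝ} {M : ℝ}
    {ζ : R3} (hi : Integrable (collisionKernel γ β ζ)) {y : R3} (hm : Measurable (f y))
    (hf : ∀ η, |f y η| ≤ M) : Integrable fun η => collisionKernel γ β ζ η * f y η :=
  hi.mul_bdd (c := M) hm.aestronglyMeasurable (Filter.Eventually.of_forall hf)

theorem abs_collK_sub_le {γ : ℝ} {β : ℝ → ℝ} {f : R3 → R3 → ℝ} {M c : ℝ} (hM : 0 ≤ M)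
    {ζ₀ ζ₁ : R3} (h0 : Integrable (collisionKernel γ β ζ₀))
    (h1 : Integrable (collisionKernel γ β ζ₁))
    (hc : ∫ η, |collisionKernel γ β ζ₀ η - collisionKernel γ β ζ₁ η| ≤ c)
    {y : R3} (hm : Measurable (f y)) (hf : ∀ η, |f y η| ≤ M) :
    |collK γ β f y ζ₀ - collK γ β f y ζ₁| ≤ c * M := by
  unfold collK
  rw [← integral_sub (integrable_collisionKernel_mul h0 hm hf)
    (integrable_collisionKernel_mul h1 hm hf), ← Real.norm_eq_abs]
  refine (norm_integral_le_of_norm_le ((h0.sub h1).abs.mul_const M)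
    (Filter.Eventually.of_forall fun η => ?_)).trans ?_
  · rw [Real.norm_eq_abs, ← sub_mul, abs_mul, Pi.sub_apply]; gcongr; exact hf η
  · rw [integral_mul_const]; simp only [Pi.sub_apply]; gcongr

theorem norm_dirVel_sub_le {x₀ x₁ y : R3} (h₀ : x₀ ≠ y) (h₁ : x₁ ≠ y) {ρ : ℝ} (hρ : 0 < ρ) :
    ‖dirVel x₀ y ρ - dirVel x₁ y ρ‖ ≤ 2 * (ρ * ‖x₀ - x₁‖ / ‖x₀ - y‖) := by
  have r0 : 0 < ‖x₀ - y‖ := norm_pos_iff.2 (sub_ne_zero.2 h₀)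
  have r1 : 0 < ‖x₁ - y‖ := norm_pos_iff.2 (sub_ne_zero.2 h₁)
  have hd : (x₀ - y) - (x₁ - y) = x₀ - x₁ := by abel
  have heq : dirVel x₀ y ρ - dirVel x₁ y ρ = (ρ / ‖x₀ - y‖) • (x₀ - x₁) +
      (ρ / ‖x₀ - y‖ * ((‖x₁ - y‖ - ‖x₀ - y‖) / ‖x₁ - y‖)) • (x₁ - y) := by
    rw [show ρ / ‖x₀ - y‖ * ((‖x₁ - y‖ - ‖x₀ - y‖) / ‖x₁ - y‖) = ρ / ‖x₀ - y‖ - ρ / ‖x₁ - y‖ by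
      field_simp, dirVel, dirVel]
    module
  have hn : |‖x₁ - y‖ - ‖x₀ - y‖| ≤ ‖x₀ - x₁‖ := by
    rw [abs_sub_comm, ← hd]; exact abs_norm_sub_norm_le _ _
  rw [heq]
  refine (norm_add_le _ _).trans ?_
  rw [norm_smul, norm_smul, Real.norm_of_nonneg (by positivity), Real.norm_eq_abs, abs_mul,
    abs_of_pos (by positivity : 0 < ρ / ‖x₀ - y‖), abs_div, abs_of_pos r1]
  calc _ = ρ / ‖x₀ - y‖ * ‖x₀ - x₁‖ + ρ / ‖x₀ - y‖ * |‖x₁ - y‖ - ‖x₀ - y‖| := by field_simp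
    _ ≤ ρ / ‖x₀ - y‖ * ‖x₀ - x₁‖ + ρ / ‖x₀ - y‖ * ‖x₀ - x₁‖ := by gcongr
    _ = _ := by ring

/-- The integrand of `G` in the variables speed and position, without the Jacobian. -/
noncomputable def velIntegrand (γ : ℝ) (β : ℝ → ℝ) (f : R3 → R3 → ℝ) (x ζ : R3)
    (p : ℝ × R3) : ℝ :=
  collisionKernel γ β ζ (dirVel x p.2 p.1) *
    Real.exp (-nu γ β (dirVel x p.2 p.1) * (‖x - p.2‖ / p.1)) *
    collK γ β f p.2 (dirVel x p.2 p.1)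

theorem spaceIntegrand_eq (γ : ℝ) (β : ℝ → ℝ) (f : R3 → R3 → ℝ) (x ζ : R3) (p : ℝ × R3) :
    spaceIntegrand γ β f x ζ p.1 p.2 = jac x p * velIntegrand γ β f x ζ p := by
  rw [spaceIntegrand, velIntegrand, jac, mul_comm]

theorem inv_sq_mul_inv_sqrt {r : ℝ} (hr : 0 < r) :
    (r ^ 2)⁻¹ * (√r)⁻¹ = r ^ (-(5 / 2) : ℝ) := by
  rw [inv_sqrt_eq_rpow hr.le, ← Real.rpow_two, ← Real.rpow_neg hr.le, ← Real.rpow_add hr]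
  norm_num

theorem sqrt_mul_div_mul_le {Δ ρ d r a : ℝ} (hρ : 0 < ρ) (hd : 0 ≤ d) (hr : 0 < r) (ha : 0 ≤ a)
    (h : Δ ≤ 2 * (ρ * d / r)) : √(Δ * (1 + a)) ≤ 2 * √d * (√r)⁻¹ * √(ρ * (1 + a)) := by
  apply Real.sqrt_le_iff.2 ⟨by positivity, ?_⟩
  rw [mul_pow, mul_pow, mul_pow, inv_pow, Real.sq_sqrt hd, Real.sq_sqrt hr.le,
    Real.sq_sqrt (by positivity)]
  calc Δ * (1 + a) ≤ 2 * (ρ * d / r) * (1 + a) := by gcongr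
    _ ≤ 4 * (ρ * d / r) * (1 + a) := by gcongr; norm_num
    _ = _ := by ring

theorem abs_exp_neg_sub_exp_neg_le {a b : ℝ} (ha : 0 ≤ a) (hb : 0 ≤ b) :
    |Real.exp (-a) - Real.exp (-b)| ≤ √|a - b| := by
  wlog hab : a ≤ b generalizing a b
  · rw [abs_sub_comm, abs_sub_comm a]; exact this hb ha (le_of_not_ge hab)
  have h1 : Real.exp (-b) ≤ Real.exp (-a) := Real.exp_le_exp.2 (by linarith)
  rw [abs_of_nonneg (by linarith), abs_sub_comm, abs_of_nonneg (by linarith)]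
  have h2 : Real.exp (-a) ≤ 1 := Real.exp_le_one_iff.2 (by linarith)
  have h3 : Real.exp (-b) = Real.exp (-a) * Real.exp (-(b - a)) := by
    rw [← Real.exp_add]; congr 1; ring
  have h4 := Real.add_one_le_exp (-(b - a))
  have h5 := Real.exp_pos (-(b - a))
  have h6 := Real.exp_pos (-a)
  have h7 : Real.exp (-a) - Real.exp (-b) ≤ min 1 (b - a) := by
    refine le_min (by linarith [Real.exp_pos (-b)]) ?_
    rw [h3]; nlinarith
  refine h7.trans ?_
  apply Real.le_sqrt_of_sq_le
  have hm0 : 0 ≤ min 1 (b - a) := le_min zero_le_one (by linarith)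
  nlinarith [min_le_left 1 (b - a), min_le_right 1 (b - a)]

theorem abs_div_sq_sub_div_sq_le {ρ d r₀ r₁ : ℝ} (hρ : 0 < ρ) (h₀ : 0 < r₀) (h₁ : 0 < r₁)
    (h₀₁ : r₀ ≤ r₁) (hd : |r₀ - r₁| ≤ d) :
    |ρ / r₀ ^ 2 - ρ / r₁ ^ 2| ≤ 2 * √d * (ρ * r₀ ^ (-(5 / 2) : ℝ)) := by
  have hd0 : 0 ≤ d := (abs_nonneg _).trans hd
  rw [abs_sub_comm, abs_of_nonneg (by linarith)] at hd
  have hx : 1 - (r₀ / r₁) ^ 2 ≤ 2 * √d * (√r₀)⁻¹ := by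
    have hq : 0 < r₀ / r₁ := by positivity
    have hq1 : r₀ / r₁ ≤ 1 := (div_le_one h₁).2 h₀₁
    refine (abs_le_of_sq_le_sq' ?_ (by positivity)).2
    rw [mul_pow, mul_pow, inv_pow, Real.sq_sqrt hd0, Real.sq_sqrt h₀.le]
    have h2 : 1 - r₀ / r₁ ≤ d * r₀⁻¹ := by
      calc 1 - r₀ / r₁ = (r₁ - r₀) * r₁⁻¹ := by field_simp
        _ ≤ d * r₀⁻¹ := by gcongr
    generalize r₀ / r₁ = q at *
    have h3 : (1 - q ^ 2) ^ 2 ≤ 4 * (1 - q) := by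
      have h4 : (1 - q) * (1 + q) ^ 2 ≤ 1 * 2 ^ 2 := by gcongr <;> linarith
      calc (1 - q ^ 2) ^ 2 = (1 - q) * ((1 - q) * (1 + q) ^ 2) := by ring
        _ ≤ (1 - q) * (1 * 2 ^ 2) := mul_le_mul_of_nonneg_left h4 (by linarith)
        _ = _ := by ring
    linarith
  rw [abs_of_nonneg (sub_nonneg.2 (by gcongr))]
  calc ρ / r₀ ^ 2 - ρ / r₁ ^ 2 = ρ * (r₀ ^ 2)⁻¹ * (1 - (r₀ / r₁) ^ 2) := by field_simp
    _ ≤ ρ * (r₀ ^ 2)⁻¹ * (2 * √d * (√r₀)⁻¹) := by gcongr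
    _ = _ := by rw [← inv_sq_mul_inv_sqrt h₀]; ring

/-- The integrand of `G` is bounded by the dominating function; the excess
power `r ^ (1 / 2)` of the distance is bounded on `Ω`. -/
theorem exists_abs_spaceIntegrand_le {γ : ℝ} {β : ℝ → ℝ} (hB : IsCutoffCrossSection γ β)
    (R : ℝ) : ∃ C : ℝ, 0 ≤ C ∧ ∀ (f : R3 → R3 → ℝ) (M : ℝ), 0 ≤ M →
      (∀ y η, |f y η| ≤ M) → ∀ (x y ζ : R3) (ρ : ℝ), 0 < ρ → x ≠ y → dirVel x y ρ ≠ ζ →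
      ‖x - y‖ ≤ R → |spaceIntegrand γ β f x ζ ρ y| ≤ C * M * dominator x ζ (ρ, y) := by
  obtain ⟨Ck, hCk0, hCk⟩ := exists_abs_collisionKernel_le hB
  obtain ⟨CK, hCK0, hCK⟩ := exists_integral_collisionKernel_le hB
  refine ⟨Ck * CK * √R, by positivity, fun f M hM hf x y ζ ρ hρ hxy hne hR => ?_⟩
  have r0 : 0 < ‖x - y‖ := norm_pos_iff.2 (sub_ne_zero.2 hxy)
  have hn := norm_dirVel hxy hρ
  have hK := abs_collK_le hM (hCK (dirVel x y ρ)).1 (hCK (dirVel x y ρ)).2 (hf y)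
  have hk := hCk ζ _ hne
  have hv0 : dirVel x y ρ ≠ 0 := by rw [← norm_pos_iff, hn]; exact hρ
  have hw := norm_mul_inv_le_psi hv0 hne
  have hnu := nu_nonneg hB (dirVel x y ρ)
  have he : Real.exp (-nu γ β (dirVel x y ρ) * (‖x - y‖ / ρ)) ≤ 1 := by
    rw [Real.exp_le_one_iff]
    have : 0 ≤ ‖x - y‖ / ρ := by positivity
    nlinarith
  have hr : (‖x - y‖ ^ 2)⁻¹ ≤ √R * ‖x - y‖ ^ (-(5 / 2) : ℝ) := by
    rw [← inv_sq_mul_inv_sqrt r0]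
    have := (Real.sqrt_pos.2 r0)
    calc (‖x - y‖ ^ 2)⁻¹ = √‖x - y‖ * ((‖x - y‖ ^ 2)⁻¹ * (√‖x - y‖)⁻¹) := by field_simp
      _ ≤ _ := by gcongr
  have hd : dominator x ζ (ρ, y) = ρ ^ 2 * psi ζ (dirVel x y ρ) * ‖x - y‖ ^ (-(5 / 2) : ℝ) := rfl
  rw [hn] at hw
  rw [hd, spaceIntegrand, abs_mul, abs_mul, abs_mul, abs_of_nonneg (Real.exp_pos _).le,
    abs_of_nonneg (by positivity : 0 ≤ ρ / ‖x - y‖ ^ 2)]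
  have hpsi := psi_nonneg ζ (dirVel x y ρ)
  calc _ ≤ (Ck * (‖dirVel x y ρ - ζ‖⁻¹ * Real.exp (-‖dirVel x y ρ - ζ‖ ^ 2 / 16))) * 1 * (CK * M) *
        (ρ / ‖x - y‖ ^ 2) := by gcongr
    _ = Ck * CK * M * (ρ * (‖dirVel x y ρ - ζ‖⁻¹ * Real.exp (-‖dirVel x y ρ - ζ‖ ^ 2 / 16))) *
        (‖x - y‖ ^ 2)⁻¹ := by ring
    _ ≤ Ck * CK * M * (ρ ^ 2 * psi ζ (dirVel x y ρ)) * (√R * ‖x - y‖ ^ (-(5 / 2) : ℝ)) := by gcongr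
    _ = _ := by ring

set_option maxHeartbeats 800000 in
/-- The integrand of `G` in the variables speed and position is half-Hölder in the base point, with
an integrable constant. -/
theorem exists_abs_spaceIntegrand_sub_le {γ : ℝ} {β : ℝ → ℝ} (hB : IsCutoffCrossSection γ β)
    (R : ℝ) : ∃ C : ℝ, 0 ≤ C ∧ ∀ (f : R3 → R3 → ℝ) (M : ℝ), 0 ≤ M → (∀ y, Measurable (f y)) →
      (∀ y η, |f y η| ≤ M) → ∀ (x₀ x₁ y ζ : R3) (ρ : ℝ), 0 < ρ → x₀ ≠ y → x₁ ≠ y →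
      dirVel x₀ y ρ ≠ ζ → dirVel x₁ y ρ ≠ ζ → ‖x₀ - y‖ ≤ R → ‖x₁ - y‖ ≤ R →
      |spaceIntegrand γ β f x₀ ζ ρ y - spaceIntegrand γ β f x₁ ζ ρ y| ≤
        C * M * √‖x₀ - x₁‖ * (dominator x₀ ζ (ρ, y) + dominator x₁ ζ (ρ, y)) := by
  obtain ⟨Ck, hCk0, hCk⟩ := exists_abs_collisionKernel_le hB
  obtain ⟨Cd, hCd0, hCd⟩ := exists_abs_collisionKernel_sub_le hB
  obtain ⟨CK, hCK0, hCK⟩ := exists_integral_collisionKernel_le hB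
  obtain ⟨CD, hCD0, hCD⟩ := exists_integral_collisionKernel_sub_le hB
  obtain ⟨Cn, hCn0, hCn⟩ := exists_nu_le hB
  refine ⟨2 * Ck * CK + 4 * Ck * CD + 2 * Ck * CK * √Cn * √R + 6 * Cd * CK, by positivity,
    fun f M hM hm hf x₀ x₁ y ζ ρ hρ h₀ h₁ n₀ n₁ hR₀ hR₁ => ?_⟩
  -- the base point nearer to `y` has the larger Jacobian
  wlog hle : ‖x₀ - y‖ ≤ ‖x₁ - y‖ generalizing x₀ x₁
  · rw [abs_sub_comm, norm_sub_rev x₀, add_comm (dominator x₀ ζ _)]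
    exact this x₁ x₀ h₁ h₀ n₁ n₀ hR₁ hR₀ (le_of_not_ge hle)
  have r0 : 0 < ‖x₀ - y‖ := norm_pos_iff.2 (sub_ne_zero.2 h₀)
  have r1 : 0 < ‖x₁ - y‖ := norm_pos_iff.2 (sub_ne_zero.2 h₁)
  have hrr : |‖x₀ - y‖ - ‖x₁ - y‖| ≤ ‖x₀ - x₁‖ := by
    refine (abs_norm_sub_norm_le _ _).trans (le_of_eq ?_); congr 1; abel
  have hΔ₀ := norm_dirVel_sub_le h₀ h₁ hρ
  have hΔ₁ := norm_dirVel_sub_le h₁ h₀ hρ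
  rw [norm_sub_rev, norm_sub_rev x₁ x₀] at hΔ₁
  have hv₀ := norm_dirVel h₀ hρ
  have hv₁ := norm_dirVel h₁ hρ
  have hJ := abs_div_sq_sub_div_sq_le hρ r0 r1 hle hrr
  have hd := norm_nonneg (x₀ - x₁)
  have hD₀ : dominator x₀ ζ (ρ, y) =
    ρ ^ 2 * psi ζ (dirVel x₀ y ρ) * ‖x₀ - y‖ ^ (-(5 / 2) : ℝ) := rfl
  have hD₁ : dominator x₁ ζ (ρ, y) =
    ρ ^ 2 * psi ζ (dirVel x₁ y ρ) * ‖x₁ - y‖ ^ (-(5 / 2) : ℝ) := rfl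
  have hnu := nu_nonneg hB (dirVel x₀ y ρ)
  rw [spaceIntegrand, spaceIntegrand,
    nu_eq_of_norm_eq γ β (hv₁.trans hv₀.symm : ‖dirVel x₁ y ρ‖ = ‖dirVel x₀ y ρ‖), hD₀, hD₁]
  generalize dirVel x₀ y ρ = ζ₀ at *
  generalize dirVel x₁ y ρ = ζ₁ at *
  have z₀ : ζ₀ ≠ 0 := by rw [← norm_pos_iff, hv₀]; exact hρ
  have z₁ : ζ₁ ≠ 0 := by rw [← norm_pos_iff, hv₁]; exact hρ
  have hk₀ := hCk ζ ζ₀ n₀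
  have hkd := hCd ζ ζ₀ ζ₁ n₀ n₁ (hv₀.trans hv₁.symm)
  have hF₀ := abs_collK_le hM (hCK ζ₀).1 (hCK ζ₀).2 (hf y)
  have hF₁ := abs_collK_le hM (hCK ζ₁).1 (hCK ζ₁).2 (hf y)
  have hFd := abs_collK_sub_le hM (hCK ζ₀).1 (hCK ζ₁).1 (hCD ζ₀ ζ₁ (hv₀.trans hv₁.symm)) (hm y)
    (hf y)
  have w1 := norm_mul_inv_le_psi z₀ n₀
  have w2 := norm_mul_sqrt_div_mul_inv_le_psi z₀ n₀
  have w3 := norm_mul_sqrt_mul_inv_le_psi z₀ n₀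
  have w4 := norm_mul_sqrt_mul_rpow_le_psi z₀ n₀
  have w5 := norm_mul_sqrt_mul_rpow_le_psi z₁ n₁
  have hn := hCn ζ₀
  have p₀ := psi_nonneg ζ ζ₀
  have p₁ := psi_nonneg ζ ζ₁
  have hz := norm_nonneg ζ
  have q₀ := inv_sq_mul_inv_sqrt r0
  have q₁ := inv_sq_mul_inv_sqrt r1
  rw [hv₀] at w1 w2 w3 w4 hn hFd
  rw [hv₁] at w5
  have W₀ : 0 ≤ ‖ζ₀ - ζ‖⁻¹ * Real.exp (-‖ζ₀ - ζ‖ ^ 2 / 16) := by positivity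
  have V₀ : 0 ≤ ‖ζ₀ - ζ‖ ^ (-(3 / 2) : ℝ) * Real.exp (-‖ζ₀ - ζ‖ ^ 2 / 16) := by positivity
  have V₁ : 0 ≤ ‖ζ₁ - ζ‖ ^ (-(3 / 2) : ℝ) * Real.exp (-‖ζ₁ - ζ‖ ^ 2 / 16) := by positivity
  generalize ‖ζ₀ - ζ‖⁻¹ * Real.exp (-‖ζ₀ - ζ‖ ^ 2 / 16) = a₀ at *
  generalize ‖ζ₀ - ζ‖ ^ (-(3 / 2) : ℝ) * Real.exp (-‖ζ₀ - ζ‖ ^ 2 / 16) = b₀ at *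
  generalize ‖ζ₁ - ζ‖ ^ (-(3 / 2) : ℝ) * Real.exp (-‖ζ₁ - ζ‖ ^ 2 / 16) = b₁ at *
  generalize psi ζ ζ₀ = P₀ at *
  generalize psi ζ ζ₁ = P₁ at *
  generalize ‖ζ₀ - ζ₁‖ = Δ at *
  generalize collisionKernel γ β ζ ζ₀ = k₀ at *
  generalize collisionKernel γ β ζ ζ₁ = k₁ at *
  generalize collK γ β f y ζ₀ = F₀ at *
  generalize collK γ β f y ζ₁ = F₁ at *
  generalize nu γ β ζ₀ = ν at *
  generalize ‖x₀ - y‖ = s₀ at *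
  generalize ‖x₁ - y‖ = s₁ at *
  generalize ‖x₀ - x₁‖ = d at *
  generalize ‖ζ‖ = z at *
  clear hCk hCd hCK hCD hCn hD₀ hD₁ hm hf
  have hu₀ : 0 ≤ s₀ ^ (-(5 / 2) : ℝ) := by positivity
  have hu₁ : 0 ≤ s₁ ^ (-(5 / 2) : ℝ) := by positivity
  generalize s₀ ^ (-(5 / 2) : ℝ) = u₀ at *
  generalize s₁ ^ (-(5 / 2) : ℝ) = u₁ at *
  have hB₁ : ρ / s₁ ^ 2 ≤ ρ * (s₀ ^ 2)⁻¹ := by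
    rw [div_eq_mul_inv]; gcongr
  have he₀ : |Real.exp (-ν * (s₀ / ρ))| ≤ 1 := by
    rw [abs_of_pos (Real.exp_pos _), Real.exp_le_one_iff, neg_mul]
    exact neg_nonpos.2 (by positivity)
  have he₁ : |Real.exp (-ν * (s₁ / ρ))| ≤ 1 := by
    rw [abs_of_pos (Real.exp_pos _), Real.exp_le_one_iff, neg_mul]
    exact neg_nonpos.2 (by positivity)
  have hed : |Real.exp (-ν * (s₀ / ρ)) - Real.exp (-ν * (s₁ / ρ))| ≤
      √Cn * √d * √((1 + ρ) / ρ) := by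
    rw [neg_mul, neg_mul]
    refine (abs_exp_neg_sub_exp_neg_le (by positivity) (by positivity)).trans ?_
    rw [← Real.sqrt_mul hCn0, ← Real.sqrt_mul (by positivity)]
    apply Real.sqrt_le_sqrt
    rw [show ν * (s₀ / ρ) - ν * (s₁ / ρ) = ν / ρ * (s₀ - s₁) by ring, abs_mul,
      abs_of_nonneg (by positivity)]
    calc ν / ρ * |s₀ - s₁| ≤ (Cn * (1 + ρ)) / ρ * d := by gcongr
      _ = _ := by ring
  generalize Real.exp (-ν * (s₀ / ρ)) = e₀ at *
  generalize Real.exp (-ν * (s₁ / ρ)) = e₁ at *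
  have hrR : (s₀ ^ 2)⁻¹ ≤ √R * u₀ := by
    rw [← q₀]
    have := (Real.sqrt_pos.2 r0)
    calc (s₀ ^ 2)⁻¹ = √s₀ * ((s₀ ^ 2)⁻¹ * (√s₀)⁻¹) := by field_simp
      _ ≤ _ := by gcongr
  have hB₁0 : 0 ≤ ρ / s₁ ^ 2 := by positivity
  -- `t1`, `t2`, `t3`, `t4` are the differences in the Jacobian, in `K f`, in the exponential and in
  -- the kernel; the smaller Jacobian `ρ / s₁²` goes with the last three
  have t1 : |k₀ * e₀ * F₀ * (ρ / s₀ ^ 2 - ρ / s₁ ^ 2)| ≤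
      2 * Ck * CK * M * √d * (ρ ^ 2 * P₀ * u₀) := by
    rw [abs_mul, abs_mul, abs_mul]
    calc _ ≤ (Ck * a₀) * 1 * (CK * M) * (2 * √d * (ρ * u₀)) := by gcongr
      _ = 2 * Ck * CK * M * √d * ((ρ * a₀) * u₀) := by ring
      _ ≤ _ := by gcongr
  have t2 : |k₀ * e₀ * (F₀ - F₁) * (ρ / s₁ ^ 2)| ≤ 4 * Ck * CD * M * √d * (ρ ^ 2 * P₀ * u₀) := by
    rw [abs_mul, abs_mul, abs_mul, abs_of_nonneg hB₁0]
    calc _ ≤ (Ck * a₀) * 1 * (CD * (2 * √d * (√s₀)⁻¹ * √(ρ * (1 + ρ))) * M) *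
          (ρ * (s₀ ^ 2)⁻¹) := by
          gcongr
          refine hFd.trans ?_
          gcongr
          exact sqrt_mul_div_mul_le hρ hd r0 hρ.le hΔ₀
      _ = 2 * Ck * CD * M * √d * ((ρ * (√(ρ * (1 + ρ)) * a₀)) * ((s₀ ^ 2)⁻¹ * (√s₀)⁻¹)) := by ring
      _ ≤ 2 * Ck * CD * M * √d * ((2 * (ρ ^ 2 * P₀)) * u₀) := by rw [q₀]; gcongr
      _ = _ := by ring
  have t3 : |k₀ * (e₀ - e₁) * F₁ * (ρ / s₁ ^ 2)| ≤
      2 * Ck * CK * √Cn * √R * M * √d * (ρ ^ 2 * P₀ * u₀) := by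
    rw [abs_mul, abs_mul, abs_mul, abs_of_nonneg hB₁0]
    calc _ ≤ (Ck * a₀) * (√Cn * √d * √((1 + ρ) / ρ)) * (CK * M) * (ρ * (√R * u₀)) := by
          gcongr
          exact hB₁.trans (by gcongr)
      _ = Ck * CK * √Cn * √R * M * √d * ((ρ * (√((1 + ρ) / ρ) * a₀)) * u₀) := by ring
      _ ≤ Ck * CK * √Cn * √R * M * √d * ((2 * (ρ ^ 2 * P₀)) * u₀) := by gcongr
      _ = _ := by ring
  have aux : ∀ s b P u : ℝ, 0 < s → 0 ≤ b → 0 ≤ u → Δ ≤ 2 * (ρ * d / s) → s ≤ s₁ →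
      (s ^ 2)⁻¹ * (√s)⁻¹ = u → ρ * (√(ρ * (1 + z)) * b) ≤ 3 * (ρ ^ 2 * P) →
      √(Δ * (1 + z)) * b * (ρ / s₁ ^ 2) ≤ 6 * √d * (ρ ^ 2 * P * u) := by
    intro s b P u hs hb hu hΔ hss hq hw
    have hBs : ρ / s₁ ^ 2 ≤ ρ * (s ^ 2)⁻¹ := by rw [div_eq_mul_inv]; gcongr
    calc _ ≤ (2 * √d * (√s)⁻¹ * √(ρ * (1 + z))) * b * (ρ * (s ^ 2)⁻¹) := by
          gcongr
          exact sqrt_mul_div_mul_le hρ hd hs hz hΔ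
      _ = 2 * √d * ((ρ * (√(ρ * (1 + z)) * b)) * ((s ^ 2)⁻¹ * (√s)⁻¹)) := by ring
      _ ≤ 2 * √d * ((3 * (ρ ^ 2 * P)) * u) := by rw [hq]; gcongr
      _ = _ := by ring
  have t4 : |(k₀ - k₁) * e₁ * F₁ * (ρ / s₁ ^ 2)| ≤
      6 * Cd * CK * M * √d * (ρ ^ 2 * P₀ * u₀ + ρ ^ 2 * P₁ * u₁) := by
    rw [abs_mul, abs_mul, abs_mul, abs_of_nonneg hB₁0]
    calc _ ≤ (Cd * (√(Δ * (1 + z)) * (b₀ + b₁))) * 1 * (CK * M) * (ρ / s₁ ^ 2) := by gcongr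
      _ = Cd * CK * M * (√(Δ * (1 + z)) * b₀ * (ρ / s₁ ^ 2) +
          √(Δ * (1 + z)) * b₁ * (ρ / s₁ ^ 2)) := by ring
      _ ≤ Cd * CK * M * (6 * √d * (ρ ^ 2 * P₀ * u₀) + 6 * √d * (ρ ^ 2 * P₁ * u₁)) := by
          refine mul_le_mul_of_nonneg_left (add_le_add ?_ ?_) (by positivity)
          · exact aux s₀ b₀ P₀ u₀ r0 V₀ hu₀ hΔ₀ hle q₀ w4
          · exact aux s₁ b₁ P₁ u₁ r1 V₁ hu₁ hΔ₁ le_rfl q₁ w5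
      _ = _ := by ring
  rw [show k₀ * e₀ * F₀ * (ρ / s₀ ^ 2) - k₁ * e₁ * F₁ * (ρ / s₁ ^ 2) =
    k₀ * e₀ * F₀ * (ρ / s₀ ^ 2 - ρ / s₁ ^ 2) + (k₀ * e₀ * (F₀ - F₁) * (ρ / s₁ ^ 2) +
      (k₀ * (e₀ - e₁) * F₁ * (ρ / s₁ ^ 2) + (k₀ - k₁) * e₁ * F₁ * (ρ / s₁ ^ 2))) by ring]
  refine (abs_add_le _ _).trans ((add_le_add t1 ((abs_add_le _ _).trans (add_le_add t2
    ((abs_add_le _ _).trans (add_le_add t3 t4))))).trans ?_)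
  have hX : 0 ≤ (2 * Ck * CK + 4 * Ck * CD + 2 * Ck * CK * √Cn * √R) * M * √d *
      (ρ ^ 2 * P₁ * u₁) := by positivity
  linarith

/-! ### Measurable representatives and the formula for `G` -/

theorem normLinf_nonneg (Ω : Set R3) (f : R3 → R3 → ℝ) : 0 ≤ normLinf Ω f :=
  ENNReal.toReal_nonneg

/-- A function in `L^∞` agrees, for almost every position and then almost every velocity, with a
Borel function that is bounded everywhere by the norm. -/
theorem exists_bounded_representative {Ω : Set R3} {f : R3 → R3 → ℝ} (hf : MemLinf Ω f) :
    ∃ g : R3 → R3 → ℝ, Measurable (Function.uncurry g) ∧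
      (∀ y η, |g y η| ≤ normLinf Ω f) ∧
      ∀ᵐ y ∂(volume.restrict Ω), ∀ᵐ η, f y η = g y η := by
  have hM := normLinf_nonneg Ω f
  have hbound : ∀ᵐ q : R3 × R3 ∂(volume.restrict (Ω ×ˢ univ)), |f q.1 q.2| ≤ normLinf Ω f := by
    have h := ae_le_eLpNormEssSup (f := fun q : R3 × R3 => f q.1 q.2)
      (μ := volume.restrict (Ω ×ˢ univ))
    filter_upwards [h] with q hq
    have hlt := hf.2
    rw [eLpNorm_exponent_top] at hlt
    have := ENNReal.toReal_mono hlt.ne hq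
    rw [toReal_enorm] at this
    rw [normLinf, eLpNorm_exponent_top]
    exact this
  refine ⟨fun y η => max (-normLinf Ω f) (min (normLinf Ω f) (hf.1.mk _ (y, η))), ?_, ?_, ?_⟩
  · exact measurable_const.max (measurable_const.min hf.1.stronglyMeasurable_mk.measurable)
  · intro y η
    exact abs_le.2 ⟨le_max_left _ _, max_le (by linarith) (min_le_left _ _)⟩
  · have hae : ∀ᵐ q : R3 × R3 ∂((volume.restrict Ω).prod volume), f q.1 q.2 =
        max (-normLinf Ω f) (min (normLinf Ω f) (hf.1.mk _ q)) := by
      have hprod : (volume.restrict Ω).prod (volume : Measure R3) =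
          volume.restrict (Ω ×ˢ (univ : Set R3)) := by
        rw [Measure.volume_eq_prod, ← Measure.prod_restrict, Measure.restrict_univ]
      rw [hprod]
      filter_upwards [hbound, hf.1.ae_eq_mk] with q h1 h2
      rw [← h2, min_eq_right (abs_le.1 h1).2, max_eq_right (abs_le.1 h1).1]
    exact Measure.ae_ae_of_ae_prod hae

theorem ae_collK_eq {γ : ℝ} {β : ℝ → ℝ} {Ω : Set R3} {f g : R3 → R3 → ℝ}
    (h : ∀ᵐ y ∂(volume.restrict Ω), ∀ᵐ η, f y η = g y η) :
    ∀ᵐ y ∂(volume.restrict Ω), ∀ ζ, collK γ β f y ζ = collK γ β g y ζ := by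
  filter_upwards [h] with y hy ζ
  exact integral_congr_ae (hy.mono fun η hη => by simp only [hη])

theorem measurable_collK {γ : ℝ} {β : ℝ → ℝ} (hβ : Measurable β) {g : R3 → R3 → ℝ}
    (hg : Measurable (Function.uncurry g)) :
    Measurable fun q : R3 × R3 => collK γ β g q.1 q.2 := by
  have m1 : Measurable fun q : (R3 × R3) × R3 => (q.1.2, q.2) := by fun_prop
  have m2 : Measurable fun q : (R3 × R3) × R3 => (q.1.1, q.2) := by fun_prop
  have h1 := (measurable_collisionKernel γ hβ).comp m1
  have h2 := hg.comp m2
  have : StronglyMeasurable (Function.uncurry fun (q : R3 × R3) (η : R3) =>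
      collisionKernel γ β q.2 η * g q.1 η) := (h1.mul h2).stronglyMeasurable
  exact (this.integral_prod_right (ν := (volume : Measure R3))).measurable

theorem measurable_velIntegrand {γ : ℝ} {β : ℝ → ℝ} (hβ : Measurable β) {g : R3 → R3 → ℝ}
    (hg : Measurable (Function.uncurry g)) (x ζ : R3) :
    Measurable (velIntegrand γ β g x ζ) := by
  have hd := measurable_dirVel x
  have h1 := (measurable_collisionKernel γ hβ).comp ((measurable_const (a := ζ)).prodMk hd)
  have h2 := Real.measurable_exp.comp (((measurable_nu γ β).comp hd).neg.mul
    (by fun_prop : Measurable fun p : ℝ × R3 => ‖x - p.2‖ / p.1))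
  have h3 := (measurable_collK (γ := γ) hβ hg).comp (measurable_snd.prodMk hd)
  exact (h1.mul h2).mul h3

theorem volume_restrict_Ioi_prod (Ω : Set R3) :
    (volume : Measure (ℝ × R3)).restrict (Ioi (0 : ℝ) ×ˢ Ω) =
      (volume.restrict (Ioi (0 : ℝ))).prod (volume.restrict Ω) := by
  rw [Measure.volume_eq_prod, Measure.prod_restrict]

theorem ae_velIntegrand_eq {γ : ℝ} {β : ℝ → ℝ} {Ω : Set R3} {f g : R3 → R3 → ℝ}
    (h : ∀ᵐ y ∂(volume.restrict Ω), ∀ᵐ η, f y η = g y η) (x ζ : R3) :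
    velIntegrand γ β f x ζ =ᵐ[volume.restrict (Ioi (0 : ℝ) ×ˢ Ω)] velIntegrand γ β g x ζ := by
  rw [volume_restrict_Ioi_prod]
  have := Measure.quasiMeasurePreserving_snd (μ := volume.restrict (Ioi (0 : ℝ)))
    (ν := volume.restrict Ω) |>.ae (ae_collK_eq (γ := γ) (β := β) h)
  filter_upwards [this] with p hp
  rw [velIntegrand, velIntegrand, hp]

theorem ae_dirVel_ne {Ω : Set R3} (hΩ : MeasurableSet Ω) (x ζ : R3) :
    ∀ᵐ p ∂(volume : Measure (ℝ × R3)).restrict (Ioi (0 : ℝ) ×ˢ Ω),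
      x ≠ p.2 ∧ dirVel x p.2 p.1 ≠ ζ := by
  have h1 : ∀ᵐ p ∂(volume : Measure (ℝ × R3)).restrict (Ioi (0 : ℝ) ×ˢ Ω), p.2 ≠ x := by
    rw [volume_restrict_Ioi_prod]
    exact Measure.quasiMeasurePreserving_snd.ae (ae_restrict_of_ae (ae_ne x))
  have h2 : ∀ᵐ p ∂(volume : Measure (ℝ × R3)).restrict (Ioi (0 : ℝ) ×ˢ Ω), p.1 ≠ ‖ζ‖ := by
    rw [volume_restrict_Ioi_prod]
    exact Measure.quasiMeasurePreserving_fst.ae (ae_restrict_of_ae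
      (by simp [ae_iff] : ∀ᵐ t : ℝ, t ≠ ‖ζ‖))
  filter_upwards [h1, h2, ae_restrict_mem (measurableSet_Ioi.prod hΩ)] with p hp1 hp2 hp
  refine ⟨hp1.symm, fun h => hp2 ?_⟩
  rw [← h, norm_dirVel hp1.symm hp.1]

/-- The times at which the backward trajectory is in `Ω` form the interval `(0, τ_-)`. -/
theorem mem_Ioo_tauMinus_iff {Ω : Set R3} (ho : IsOpen Ω) (hc : Convex ℝ Ω)
    (hb : Bornology.IsBounded Ω) {x : R3} (hx : x ∈ Ω) {ζ : R3} (hζ : ζ ≠ 0) :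
    0 ≤ tauMinus Ω x ζ ∧
      ∀ t, t ∈ Ioo 0 (tauMinus Ω x ζ) ↔ t ∈ Ioi (0 : ℝ) ∩ {t | x - t • ζ ∈ Ω} := by
  set S := {t : ℝ | 0 ≤ t ∧ x - t • ζ ∉ Ω} with hS
  have hn : 0 < ‖ζ‖ := norm_pos_iff.2 hζ
  have hne : S.Nonempty := by
    obtain ⟨R, hR⟩ := Metric.isBounded_iff.1 hb
    have hR0 : 0 ≤ R := dist_nonneg.trans (hR hx hx)
    refine ⟨(R + 1) / ‖ζ‖, by positivity, fun hmem => ?_⟩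
    have := hR hx hmem
    rw [dist_eq_norm, sub_sub_cancel, norm_smul, Real.norm_of_nonneg (by positivity),
      div_mul_cancel₀ _ hn.ne'] at this
    linarith
  have hcl : IsClosed S := by
    have : S = Ici 0 ∩ (fun t : ℝ => x - t • ζ) ⁻¹' Ωᶜ := rfl
    rw [this]
    exact isClosed_Ici.inter (ho.isClosed_compl.preimage (by fun_prop))
  have hbd : BddBelow S := ⟨0, fun t ht => ht.1⟩
  have hmem : tauMinus Ω x ζ ∈ S := hcl.csInf_mem hne hbd
  refine ⟨hmem.1, fun t => ⟨fun ht => ⟨ht.1, ?_⟩, fun ht => ⟨ht.1, ?_⟩⟩⟩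
  · by_contra hcon
    exact absurd (csInf_le hbd (show t ∈ S from ⟨ht.1.le, hcon⟩)) (not_le.2 ht.2)
  · by_contra hcon
    have ht0 : 0 < t := ht.1
    have hle : tauMinus Ω x ζ ≤ t := not_lt.1 hcon
    refine hmem.2 ?_
    have h1 : x - tauMinus Ω x ζ • ζ = (1 - tauMinus Ω x ζ / t) • x +
        (tauMinus Ω x ζ / t) • (x - t • ζ) := by
      rw [smul_sub, smul_smul, div_mul_cancel₀ _ ht0.ne', sub_smul, one_smul]; abel
    rw [h1]
    exact hc hx ht.2 (sub_nonneg.2 ((div_le_one ht0).2 hle)) (div_nonneg hmem.1 ht0.le) (by ring)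

theorem ae_trajMeasure {Ω : Set R3} (hΩ : MeasurableSet Ω) (x : R3) :
    ∀ᵐ q ∂(trajMeasure Ω x), q.1 ≠ 0 ∧ 0 < q.2 ∧ x - q.2 • q.1 ∈ Ω := by
  have h1 : ∀ᵐ q ∂((volume : Measure R3).prod (volume.restrict (Ioi (0 : ℝ)))), q.1 ≠ 0 :=
    Measure.quasiMeasurePreserving_fst.ae (ae_ne 0)
  have h2 : ∀ᵐ q ∂((volume : Measure R3).prod (volume.restrict (Ioi (0 : ℝ)))), 0 < q.2 :=
    Measure.quasiMeasurePreserving_snd.ae (ae_restrict_mem measurableSet_Ioi)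
  have hm := measurable_speedPosition x (MeasurableSet.univ.prod hΩ)
  filter_upwards [ae_restrict_of_ae h1, ae_restrict_of_ae h2, ae_restrict_mem hm] with q a b c
  exact ⟨a, b, c.2⟩

/-- The function `G` as an integral over velocities and times. -/
theorem G_eq_integral_trajMeasure {γ : ℝ} {β : ℝ → ℝ} {Ω : Set R3} (ho : IsOpen Ω)
    (hc : Convex ℝ Ω) (hb : Bornology.IsBounded Ω) (f : R3 → R3 → ℝ) {x : R3} (hx : x ∈ Ω) (ζ : R3)
    (hi : Integrable (fun q => velIntegrand γ β f x ζ (speedPosition x q)) (trajMeasure Ω x)) :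
    G γ β Ω f x ζ = ∫ q, velIntegrand γ β f x ζ (speedPosition x q) ∂(trajMeasure Ω x) := by
  have hΩ := ho.measurableSet
  have hm := measurable_speedPosition x (MeasurableSet.univ.prod hΩ)
  let A : R3 × ℝ → ℝ := fun q => collisionKernel γ β ζ q.1 *
    Real.exp (-nu γ β q.1 * q.2) * collK γ β f (x - q.2 • q.1) q.1
  have hA : (fun q => velIntegrand γ β f x ζ (speedPosition x q)) =ᵐ[trajMeasure Ω x] A := by
    filter_upwards [ae_trajMeasure hΩ x] with q hq
    have hn := norm_ne_zero_iff.2 hq.1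
    have h1 : ‖x - (speedPosition x q).2‖ / (speedPosition x q).1 = q.2 := by
      simp only [speedPosition, sub_sub_cancel, norm_smul, Real.norm_of_nonneg hq.2.1.le]
      field_simp
    rw [velIntegrand, dirVel_speedPosition x hq.1 hq.2.1, h1]
    rfl
  rw [integrable_congr hA, trajMeasure, ← IntegrableOn, ← integrable_indicator_iff hm] at hi
  rw [integral_congr_ae hA, trajMeasure, ← integral_indicator hm, integral_prod _ hi]
  refine integral_congr_ae ?_
  filter_upwards [ae_ne 0] with ζ' hζ'
  obtain ⟨h0, hiff⟩ := mem_Ioo_tauMinus_iff ho hc hb hx hζ'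
  have hset : Ioo 0 (tauMinus Ω x ζ') = Ioi (0 : ℝ) ∩ {t | x - t • ζ' ∈ Ω} :=
    Set.ext hiff
  have hms : MeasurableSet {t : ℝ | x - t • ζ' ∈ Ω} :=
    (by fun_prop : Measurable fun t : ℝ => x - t • ζ') hΩ
  have hind : ∀ t, (speedPosition x ⁻¹' univ ×ˢ Ω).indicator A (ζ', t) =
      {t | x - t • ζ' ∈ Ω}.indicator (fun t => A (ζ', t)) t := by
    intro t
    have hmem : (ζ', t) ∈ speedPosition x ⁻¹' univ ×ˢ Ω ↔ x - t • ζ' ∈ Ω :=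
      ⟨fun h => h.2, fun h => ⟨trivial, h⟩⟩
    by_cases h : x - t • ζ' ∈ Ω
    · rw [indicator_of_mem (hmem.2 h), indicator_of_mem (show t ∈ {t | x - t • ζ' ∈ Ω} from h)]
    · rw [indicator_of_notMem (mt hmem.1 h),
        indicator_of_notMem (show t ∉ {t | x - t • ζ' ∈ Ω} from h)]
  simp_rw [hind]
  rw [setIntegral_indicator hms, ← hset, ← integral_Ioc_eq_integral_Ioo,
    intervalIntegral.integral_of_le h0]

end LinBoltzmann

open LinBoltzmann in
theorem mainTheorem2 (γ : ℝ) (β : ℝ → ℝ) (hB : LinBoltzmann.IsCutoffCrossSection γ β)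
    (Ω : Set LinBoltzmann.R3) (hΩ_open : IsOpen Ω) (hΩ_convex : Convex ℝ Ω)
    (hΩ_bounded : Bornology.IsBounded Ω) (hΩ_C1 : LinBoltzmann.HasC1Boundary Ω) :
    ∃ C₃ : ℝ, ∀ f : LinBoltzmann.R3 → LinBoltzmann.R3 → ℝ,
      LinBoltzmann.MemLinf Ω f → LinBoltzmann.IsStationarySolution γ β Ω f →
      (∀ x₀ ∈ Ω, ∀ ζ : LinBoltzmann.R3,
        IntegrableOn
          (fun q : ℝ × LinBoltzmann.R3 => LinBoltzmann.spaceIntegrand γ β f x₀ ζ q.1 q.2)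
          (Ioi (0 : ℝ) ×ˢ Ω) ∧
        LinBoltzmann.G γ β Ω f x₀ ζ =
          ∫ ρ in Ioi (0 : ℝ), ∫ y in Ω, LinBoltzmann.spaceIntegrand γ β f x₀ ζ ρ y) ∧
      (∀ x₀ ∈ Ω, ∀ x₁ ∈ Ω, ∀ ζ : LinBoltzmann.R3,
        |LinBoltzmann.G γ β Ω f x₀ ζ - LinBoltzmann.G γ β Ω f x₁ ζ| ≤
          C₃ * LinBoltzmann.normLinf Ω f * ‖x₀ - x₁‖ ^ (1 / 2 : ℝ)) := by
  have hΩ := hΩ_open.measurableSet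
  obtain ⟨R, hR⟩ := Metric.isBounded_iff.1 hΩ_bounded
  obtain ⟨Cs, hCs0, hCs⟩ := exists_abs_spaceIntegrand_le hB R
  obtain ⟨Cd, hCd0, hCd⟩ := exists_abs_spaceIntegrand_sub_le hB R
  obtain ⟨D, hD0, hD⟩ := exists_integral_dominator_le hΩ hΩ_bounded
  refine ⟨Cd * (2 * D), fun f hf _ => ?_⟩
  -- the integrals below do not change if `f` is replaced by a bounded Borel representative
  obtain ⟨g, hgm, hgb, hfg⟩ := exists_bounded_representative hf
  have hM := normLinf_nonneg Ω f
  have hgy : ∀ y, Measurable (g y) := fun y => hgm.comp measurable_prodMk_left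
  have hR' : ∀ x ∈ Ω, ∀ y ∈ Ω, ‖x - y‖ ≤ R := fun x hx y hy => by
    rw [← dist_eq_norm]; exact hR hx hy
  have hsub : ∀ x ζ : R3, (fun q : ℝ × R3 => spaceIntegrand γ β f x ζ q.1 q.2)
      =ᵐ[volume.restrict (Ioi (0 : ℝ) ×ˢ Ω)] fun q => spaceIntegrand γ β g x ζ q.1 q.2 := by
    intro x ζ
    filter_upwards [ae_velIntegrand_eq (γ := γ) (β := β) hfg x ζ] with q hq
    rw [spaceIntegrand_eq, spaceIntegrand_eq, hq]
  have hgmeas : ∀ x ζ : R3, Measurable fun q : ℝ × R3 => spaceIntegrand γ β g x ζ q.1 q.2 := by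
    intro x ζ
    simp_rw [spaceIntegrand_eq]
    exact (measurable_jac x).mul (measurable_velIntegrand hB.measurable_beta hgm x ζ)
  have hint : ∀ x ∈ Ω, ∀ ζ : R3, IntegrableOn
      (fun q : ℝ × R3 => spaceIntegrand γ β f x ζ q.1 q.2) (Ioi (0 : ℝ) ×ˢ Ω) := by
    intro x hx ζ
    refine Integrable.congr ?_ (hsub x ζ).symm
    refine ((hD x hx ζ).1.const_mul (Cs * normLinf Ω f)).mono' (hgmeas x ζ).aestronglyMeasurable ?_
    filter_upwards [ae_dirVel_ne hΩ x ζ, ae_restrict_mem (measurableSet_Ioi.prod hΩ)] with q h1 h2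
    exact hCs g _ hM hgb x q.2 ζ q.1 h2.1 h1.1 h1.2 (hR' x hx q.2 h2.2)
  have hG : ∀ x ∈ Ω, ∀ ζ : R3, G γ β Ω f x ζ =
      ∫ q in Ioi (0 : ℝ) ×ˢ Ω, spaceIntegrand γ β f x ζ q.1 q.2 := by
    intro x hx ζ
    have hmeas : AEStronglyMeasurable (velIntegrand γ β f x ζ)
        (volume.restrict (Ioi (0 : ℝ) ×ˢ Ω)) :=
      (measurable_velIntegrand hB.measurable_beta hgm x ζ).aestronglyMeasurable.congr
        (ae_velIntegrand_eq hfg x ζ).symm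
    have h1 := hint x hx ζ
    simp_rw [spaceIntegrand_eq] at h1 ⊢
    rw [G_eq_integral_trajMeasure hΩ_open hΩ_convex hΩ_bounded f hx ζ
      ((integrable_comp_speedPosition_iff hΩ x hmeas).2 h1), integral_comp_speedPosition hΩ x hmeas]
  refine ⟨fun x hx ζ => ⟨hint x hx ζ, ?_⟩, fun x₀ hx₀ x₁ hx₁ ζ => ?_⟩
  · rw [hG x hx ζ, Measure.volume_eq_prod, setIntegral_prod]
    rw [← Measure.volume_eq_prod]
    exact hint x hx ζ
  · rw [hG x₀ hx₀ ζ, hG x₁ hx₁ ζ, ← integral_sub (hint x₀ hx₀ ζ) (hint x₁ hx₁ ζ),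
      ← Real.sqrt_eq_rpow, ← Real.norm_eq_abs]
    obtain ⟨i0, b0⟩ := hD x₀ hx₀ ζ
    obtain ⟨i1, b1⟩ := hD x₁ hx₁ ζ
    refine (norm_integral_le_of_norm_le ((i0.add i1).const_mul
      (Cd * normLinf Ω f * √‖x₀ - x₁‖)) ?_).trans ?_
    · filter_upwards [ae_dirVel_ne hΩ x₀ ζ, ae_dirVel_ne hΩ x₁ ζ, hsub x₀ ζ, hsub x₁ ζ,
        ae_restrict_mem (measurableSet_Ioi.prod hΩ)] with q h0 h1 e0 e1 hq
      rw [e0, e1]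
      exact hCd g _ hM hgy hgb x₀ x₁ q.2 ζ q.1 hq.1 h0.1 h1.1 h0.2 h1.2 (hR' x₀ hx₀ q.2 hq.2)
        (hR' x₁ hx₁ q.2 hq.2)
    · simp only [Pi.add_apply]
      rw [integral_const_mul, integral_add i0 i1]
      calc _ ≤ Cd * normLinf Ω f * √‖x₀ - x₁‖ * (D + D) := by gcongr
        _ = _ := by ring
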